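/- Let $d\ge 1$ be an integer and let $\alpha>0$ be a real number that is not an integer. Let $\mathcal H_0$ be the Hilbert space with orthonormal basis $e_{\mathfrak n}$, $\mathfrak n=(n_1,\dots,n_d)\in\mathbb N_0^d$, put $|\mathfrak n|=n_1+\dots+n_d$, and let $\mathcal D_0\subseteq\mathcal H_0$ be the dense subspace of all $\varphi=\sum\varphi_{\mathfrak n}e_{\mathfrak n}$ with $\sum_{\mathfrak n}(1+|\mathfrak n|)^r|\varphi_{\mathfrak n}|^2<\infty$ for all $r\in\mathbb N_0$. On $\mathcal D_0$ define $$a_k e_{\mathfrak n}=\sqrt{n_k}\,e_{\mathfrak n-1_k},\qquad a_{-k}e_{\mathfrak n}=\sqrt{n_k+1}\,e_{\mathfrak n+1_k}\quad(k=1,\dots,d),\qquad a_0=1,\qquad Ne_{\mathfrak n}=|\mathfrak n|e_{\mathfrak n},$$ where $1_k$ is the $k$-th unit multi-index and $e_{\mathfrak n-1_k}=0$ if $n_k=0$. For $k,l\in\{-d,\dots,d\}$ and $n\in\mathbb N_0$ put $$x_{kl}=a_ka_l(N+\alpha)^{-1}\ \text{ if } k>0\text{ or }l>0,\qquad x_{kl}=(N+\alpha)^{-1}a_ka_l\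 \text{ if } k\le 0\text{ and }l\le 0,\qquad y_n=(N+\alpha+n)^{-1},$$ and $x_k=x_{k0}$, $x^{\mathfrak n}=x_1^{n_1}\cdots x_d^{n_d}$. Let $\mathcal X$ be the unital $*$-algebra of operators on $\mathcal D_0$ generated by all $x_{kl}$ and $y_n$, the involution being the formal adjoint on $\mathcal D_0$. Let $\pi$ be a $*$-representation of $\mathcal X$ on a dense subspace $\mathcal D$ of a complex Hilbert space $\mathcal H$, that is, a unital algebra homomorphism of $\mathcal X$ into the linear operators $\mathcal D\to\mathcal D$ such that $\langle\pi(x)\varphi,\psi\rangle=\langle\varphi,\pi(x^*)\psi\rangle$ for all $x\in\mathcal X$ and $\varphi,\psi\in\mathcal D$. Then: 1. For each $x\in\mathcal X$ the operator $\pi(x)$ is bounded. The continuous extensions of the $\pi(x)$ to $\mathcal H$ form a $*$-representation of $\mathcal X$ by bounded operators on $\mathcal H$, denoted again by $\pi$. In particular all $x\in\mathcal X$ are bounded on $\mathcal D_0$, and their continuous extensions $\rho(x)=\overline{x}$ form a $*$-representation $\rho$ of $\mathcal X$ on $\mathcal H_0$, the identity representation. 2. Let $\mathcal H_\infty=\ker\pi(y_0)$,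 let $\mathcal K_0=\ker(\pi(y_0)-\alpha^{-1})$, and let $\mathcal H_1$ be the closed linear span of the spaces $\pi(x^{\mathfrak n})^*\mathcal K_0$, $\mathfrak n\in\mathbb N_0^d$. Then $\mathcal H=\mathcal H_1\oplus\mathcal H_\infty$ is an orthogonal decomposition into invariant subspaces of $\pi$, so that $\pi=\pi_1\oplus\pi_\infty$, where $\pi_1$ and $\pi_\infty$ are the restrictions of $\pi$ to $\mathcal H_1$ and $\mathcal H_\infty$. 3. $\pi_1$ is a (possibly empty) Hilbert space direct sum of representations each unitarily equivalent to the identity representation $\rho$. 4. $\pi_\infty(y_n)=0$ for all $n\in\mathbb N_0$ and $\pi_\infty(x_{k0})=\pi_\infty(x_{0k})=0$ for $k=-d,\dots,d$. Moreover there is a spectral (projection-valued) measure $E$ on the Borel sets of the unit sphere $S^d=\{z\in\mathbb C^d:|z_1|^2+\dots+|z_d|^2=1\}$, with values in the orthogonal projections of $\mathcal H_\infty$ and $E(S^d)=I$, such that for all $k,l=1,\dots,d$ $$\pi_\infty(x_{kl})=\int_{S^d}z_kz_l\,dE,\qquad \pi_\infty(x_{k,-l})=\pi_\infty(x_{-l,k})=\int_{S^d}z_k\overline{z_l}\,dE,\qquad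 \pi_\infty(x_{-k,-l})=\int_{S^d}\overline{z_k}\,\overline{z_l}\,dE .$$ -/

import Mathlib

open scoped InnerProductSpace ENNReal

universe u

noncomputable section

namespace WeylAux

/-! ### Adjointable operators on a pre-Hilbert space -/

section Adjointable

variable (D : Type*) [NormedAddCommGroup D] [InnerProductSpace ℂ D]

/-- The algebra of all linear operators `T : D → D` that possess a formal adjoint `S : D → D`,
that is, `⟪T φ, ψ⟫ = ⟪φ, S ψ⟫` on `D`. -/
def adjointable : Subalgebra ℂ (Module.End ℂ D) where
  carrier := {T | ∃ S : Module.End ℂ D, ∀ φ ψ : D, ⟪T φ, ψ⟫_ℂ = ⟪φ, S ψ⟫_ℂ}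
  mul_mem' := by
    rintro T T' ⟨S, hS⟩ ⟨S', hS'⟩
    exact ⟨S' * S, fun φ ψ => by simp [hS, hS']⟩
  add_mem' := by
    rintro T T' ⟨S, hS⟩ ⟨S', hS'⟩
    exact ⟨S + S', fun φ ψ => by
      rw [LinearMap.add_apply, LinearMap.add_apply, inner_add_left, inner_add_right, hS, hS']⟩
  algebraMap_mem' c := ⟨algebraMap ℂ _ (starRingEnd ℂ c), fun φ ψ => by
    rw [Module.algebraMap_end_apply, Module.algebraMap_end_apply, inner_smul_left,
      inner_smul_right]⟩

variable {D}

theorem adjoint_unique {T S S' : Module.End ℂ D} (h : ∀ φ ψ : D, ⟪T φ, ψ⟫_ℂ = ⟪φ, S ψ⟫_ℂ)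
    (h' : ∀ φ ψ : D, ⟪T φ, ψ⟫_ℂ = ⟪φ, S' ψ⟫_ℂ) : S = S' := by
  ext ψ
  exact ext_inner_left ℂ fun φ => by rw [← h, ← h']

theorem inner_adjoint_swap {T S : Module.End ℂ D} (h : ∀ φ ψ : D, ⟪T φ, ψ⟫_ℂ = ⟪φ, S ψ⟫_ℂ)
    (φ ψ : D) : ⟪S φ, ψ⟫_ℂ = ⟪φ, T ψ⟫_ℂ := by
  rw [← inner_conj_symm, ← h, inner_conj_symm]

/-- The involution: `star T` is the formal adjoint of `T` on `D`. -/
instance : Star (adjointable D) where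
  star T := ⟨T.2.choose, T.1, inner_adjoint_swap T.2.choose_spec⟩

theorem inner_star (T : adjointable D) (φ ψ : D) :
    ⟪(T : Module.End ℂ D) φ, ψ⟫_ℂ = ⟪φ, ((star T : adjointable D) : Module.End ℂ D) ψ⟫_ℂ :=
  T.2.choose_spec φ ψ

theorem star_eq_of {T S : adjointable D} (h : ∀ φ ψ : D,
    ⟪(T : Module.End ℂ D) φ, ψ⟫_ℂ = ⟪φ, (S : Module.End ℂ D) ψ⟫_ℂ) : star T = S :=
  Subtype.ext (adjoint_unique (inner_star T) h)

instance : StarRing (adjointable D) where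
  star_involutive T := star_eq_of (inner_adjoint_swap (inner_star T))
  star_mul S T := star_eq_of fun φ ψ => by simp [inner_star]
  star_add S T := star_eq_of fun φ ψ => by
    simp [inner_star]

instance : StarModule ℂ (adjointable D) where
  star_smul c T := star_eq_of fun φ ψ => by
    simp [inner_star, mul_comm]

end Adjointable

/-! ### The Fock-Bargmann representation -/

/-- The Hilbert space `ℓ²(ℕ₀^d)`, with orthonormal basis `e_n`, `n ∈ ℕ₀^d`. -/
def Fock (d : ℕ) : Type := lp (fun _ : Fin d → ℕ => ℂ) 2

instance (d : ℕ) : NormedAddCommGroup (Fock d) :=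
  inferInstanceAs (NormedAddCommGroup (lp (fun _ : Fin d → ℕ => ℂ) 2))

instance (d : ℕ) : InnerProductSpace ℂ (Fock d) :=
  inferInstanceAs (InnerProductSpace ℂ (lp (fun _ : Fin d → ℕ => ℂ) 2))

instance (d : ℕ) : CompleteSpace (Fock d) :=
  inferInstanceAs (CompleteSpace (lp (fun _ : Fin d → ℕ => ℂ) 2))

/-- `coeff φ n` is the coefficient of `φ` at `e_n`. -/
def coeff {d : ℕ} (φ : Fock d) (n : Fin d → ℕ) : ℂ :=
  (show lp (fun _ : Fin d → ℕ => ℂ) 2 from φ).1 n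

theorem coeff_ext {d : ℕ} {φ ψ : Fock d} (h : ∀ n, coeff φ n = coeff ψ n) : φ = ψ :=
  Subtype.ext (funext h)

theorem coeff_zero {d : ℕ} (n : Fin d → ℕ) : coeff (0 : Fock d) n = 0 := rfl

theorem coeff_add {d : ℕ} (φ ψ : Fock d) (n : Fin d → ℕ) :
    coeff (φ + ψ) n = coeff φ n + coeff ψ n := rfl

theorem coeff_smul {d : ℕ} (c : ℂ) (φ : Fock d) (n : Fin d → ℕ) :
    coeff (c • φ) n = c * coeff φ n := rfl

theorem inner_eq_tsum {d : ℕ} (φ ψ : Fock d) :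
    ⟪φ, ψ⟫_ℂ = ∑' n, ⟪coeff φ n, coeff ψ n⟫_ℂ := rfl

/-- `|n| = n_1 + ... + n_d`. -/
def deg {d : ℕ} (n : Fin d → ℕ) : ℕ := ∑ k, n k

/-- The domain of the representation: vectors with rapidly decreasing coefficients
(it corresponds to the Schwartz space). -/
def fockDomain (d : ℕ) : Submodule ℂ (Fock d) where
  carrier := {φ | ∀ r : ℕ, Summable fun n => ((1 + deg n : ℕ) : ℝ) ^ r * ‖coeff φ n‖ ^ 2}
  zero_mem' r := by simp [coeff_zero]
  add_mem' := by
    intro φ ψ hφ hψ r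
    refine Summable.of_nonneg_of_le (fun n => by positivity) (fun n => ?_)
      (((hφ r).add (hψ r)).mul_left 2)
    have h1 : ‖coeff (φ + ψ) n‖ ≤ ‖coeff φ n‖ + ‖coeff ψ n‖ := by
      rw [coeff_add]; exact norm_add_le _ _
    have h2 : ‖coeff (φ + ψ) n‖ ^ 2 ≤ 2 * (‖coeff φ n‖ ^ 2 + ‖coeff ψ n‖ ^ 2) := by
      nlinarith [norm_nonneg (coeff (φ + ψ) n), sq_nonneg (‖coeff φ n‖ - ‖coeff ψ n‖)]
    calc _ ≤ ((1 + deg n : ℕ) : ℝ) ^ r * (2 * (‖coeff φ n‖ ^ 2 + ‖coeff ψ n‖ ^ 2)) := by gcongr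
      _ = _ := by ring
  smul_mem' := by
    intro c φ hφ r
    refine ((hφ r).mul_left (‖c‖ ^ 2)).congr fun n => ?_
    simp [coeff_smul, mul_pow]
    ring

/-- Coefficient families that give vectors of the domain. -/
theorem memFock {d : ℕ} {f : (Fin d → ℕ) → ℂ}
    (hf : ∀ r : ℕ, Summable fun n => ((1 + deg n : ℕ) : ℝ) ^ r * ‖f n‖ ^ 2) :
    Memℓp f 2 := by
  refine memℓp_gen ?_
  simpa using hf 0

/-- The vector of the domain with given rapidly decreasing coefficients. -/
def mkDom {d : ℕ} (f : (Fin d → ℕ) → ℂ)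
    (hf : ∀ r : ℕ, Summable fun n => ((1 + deg n : ℕ) : ℝ) ^ r * ‖f n‖ ^ 2) : fockDomain d :=
  ⟨⟨f, memFock hf⟩, hf⟩

theorem coeff_mkDom {d : ℕ} (f : (Fin d → ℕ) → ℂ)
    (hf : ∀ r : ℕ, Summable fun n => ((1 + deg n : ℕ) : ℝ) ^ r * ‖f n‖ ^ 2) (n : Fin d → ℕ) :
    coeff (mkDom f hf).1 n = f n := rfl

theorem deg_add_single {d : ℕ} (n : Fin d → ℕ) (k : Fin d) :
    deg (n + Pi.single k 1) = deg n + 1 := by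
  simp [deg, Finset.sum_add_distrib]

theorem le_deg {d : ℕ} (n : Fin d → ℕ) (k : Fin d) : n k ≤ deg n :=
  Finset.single_le_sum (f := n) (fun _ _ => Nat.zero_le _) (Finset.mem_univ k)

theorem shift_injective {d : ℕ} (k : Fin d) :
    Function.Injective fun n : Fin d → ℕ => n + Pi.single k 1 := add_left_injective _

theorem eq_zero_of_not_shift {d : ℕ} {k : Fin d} {n : Fin d → ℕ}
    (h : n ∉ Set.range fun n : Fin d → ℕ => n + Pi.single k 1) : n k = 0 := by
  by_contra h0
  refine h ⟨n - Pi.single k 1, ?_⟩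
  ext j
  by_cases hj : j = k
  · subst hj
    simp
    omega
  · simp [hj]

theorem ann_summable {d : ℕ} (k : Fin d) (φ : fockDomain d) (r : ℕ) :
    Summable fun n => ((1 + deg n : ℕ) : ℝ) ^ r *
      ‖(√(n k + 1) : ℂ) * coeff φ.1 (n + Pi.single k 1)‖ ^ 2 := by
  refine Summable.of_nonneg_of_le (fun n => by positivity) (fun n => ?_)
    ((φ.2 (r + 1)).comp_injective (shift_injective k))
  have h1 : ‖((√(n k + 1) : ℝ) : ℂ)‖ ^ 2 = n k + 1 := by
    rw [Complex.norm_real, Real.norm_eq_abs, sq_abs, Real.sq_sqrt (by positivity)]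
  have h2 : (n k : ℝ) ≤ deg n := by exact_mod_cast le_deg n k
  simp only [Function.comp, norm_mul, mul_pow, h1, deg_add_single]
  push_cast
  have h3 : (1 + deg n : ℝ) ^ r * (n k + 1) ≤ (1 + (deg n + 1)) ^ (r + 1) := by
    rw [pow_succ]
    refine mul_le_mul (pow_le_pow_left₀ (by positivity) (by linarith) r) (by linarith)
      (by positivity) (by positivity)
  calc _ = (1 + deg n : ℝ) ^ r * (n k + 1) * ‖coeff φ.1 (n + Pi.single k 1)‖ ^ 2 := by ring
    _ ≤ _ := by gcongr

theorem cre_summable {d : ℕ} (k : Fin d) (φ : fockDomain d) (r : ℕ) :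
    Summable fun n => ((1 + deg n : ℕ) : ℝ) ^ r *
      ‖(√(n k) : ℂ) * coeff φ.1 (n - Pi.single k 1)‖ ^ 2 := by
  refine ((shift_injective k).summable_iff (fun n hn => ?_)).1 ?_
  · simp [eq_zero_of_not_shift hn]
  refine Summable.of_nonneg_of_le (fun n => by dsimp only [Function.comp]; positivity)
    (fun n => ?_) ((φ.2 (r + 1)).mul_left (2 ^ r))
  have h1 : ‖((√(n k + 1) : ℝ) : ℂ)‖ ^ 2 = n k + 1 := by
    rw [Complex.norm_real, Real.norm_eq_abs, sq_abs, Real.sq_sqrt (by positivity)]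
  have h2 : (n k : ℝ) ≤ deg n := by exact_mod_cast le_deg n k
  simp only [Function.comp, norm_mul, mul_pow, deg_add_single, add_tsub_cancel_right,
    Pi.add_apply, Pi.single_eq_same]
  push_cast
  rw [h1]
  have h3 : (1 + (deg n + 1) : ℝ) ^ r * (n k + 1) ≤ 2 ^ r * (1 + deg n) ^ (r + 1) := by
    rw [pow_succ, ← mul_assoc, ← mul_pow]
    refine mul_le_mul (pow_le_pow_left₀ (by positivity) (by linarith [(deg n).cast_nonneg (α := ℝ)]) r)
      (by linarith) (by positivity) (by positivity)
  calc _ = (1 + (deg n + 1) : ℝ) ^ r * (n k + 1) * ‖coeff φ.1 n‖ ^ 2 := by ring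
    _ ≤ 2 ^ r * (1 + deg n : ℝ) ^ (r + 1) * ‖coeff φ.1 n‖ ^ 2 := by gcongr
    _ = _ := by ring

/-- The annihilation operator `a_k e_n = √n_k e_{n - 1_k}`, in terms of coefficients. -/
def annOp {d : ℕ} (k : Fin d) : Module.End ℂ (fockDomain d) where
  toFun φ := mkDom (fun n => (√(n k + 1) : ℂ) * coeff φ.1 (n + Pi.single k 1)) (ann_summable k φ)
  map_add' φ ψ := by
    refine Subtype.ext (coeff_ext fun n => ?_)
    exact mul_add _ _ _
  map_smul' c φ := by
    refine Subtype.ext (coeff_ext fun n => ?_)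
    exact mul_left_comm _ _ _

/-- The creation operator `a_{-k} e_n = √(n_k + 1) e_{n + 1_k}`, in terms of coefficients
(the coefficient at `n` is zero when `n k = 0`). -/
def creOp {d : ℕ} (k : Fin d) : Module.End ℂ (fockDomain d) where
  toFun φ := mkDom (fun n => (√(n k) : ℂ) * coeff φ.1 (n - Pi.single k 1)) (cre_summable k φ)
  map_add' φ ψ := by
    refine Subtype.ext (coeff_ext fun n => ?_)
    exact mul_add _ _ _
  map_smul' c φ := by
    refine Subtype.ext (coeff_ext fun n => ?_)
    exact mul_left_comm _ _ _

theorem coeff_creOp {d : ℕ} (k : Fin d) (φ : fockDomain d) (n : Fin d → ℕ) :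
    coeff (creOp k φ).1 n = (√(n k) : ℂ) * coeff φ.1 (n - Pi.single k 1) := rfl

theorem coeff_annOp {d : ℕ} (k : Fin d) (φ : fockDomain d) (n : Fin d → ℕ) :
    coeff (annOp k φ).1 n = (√(n k + 1) : ℂ) * coeff φ.1 (n + Pi.single k 1) := rfl

theorem ann_cre_adjoint {d : ℕ} (k : Fin d) (φ ψ : fockDomain d) :
    ⟪annOp k φ, ψ⟫_ℂ = ⟪φ, creOp k ψ⟫_ℂ := by
  rw [Submodule.coe_inner, Submodule.coe_inner, inner_eq_tsum, inner_eq_tsum]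
  rw [← (shift_injective k).tsum_eq
    (f := fun n => ⟪coeff φ.1 n, coeff (creOp k ψ).1 n⟫_ℂ)]
  · refine tsum_congr fun n => ?_
    simp [coeff_annOp, coeff_creOp]
    ring
  · intro n hn
    by_contra h
    refine hn ?_
    simp [coeff_creOp, eq_zero_of_not_shift h]

theorem bounded_inv (β : ℝ) : ∃ C : ℝ, ∀ m : ℕ, |((m : ℝ) + β)⁻¹| ≤ C := by
  have h : Filter.Tendsto (fun m : ℕ => |((m : ℝ) + β)⁻¹|) Filter.atTop (nhds |0|) :=
    (tendsto_inv_atTop_zero.comp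
      (Filter.tendsto_atTop_add_const_right _ β tendsto_natCast_atTop_atTop)).abs
  obtain ⟨C, hC⟩ := h.bddAbove_range
  exact ⟨C, fun m => hC ⟨m, rfl⟩⟩

theorem inv_summable {d : ℕ} (β : ℝ) (φ : fockDomain d) (r : ℕ) :
    Summable fun n => ((1 + deg n : ℕ) : ℝ) ^ r *
      ‖(((deg n + β)⁻¹ : ℝ) : ℂ) * coeff φ.1 n‖ ^ 2 := by
  obtain ⟨C, hC⟩ := bounded_inv β
  refine Summable.of_nonneg_of_le (fun n => by positivity) (fun n => ?_)
    ((φ.2 r).mul_left (C ^ 2))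
  rw [norm_mul, mul_pow, Complex.norm_real, Real.norm_eq_abs]
  have := hC (deg n)
  calc _ ≤ ((1 + deg n : ℕ) : ℝ) ^ r * (C ^ 2 * ‖coeff φ.1 n‖ ^ 2) := by gcongr
    _ = _ := by ring

/-- The operator `(N + β)⁻¹`, where `N e_n = |n| e_n`. -/
def invOp {d : ℕ} (β : ℝ) : Module.End ℂ (fockDomain d) where
  toFun φ := mkDom (fun n => (((deg n + β)⁻¹ : ℝ) : ℂ) * coeff φ.1 n) (inv_summable β φ)
  map_add' φ ψ := by
    refine Subtype.ext (coeff_ext fun n => ?_)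
    exact mul_add _ _ _
  map_smul' c φ := by
    refine Subtype.ext (coeff_ext fun n => ?_)
    exact mul_left_comm _ _ _

theorem coeff_invOp {d : ℕ} (β : ℝ) (φ : fockDomain d) (n : Fin d → ℕ) :
    coeff (invOp β φ).1 n = (((deg n + β)⁻¹ : ℝ) : ℂ) * coeff φ.1 n := rfl

theorem inv_adjoint {d : ℕ} (β : ℝ) (φ ψ : fockDomain d) :
    ⟪invOp β φ, ψ⟫_ℂ = ⟪φ, invOp β ψ⟫_ℂ := by
  rw [Submodule.coe_inner, Submodule.coe_inner, inner_eq_tsum, inner_eq_tsum]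
  refine tsum_congr fun n => ?_
  simp [coeff_invOp]
  ring

/-! ### The auxiliary algebra -/

/-- The index set `{-d, ..., d}`: `pos k`, `neg k` (`k : Fin d`) stand for the numbers
`k + 1` and `-(k + 1)`. -/
inductive Index (d : ℕ) : Type
  | zero : Index d
  | pos (k : Fin d) : Index d
  | neg (k : Fin d) : Index d

/-- Whether an index is strictly positive. -/
def Index.isPos {d : ℕ} : Index d → Bool
  | .pos _ => true
  | _ => false

/-- The operators `a_k`, `k = -d, ..., d`, on the domain, with `a_0 = 1`. -/
def a {d : ℕ} : Index d → adjointable (fockDomain d)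
  | .zero => 1
  | .pos k => ⟨annOp k, creOp k, ann_cre_adjoint k⟩
  | .neg k => ⟨creOp k, annOp k, inner_adjoint_swap (ann_cre_adjoint k)⟩

/-- `y_n = (N + α + n)⁻¹`. -/
def yOp {d : ℕ} (α : ℝ) (n : ℕ) : adjointable (fockDomain d) :=
  ⟨invOp (α + n), invOp (α + n), inv_adjoint (α + n)⟩

/-- `x_{kl} = a_k a_l (N + α)⁻¹` if `k > 0` or `l > 0`, and `x_{kl} = (N + α)⁻¹ a_k a_l` if
`k ≤ 0` and `l ≤ 0`; so `x_{kl}* = x_{-l,-k}`. -/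
def xOp {d : ℕ} (α : ℝ) (k l : Index d) : adjointable (fockDomain d) :=
  if k.isPos || l.isPos then a k * a l * yOp α 0 else yOp α 0 * (a k * a l)

/-- The unital `*`-algebra of operators on the domain generated by the `x_{kl}` and the `y_n`. -/
def auxAlgebra (d : ℕ) (α : ℝ) : StarSubalgebra ℂ (adjointable (fockDomain d)) :=
  StarAlgebra.adjoin ℂ
    (Set.range (fun p : Index d × Index d => xOp α p.1 p.2) ∪ Set.range (yOp α))

/-- The generator `x_{kl}` as an element of the auxiliary algebra. -/
def x {d : ℕ} (α : ℝ) (k l : Index d) : auxAlgebra d α :=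
  ⟨xOp α k l, StarAlgebra.subset_adjoin ℂ _ (Or.inl ⟨(k, l), rfl⟩)⟩

/-- The generator `y_n` as an element of the auxiliary algebra. -/
def y {d : ℕ} (α : ℝ) (n : ℕ) : auxAlgebra d α :=
  ⟨yOp α n, StarAlgebra.subset_adjoin ℂ _ (Or.inr ⟨n, rfl⟩)⟩

/-- `x^n = x_1^{n_1} ⋯ x_d^{n_d}`, where `x_k = x_{k0}`. -/
def xpow {d : ℕ} (α : ℝ) (n : Fin d → ℕ) : auxAlgebra d α :=
  (List.ofFn fun k => x α (.pos k) .zero ^ n k).prod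

/-! ### Representations -/

/-- A `*`-representation of a unital `*`-algebra on a pre-Hilbert space `D`: a unital algebra
homomorphism into the linear operators on `D` with `⟪π(x) φ, ψ⟫ = ⟪φ, π(x*) ψ⟫`. -/
structure StarRep (A : Type*) [Ring A] [Algebra ℂ A] [StarRing A]
    (D : Type*) [NormedAddCommGroup D] [InnerProductSpace ℂ D] where
  toAlgHom : A →ₐ[ℂ] Module.End ℂ D
  inner_map : ∀ (x : A) (φ ψ : D), ⟪toAlgHom x φ, ψ⟫_ℂ = ⟪φ, toAlgHom (star x) ψ⟫_ℂ

/-- The auxiliary algebra acting by its own operators on the domain. -/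
def tautRep (d : ℕ) (α : ℝ) : StarRep (auxAlgebra d α) (fockDomain d) where
  toAlgHom := (adjointable (fockDomain d)).val.comp (auxAlgebra d α).subtype.toAlgHom
  inner_map x φ ψ := inner_star x.1 φ ψ

section Hilbert

variable {A : Type*} [Ring A] [Algebra ℂ A] [StarRing A]
variable {H : Type u} [NormedAddCommGroup H] [InnerProductSpace ℂ H] [CompleteSpace H]

/-- `P`, a `*`-representation by bounded operators on the Hilbert space `H`, extends the
`*`-representation `π` on the subspace `D` of `H`. If `D` is dense, then `P(x)` is the
continuous extension of `π(x)` for all `x`. -/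
def StarRep.ExtendsTo {D : Submodule ℂ H} (π : StarRep A D) (P : A →⋆ₐ[ℂ] (H →L[ℂ] H)) : Prop :=
  ∀ (x : A) (φ : D), P x φ = π.toAlgHom x φ

/-- `Q` is the restriction of the representation `P` to the (then invariant) subspace `K`. -/
def IsRestriction (P : A →⋆ₐ[ℂ] (H →L[ℂ] H)) (K : Submodule ℂ H) [CompleteSpace K]
    (Q : A →⋆ₐ[ℂ] (K →L[ℂ] K)) : Prop :=
  ∀ (x : A) (φ : K), (Q x φ : H) = P x φ

/-- `Q` is the Hilbert space direct sum, over the index set `ι`, of representations which are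
unitarily equivalent to the representation `R`: there are isometric embeddings `V i` with mutually
orthogonal ranges, whose closed linear span is everything, intertwining `R` and `Q`. -/
def IsSumOfCopies {G : Type*} [NormedAddCommGroup G] [InnerProductSpace ℂ G] [CompleteSpace G]
    (R : A →⋆ₐ[ℂ] (G →L[ℂ] G)) (Q : A →⋆ₐ[ℂ] (H →L[ℂ] H)) (ι : Type*) : Prop :=
  ∃ V : ι → G →ₗᵢ[ℂ] H, IsHilbertSum ℂ (fun _ : ι => G) V ∧
    ∀ (i : ι) (x : A) (f : G), Q x (V i f) = V i (R x f)

variable {d : ℕ} {α : ℝ} (P : auxAlgebra d α →⋆ₐ[ℂ] (H →L[ℂ] H))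

/-- `H_∞ = ker y_0`. -/
def Hinf : Submodule ℂ H := (P (y α 0)).ker

/-- `K_0 = ker (y_0 - α⁻¹)`. -/
def K0 : Submodule ℂ H := (P (y α 0) - ((α⁻¹ : ℝ) : ℂ) • (1 : H →L[ℂ] H)).ker

/-- `H_1`, the closed linear span of the spaces `K_n = (x^n)* K_0`, `n ∈ ℕ₀^d`
(the one with `n = 0` is `K_0`). -/
def H1 : Submodule ℂ H :=
  (⨆ n : Fin d → ℕ, (K0 P).map (P (star (xpow α n))).toLinearMap).topologicalClosure

instance : CompleteSpace (Hinf P) :=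
  inferInstanceAs (CompleteSpace (P (y α 0)).ker)

instance : CompleteSpace (H1 P) :=
  inferInstanceAs (CompleteSpace (Submodule.topologicalClosure _))

end Hilbert

/-! ### Spectral measures -/

section Spectral

/-- A spectral measure on `Ω`: a strongly countably additive map from the measurable sets into the
orthogonal projections on `K`, with value `1` at `Ω` (values at other sets are irrelevant). -/
structure SpectralMeasure (Ω : Type*) [MeasurableSpace Ω]
    (K : Type*) [NormedAddCommGroup K] [InnerProductSpace ℂ K] [CompleteSpace K] where
  proj : Set Ω → (K →L[ℂ] K)
  isStarProjection : ∀ B, MeasurableSet B → IsStarProjection (proj B)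
  proj_univ : proj Set.univ = 1
  hasSum_iUnion : ∀ B : ℕ → Set Ω, (∀ i, MeasurableSet (B i)) →
    Pairwise (Function.onFun Disjoint B) →
    ∀ φ : K, HasSum (fun i => proj (B i) φ) (proj (⋃ i, B i) φ)

variable {Ω : Type*} [MeasurableSpace Ω]
variable {K : Type*} [NormedAddCommGroup K] [InnerProductSpace ℂ K] [CompleteSpace K]

namespace SpectralMeasure

variable (E : SpectralMeasure Ω K)

theorem proj_empty (φ : K) : E.proj ∅ φ = 0 := by
  have h := E.hasSum_iUnion (fun _ => ∅) (fun _ => MeasurableSet.empty)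
    (fun _ _ _ => disjoint_bot_left) φ
  exact (tendsto_const_nhds_iff (l := Filter.atTop (α := ℕ))).1 h.summable.tendsto_atTop_zero

theorem re_inner_nonneg {B : Set Ω} (hB : MeasurableSet B) (φ : K) :
    0 ≤ (⟪φ, E.proj B φ⟫_ℂ).re := by
  have h := E.isStarProjection B hB
  have h1 : E.proj B φ = E.proj B (E.proj B φ) :=
    (congrArg (fun T : K →L[ℂ] K => T φ) h.isIdempotentElem.eq).symm
  have h2 : ⟪φ, E.proj B φ⟫_ℂ = ⟪E.proj B φ, E.proj B φ⟫_ℂ := by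
    conv_lhs => rw [h1]
    rw [← ContinuousLinearMap.adjoint_inner_left, ← ContinuousLinearMap.star_eq_adjoint,
      h.isSelfAdjoint.star_eq]
  rw [h2]
  exact inner_self_nonneg (𝕜 := ℂ)

/-- The finite positive measure `B ↦ ⟪E(B) φ, φ⟫`. -/
def scalarMeasure (φ : K) : MeasureTheory.Measure Ω :=
  MeasureTheory.Measure.ofMeasurable
    (fun B _ => ENNReal.ofReal (⟪φ, E.proj B φ⟫_ℂ).re)
    (by simp [E.proj_empty])
    (by
      intro B hB hdisj
      have h1 : HasSum (fun i => (⟪φ, E.proj (B i) φ⟫_ℂ).re) (⟪φ, E.proj (⋃ i, B i) φ⟫_ℂ).re :=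
        Complex.hasSum_re ((E.hasSum_iUnion B hB hdisj φ).mapL (innerSL ℂ φ))
      rw [← h1.tsum_eq, ENNReal.ofReal_tsum_of_nonneg
        (fun i => E.re_inner_nonneg (hB i) φ) h1.summable])

/-- `T = ∫ f dE`: the bounded operator `T` is determined by
`⟪T φ, φ⟫ = ∫ f d⟪E(·) φ, φ⟫` for all `φ`. Since Mathlib's inner product is conjugate linear in
the first variable, `⟪T φ, φ⟫` in the usual convention is `⟪φ, T φ⟫_ℂ` here. -/
def IsIntegral (f : Ω → ℂ) (T : K →L[ℂ] K) : Prop :=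
  ∀ φ : K, MeasureTheory.Integrable f (E.scalarMeasure φ) ∧
    ⟪φ, T φ⟫_ℂ = ∫ z, f z ∂(E.scalarMeasure φ)

end SpectralMeasure

end Spectral

/-- The unit sphere of `ℂ^d`. -/
abbrev Sphere (d : ℕ) : Type := Metric.sphere (0 : EuclideanSpace ℂ (Fin d)) 1

end WeylAux

end

open WeylAux

/-! Write `X_k = x_{k0}`, `Z_{kl} = x_{kl}` and `W_{kl} = x_{k,-l}` for `k, l > 0`. Everything is
drawn from finitely many algebraic identities among these elements, their adjoints and the `y_n`,
collected in `AuxRelations`; they survive any `*`-homomorphism.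

Boundedness comes from sums of squares. `∑ X_k* X_k = y_0 - α y_0²` gives `α‖y_0 φ‖² ≤ ⟪φ, y_0 φ⟫`,
hence `y_0` is bounded and positive, and then the `X_k` are bounded; `∑ Z* Z` is a polynomial in
`y_0`; `W* W` is a combination of products of bounded generators (`StarRep.mem_bdd`). A
representation on a dense subspace therefore extends to the Hilbert space.

On the Hilbert space, `X_k` lowers `N` by one, so it moves a spectral value `t` of `y_0` to `t'`
with `1/t' = 1/t - 1`. The same sum of squares confines the spectrum to `[0, 1/α]`, so lowering must
stop, and it can stop only at `t = 1/α`. Hence the nonzero spectral values are numbers `(α + j)⁻¹`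
(`AuxRelations.eq_of_mem_spectrum`). They accumulate only at `0`, so eigenvectors span `(ker y_0)ᗮ`,
and each eigenvector is recovered from the eigenvectors at `1/α`, the vacua, by applying the `X_k*`
(`AuxRelations.orthogonal_ker_le`). This identifies `H_1` with `(ker y_0)ᗮ`.

Acting on a vacuum, every algebra element gives a scalar multiple of the vacuum modulo the ranges of
the `X_k*`, which are orthogonal to all vacua. The scalar depends on the algebra element only
(`inner_vacuum`), so each unit vacuum generates a copy of the Fock representation, and an
orthonormal basis of vacua splits `H_1` into such copies.

On `ker y_0` all commutator terms carry a factor `y_0` and vanish. The `Z` and `W` become commuting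
normal operators which satisfy the relations of the products `z_k z_l` and `z_k conj(z_l)` on the
sphere. Gelfand duality and the spectral theorem give a spectral measure on the set of such
products. The products determine `z` up to sign, and a measurable choice of sign carries the measure
to the sphere. -/

noncomputable section
namespace WeylAux

/-! ### Commutation relations on the Fock space -/

section Relations

variable {d : ℕ} {α : ℝ}

theorem adjointable_ext {S T : adjointable (fockDomain d)}
    (h : ∀ (φ : fockDomain d) (n : Fin d → ℕ),
      coeff ((S : Module.End ℂ (fockDomain d)) φ).1 n =
        coeff ((T : Module.End ℂ (fockDomain d)) φ).1 n) : S = T :=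
  Subtype.ext (LinearMap.ext fun φ => Subtype.ext (coeff_ext (h φ)))

theorem coeff_pos (k : Fin d) (φ : fockDomain d) (n : Fin d → ℕ) :
    coeff ((a (.pos k) : adjointable (fockDomain d)).1 φ).1 n =
      (√(n k + 1) : ℂ) * coeff φ.1 (n + Pi.single k 1) := rfl

theorem coeff_neg (k : Fin d) (φ : fockDomain d) (n : Fin d → ℕ) :
    coeff ((a (.neg k) : adjointable (fockDomain d)).1 φ).1 n =
      (√(n k) : ℂ) * coeff φ.1 (n - Pi.single k 1) := rfl

theorem coeff_yOp (m : ℕ) (φ : fockDomain d) (n : Fin d → ℕ) :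
    coeff ((yOp α m : adjointable (fockDomain d)).1 φ).1 n =
      (((deg n + (α + m))⁻¹ : ℝ) : ℂ) * coeff φ.1 n := rfl

theorem coeff_mul_apply (S T : adjointable (fockDomain d)) (φ : fockDomain d) (n : Fin d → ℕ) :
    coeff ((S * T).1 φ).1 n = coeff (S.1 (T.1 φ)).1 n := rfl

theorem coeff_add_apply (S T : adjointable (fockDomain d)) (φ : fockDomain d) (n : Fin d → ℕ) :
    coeff ((S + T).1 φ).1 n = coeff (S.1 φ).1 n + coeff (T.1 φ).1 n := rfl

theorem coeff_sub_apply (S T : adjointable (fockDomain d)) (φ : fockDomain d) (n : Fin d → ℕ) :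
    coeff ((S - T).1 φ).1 n = coeff (S.1 φ).1 n - coeff (T.1 φ).1 n := rfl

theorem coeff_smul_apply (c : ℂ) (T : adjointable (fockDomain d)) (φ : fockDomain d)
    (n : Fin d → ℕ) : coeff ((c • T).1 φ).1 n = c * coeff (T.1 φ).1 n := rfl

theorem coeff_one_apply (φ : fockDomain d) (n : Fin d → ℕ) :
    coeff ((1 : adjointable (fockDomain d)).1 φ).1 n = coeff φ.1 n := rfl

theorem coeff_sum_apply {ι : Type*} (s : Finset ι) (T : ι → adjointable (fockDomain d))
    (φ : fockDomain d) (n : Fin d → ℕ) :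
    coeff ((∑ i ∈ s, T i).1 φ).1 n = ∑ i ∈ s, coeff ((T i).1 φ).1 n := by
  classical
  induction s using Finset.induction_on with
  | empty => rfl
  | insert i s hi ih => rw [Finset.sum_insert hi, Finset.sum_insert hi, coeff_add_apply, ih]

theorem star_a_pos (k : Fin d) : star (a (.pos k) : adjointable (fockDomain d)) = a (.neg k) :=
  star_eq_of (ann_cre_adjoint k)

theorem star_a_neg (k : Fin d) : star (a (.neg k) : adjointable (fockDomain d)) = a (.pos k) := by
  rw [← star_a_pos, star_star]

theorem star_yOp (n : ℕ) : star (yOp α n : adjointable (fockDomain d)) = yOp α n :=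
  star_eq_of (inv_adjoint (α + n))

theorem deg_add_cast (n : Fin d → ℕ) (k : Fin d) :
    (deg (n + Pi.single k 1) : ℝ) = deg n + 1 := by
  rw [deg_add_single]; push_cast; rfl

theorem pos_mul_pos (k l : Fin d) :
    (a (.pos k) * a (.pos l) : adjointable (fockDomain d)) = a (.pos l) * a (.pos k) := by
  refine adjointable_ext fun φ n => ?_
  simp only [coeff_mul_apply, coeff_pos, add_right_comm n (Pi.single k 1)]
  rcases eq_or_ne k l with rfl | h
  · rfl
  · simp [h, h.symm]
    ring

theorem neg_mul_neg (k l : Fin d) :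
    (a (.neg k) * a (.neg l) : adjointable (fockDomain d)) = a (.neg l) * a (.neg k) := by
  simpa [star_a_pos] using congrArg star (pos_mul_pos l k)

theorem pos_mul_neg (k l : Fin d) :
    (a (.pos k) * a (.neg l) : adjointable (fockDomain d)) =
      a (.neg l) * a (.pos k) + (if k = l then 1 else 0 : ℂ) • 1 := by
  refine adjointable_ext fun φ n => ?_
  simp only [coeff_mul_apply, coeff_pos, coeff_neg, coeff_add_apply, coeff_smul_apply,
    coeff_one_apply]
  rcases eq_or_ne k l with rfl | h
  · have h1 : ((√((n k : ℝ) + 1) : ℝ) : ℂ) * (√((n k : ℝ) + 1) : ℝ) = n k + 1 := by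
      rw [← Complex.ofReal_mul, Real.mul_self_sqrt (by positivity)]; simp
    have h2 : ((√(n k : ℝ) : ℝ) : ℂ) * (√(n k : ℝ) : ℝ) = n k := by
      rw [← Complex.ofReal_mul, Real.mul_self_sqrt (by positivity)]; simp
    -- Subtracting `1_k` is truncated, so adding it back recovers `n` only when `n k > 0`; for `n k
    -- = 0` the factor `√(n k)` kills the term.
    rcases Nat.eq_zero_or_pos (n k) with h0 | h0
    · simp [h0]
    · have h3 : n - Pi.single k 1 + Pi.single k 1 = n := by
        ext j
        rcases eq_or_ne j k with rfl | hj
        · simp; omega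
        · simp [hj]
      have h4 : (((n k - 1 : ℕ) : ℝ) + 1) = n k := by
        rw [Nat.cast_sub h0]; simp
      simp only [Pi.add_apply, Pi.single_eq_same, add_tsub_cancel_right, Pi.sub_apply, h3, h4,
        if_true, one_mul]
      push_cast
      rw [← mul_assoc, ← mul_assoc, h1, h2]
      ring
  · rcases Nat.eq_zero_or_pos (n l) with h0 | h0
    · simp [h, h.symm, h0]
    · have h3 : n - Pi.single l 1 + Pi.single k 1 = n + Pi.single k 1 - Pi.single l 1 := by
        ext j
        rcases eq_or_ne j l with rfl | hj
        · simp [h.symm]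
        · simp [hj]
      simp only [h3, if_neg h, zero_mul, add_zero]
      simp [h, h.symm]
      ring

theorem pos_mul_yOp (k : Fin d) (m : ℕ) :
    (a (.pos k) * yOp α m : adjointable (fockDomain d)) = yOp α (m + 1) * a (.pos k) := by
  refine adjointable_ext fun φ n => ?_
  simp only [coeff_mul_apply, coeff_pos, coeff_yOp, deg_add_cast]
  rw [show (deg n : ℝ) + 1 + (α + m) = deg n + (α + (m + 1 : ℕ)) by push_cast; ring]
  ring

theorem yOp_mul_neg (k : Fin d) (m : ℕ) :
    (yOp α m * a (.neg k) : adjointable (fockDomain d)) = a (.neg k) * yOp α (m + 1) := by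
  simpa [star_a_pos, star_yOp] using congrArg star (pos_mul_yOp (α := α) k m)

theorem yOp_mul_yOp (m n : ℕ) :
    (yOp α m * yOp α n : adjointable (fockDomain d)) = yOp α n * yOp α m := by
  refine adjointable_ext fun φ n => ?_
  simp only [coeff_mul_apply, coeff_yOp]
  ring

theorem yOp_eq (hα : 0 < α) (m : ℕ) :
    (yOp α 0 : adjointable (fockDomain d)) = yOp α m + (m : ℂ) • (yOp α 0 * yOp α m) := by
  refine adjointable_ext fun φ n => ?_
  simp only [coeff_mul_apply, coeff_yOp, coeff_add_apply, coeff_smul_apply]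
  have h1 : (deg n : ℂ) + (α + (0 : ℕ)) ≠ 0 := by
    have : (deg n : ℝ) + (α + (0 : ℕ)) ≠ 0 := by positivity
    exact_mod_cast this
  have h2 : (deg n : ℂ) + (α + m) ≠ 0 := by
    have : (deg n : ℝ) + (α + m) ≠ 0 := by positivity
    exact_mod_cast this
  push_cast at h1 ⊢
  field_simp
  ring

/-- The sum is the number operator, and `|n| / (|n| + α) = 1 - α / (|n| + α)`. -/
theorem sum_neg_mul_pos (hα : 0 < α) :
    (∑ k, a (.neg k) * a (.pos k)) * yOp α 0 =
      (1 - (α : ℂ) • yOp α 0 : adjointable (fockDomain d)) := by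
  refine adjointable_ext fun φ n => ?_
  have h : ∀ k, coeff ((a (.neg k) * a (.pos k) : adjointable (fockDomain d)).1
      ((yOp α 0 : adjointable (fockDomain d)).1 φ)).1 n =
      (n k : ℂ) * coeff ((yOp α 0 : adjointable (fockDomain d)).1 φ).1 n := by
    intro k
    rw [coeff_mul_apply, coeff_neg, coeff_pos]
    rcases Nat.eq_zero_or_pos (n k) with h0 | h0
    · simp [h0]
    · have h3 : n - Pi.single k 1 + Pi.single k 1 = n := by
        ext j
        rcases eq_or_ne j k with rfl | hj
        · simp; omega
        · simp [hj]
      have h4 : (((n k - 1 : ℕ) : ℝ) + 1) = n k := by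
        rw [Nat.cast_sub h0]; simp
      simp only [h3, Pi.sub_apply, Pi.single_eq_same, h4]
      rw [← mul_assoc, ← Complex.ofReal_mul, Real.mul_self_sqrt (by positivity)]
      simp
  rw [coeff_mul_apply, coeff_sum_apply, Finset.sum_congr rfl fun k _ => h k, ← Finset.sum_mul,
    coeff_sub_apply, coeff_smul_apply, coeff_one_apply, coeff_yOp]
  have h1 : (deg n : ℂ) + α ≠ 0 := by
    have : (deg n : ℝ) + α ≠ 0 := by positivity
    exact_mod_cast this
  have h2 : (∑ k, (n k : ℂ)) = deg n := by simp [deg]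
  rw [h2]
  simp only [Complex.ofReal_inv, Complex.ofReal_add, Complex.ofReal_natCast, Nat.cast_zero,
    add_zero]
  field_simp
  ring

end Relations

/-! ### Identities among the generators -/

/-- The relations between annihilation operators `p k`, creation operators `c k` and the
operators `Y n = (N + α + n)⁻¹`, in an arbitrary algebra. -/
structure ShiftRelations {R : Type*} [Ring R] [Algebra ℂ R] {d : ℕ} (α : ℝ)
    (p c : Fin d → R) (Y : ℕ → R) : Prop where
  pp : ∀ k l, p k * p l = p l * p k
  cc : ∀ k l, c k * c l = c l * c k
  pc : ∀ k l, p k * c l = c l * p k + (if k = l then 1 else 0 : ℂ) • 1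
  pY : ∀ k m, p k * Y m = Y (m + 1) * p k
  Yc : ∀ k m, Y m * c k = c k * Y (m + 1)
  YY : ∀ m n, Y m * Y n = Y n * Y m
  Y_eq : ∀ m : ℕ, Y 0 = Y m + (m : ℂ) • (Y 0 * Y m)
  sum : (∑ k, c k * p k) * Y 0 = 1 - (α : ℂ) • Y 0
  sum' : Y 0 * (∑ k, c k * p k) = 1 - (α : ℂ) • Y 0

namespace ShiftRelations

variable {R : Type*} [Ring R] [Algebra ℂ R] {d : ℕ} {α : ℝ} {p c : Fin d → R} {Y : ℕ → R}

theorem Ycp (h : ShiftRelations α p c Y) (k l : Fin d) (m : ℕ) : Y m * (c k * p l) = c k * p l * Y m := by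
  rw [mul_assoc, h.pY, ← mul_assoc, h.Yc, mul_assoc]

theorem Ypc (h : ShiftRelations α p c Y) (k l : Fin d) (m : ℕ) : Y m * (p k * c l) = p k * c l * Y m := by
  rw [h.pc, mul_add, add_mul, h.Ycp]
  simp

theorem Y_one (h : ShiftRelations α p c Y) : Y 1 = Y 0 - Y 0 * Y 1 := by
  have h1 := h.Y_eq 1
  rw [Nat.cast_one, one_smul] at h1
  exact eq_sub_of_add_eq h1.symm

/-- The factor `1 + 2 Y 0` stands for `(N + α + 2)(N + α)⁻¹`. It serves to trade `Y 2`, which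
appears when `Y 0` passes two annihilators or creators, for `Y 0`. -/
theorem Y_two (h : ShiftRelations α p c Y) : Y 2 * (1 + (2 : ℂ) • Y 0) = Y 0 := by
  have h1 := h.Y_eq 2
  rw [mul_add, mul_one, mul_smul_comm, h.YY]
  exact_mod_cast h1.symm

/-- This is `N p_l = p_l (N - 1)` multiplied by `Y 0`, obtained by moving `Y 0` across `p_l` and
using `N Y 1 = 1 - (1 + α) Y 1`. -/
theorem sum_mul_pos (h : ShiftRelations α p c Y) (l : Fin d) :
    (∑ k, c k * p k) * (p l * Y 0) = p l * (1 - (1 + α : ℂ) • Y 0) := by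
  have h1 : (∑ k, c k * p k) * Y 1 = 1 - (1 + α : ℂ) • Y 1 := by
    have h2 : Y 1 = Y 0 * (1 - Y 1) := by rw [mul_sub, mul_one, ← h.Y_one]
    conv_lhs => rw [h2]
    rw [← mul_assoc, h.sum, sub_mul, one_mul, smul_mul_assoc, ← h2, add_smul, one_smul]
    abel
  rw [h.pY, ← mul_assoc, h1, sub_mul, mul_sub, one_mul, mul_one, smul_mul_assoc,
    mul_smul_comm, h.pY]

theorem sum_pair (h : ShiftRelations α p c Y) :
    ∑ l, ∑ k, Y 0 * (c k * c l) * (p k * p l * Y 0) =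
      (1 - (α : ℂ) • Y 0) * (1 - (1 + α : ℂ) • Y 0) := by
  rw [← h.sum', mul_assoc, Finset.sum_mul, Finset.mul_sum]
  refine Finset.sum_congr rfl fun l _ => ?_
  rw [mul_assoc, ← h.sum_mul_pos l, Finset.sum_mul, Finset.mul_sum, Finset.mul_sum]
  refine Finset.sum_congr rfl fun k _ => ?_
  rw [h.cc k l]
  simp only [mul_assoc]

theorem sum_single (h : ShiftRelations α p c Y) : ∑ k, Y 0 * c k * (p k * Y 0) = Y 0 - (α :
    ℂ) • (Y 0 * Y 0) := by
  have h1 := congrArg (Y 0 * ·) h.sum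
  simp only [mul_sub, mul_one, mul_smul_comm, Finset.mul_sum, Finset.sum_mul] at h1
  rw [← h1]
  exact Finset.sum_congr rfl fun k _ => by simp only [mul_assoc]

theorem sum_pos_neg (h : ShiftRelations α p c Y) : ∑ k, p k * c k * Y 0 = 1 + (d - α : ℂ) • Y 0 := by
  simp only [h.pc, if_true, one_smul]
  rw [← Finset.sum_mul, Finset.sum_add_distrib, add_mul, h.sum]
  simp only [Finset.sum_const, Finset.card_univ, Fintype.card_fin, sub_smul, smul_mul_assoc,
    one_mul, Nat.cast_smul_eq_nsmul]
  abel

theorem X_comm (h : ShiftRelations α p c Y) (k l : Fin d) : p k * Y 0 * (p l * Y 0) = p l * Y 0 * (p k * Y 0) := by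
  rw [h.pY, h.pY, ← mul_assoc, ← mul_assoc, mul_assoc (Y _) (p k), h.pY, mul_assoc (Y _) (p l),
    h.pY, ← mul_assoc, ← mul_assoc, mul_assoc _ (p k), h.pp, mul_assoc _ (p l)]

theorem Y_two_mul_pp (h : ShiftRelations α p c Y) (k l : Fin d) : Y 2 * (p k * p l) = p k * p l * Y 0 := by
  calc Y 2 * (p k * p l) = p k * Y 1 * p l := by rw [h.pY, mul_assoc]
    _ = p k * (p l * Y 0) := by rw [h.pY l, mul_assoc]
    _ = _ := (mul_assoc _ _ _).symm

theorem Z_mul_Y (h : ShiftRelations α p c Y) (k l : Fin d) : p k * p l * Y 0 * Y 0 = Y 2 * (p k * p l * Y 0) := by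
  conv_lhs => rw [← h.Y_two_mul_pp, mul_assoc]

theorem W_mul_Y (h : ShiftRelations α p c Y) (k l : Fin d) (m : ℕ) : p k * c l * Y 0 * Y m = Y m * (p k * c l * Y 0) := by
  rw [← mul_assoc, h.Ypc, mul_assoc _ (Y 0), h.YY 0 m]
  simp only [mul_assoc]

/-- Moving the inner `Y 0` to the right across `p l` would produce `(N + α - 1)⁻¹`, which is not
among the `Y n`. The factor `1 - Y 0 = (N + α - 1)(N + α)⁻¹` cancels it. -/
theorem Z_mul_Y' (h : ShiftRelations α p c Y) (k l : Fin d) :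
    p k * p l * Y 0 * Y 0 = p k * Y 0 * (p l * Y 0) * (1 - Y 0) := by
  have h1 : Y 0 * p l * Y 0 * (1 - Y 0) = p l * Y 0 * Y 0 := by
    have h2 : p l * (1 - Y 0) = (1 - Y 1) * p l := by
      rw [mul_sub, sub_mul, mul_one, one_mul, h.pY]
    have h3 : Y 0 * Y 1 * (1 - Y 1) = Y 1 * Y 1 := by
      rw [h.YY 0 1, mul_assoc, mul_sub, mul_one, ← h.Y_one]
    calc _ = Y 0 * Y 1 * (p l * (1 - Y 0)) := by
          rw [mul_assoc (Y 0), h.pY]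
          simp only [mul_assoc]
      _ = Y 1 * (Y 1 * p l) := by rw [h2, ← mul_assoc, h3, mul_assoc]
      _ = _ := by rw [h.pY, mul_assoc, h.pY]
  calc _ = p k * (p l * Y 0 * Y 0) := by simp only [mul_assoc]
    _ = _ := by rw [← h1]; simp only [mul_assoc]

theorem cp_mul_Y (h : ShiftRelations α p c Y) (k l : Fin d) : c l * p k * Y 0 * Y 0 = Y 0 * c l * (p k * Y 0) := by
  rw [← h.Ycp]
  simp only [mul_assoc]

theorem cc_mul_Y (h : ShiftRelations α p c Y) (k l : Fin d) : Y 0 * (c k * c l) * Y 1 = Y 0 * c k * (Y 0 * c l) := by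
  rw [h.Yc l]
  simp only [mul_assoc]

/-- Both sides are `p k * c l * (Y 1)²`; on the right this uses `Y 0 * (1 - Y 1) = Y 1`. -/
theorem X_mul_star_X (h : ShiftRelations α p c Y) (k l : Fin d) :
    p k * Y 0 * (Y 0 * c l) = p k * c l * Y 0 * ((1 - Y 1) * Y 1) := by
  have h2 : p k * c l * Y 0 * ((1 - Y 1) * Y 1) = p k * c l * (Y 1 * Y 1) := by
    rw [mul_assoc _ (Y 0), ← mul_assoc (Y 0), mul_sub, mul_one, ← h.Y_one]
  rw [h2, h.Yc, mul_assoc, ← mul_assoc (Y 0), h.Yc]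
  simp only [mul_assoc]

theorem pp_comm (h : ShiftRelations α p c Y) (k l m n : Fin d) : p k * p l * (p m * p n) = p m * p n * (p k * p l) :=
  ((Commute.mul_left (Commute.mul_right (h.pp k m) (h.pp k n))
    (Commute.mul_right (h.pp l m) (h.pp l n)))).eq

theorem Y_mul_cc (h : ShiftRelations α p c Y) (k l : Fin d) : Y 0 * (c k * c l) = c k * c l * Y 2 := by
  rw [← mul_assoc, h.Yc, mul_assoc, h.Yc, mul_assoc]

theorem Z_comm (h : ShiftRelations α p c Y) (k l m n : Fin d) :
    p k * p l * Y 0 * (p m * p n * Y 0) = p m * p n * Y 0 * (p k * p l * Y 0) := by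
  have h1 : ∀ k l m n, p k * p l * Y 0 * (p m * p n * Y 0) =
      Y 2 * (p k * p l * (p m * p n) * Y 0) := fun k l m n => by
    rw [← h.Y_two_mul_pp k l]
    simp only [mul_assoc]
  rw [h1, h1, h.pp_comm]

theorem W_mul_W (h : ShiftRelations α p c Y) (k l m n : Fin d) :
    p k * c m * Y 0 * (p l * c n * Y 0) = p k * (c m * p l) * c n * (Y 0 * Y 0) := by
  rw [mul_assoc _ (Y 0), ← mul_assoc (Y 0), h.Ypc]
  simp only [mul_assoc]

/-- Creators are moved to the right. This gives `p p c c (Y 0)²`, whereas `Z Z*` is `p p c c (Y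
2)²`; the two factors `1 + 2 Y 0` make up the difference. -/
theorem W_mul_W_eq (h : ShiftRelations α p c Y) (k l m n : Fin d) :
    p k * c m * Y 0 * (p l * c n * Y 0) =
      p k * p l * Y 0 * (Y 0 * (c m * c n)) * ((1 + (2 : ℂ) • Y 0) * (1 + (2 : ℂ) • Y 0)) -
      (if l = m then 1 else 0 : ℂ) • (p k * c n * Y 0 * Y 0) := by
  have h2 : p k * p l * Y 0 * (Y 0 * (c m * c n)) =
      p k * p l * (c m * c n) * (Y 2 * Y 2) := by
    rw [h.Y_mul_cc, mul_assoc _ (Y 0), ← mul_assoc (Y 0), h.Y_mul_cc]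
    simp only [mul_assoc]
  have h3 : Y 2 * Y 2 * ((1 + (2 : ℂ) • Y 0) * (1 + (2 : ℂ) • Y 0)) = Y 0 * Y 0 := by
    have hc : Commute (Y 2) (1 + (2 : ℂ) • Y 0) :=
      (Commute.one_right _).add_right (Commute.smul_right (h.YY _ _) _)
    rw [mul_assoc, ← mul_assoc (Y 2) _ (1 + (2 : ℂ) • Y 0), hc.eq, mul_assoc,
      ← mul_assoc, h.Y_two]
  rw [h.W_mul_W, h2, mul_assoc _ (Y 2 * Y 2), h3, ← sub_eq_of_eq_add (h.pc l m)]
  simp only [mul_sub, sub_mul, mul_assoc, mul_smul_comm, smul_mul_assoc, one_mul]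

/-- Creators are moved to the left. Every contraction term keeps a factor `Y 0` on the right, which
serves twice: it turns `c p Y 0` into `X* X` in the bound for `W`, and it makes these terms vanish
on `ker y_0`. -/
theorem W_mul_W_eq' (h : ShiftRelations α p c Y) (k l m n : Fin d) :
    p k * c m * Y 0 * (p l * c n * Y 0) =
      Y 0 * (c m * c n) * (p k * p l * Y 0) +
      ((if k = n then 1 else 0 : ℂ) • (c m * p l * Y 0) +
        (if k = m then 1 else 0 : ℂ) • (c n * p l * Y 0) +
        (if l = n then 1 else 0 : ℂ) • (c m * p k * Y 0) +
        ((if k = m then 1 else 0 : ℂ) * (if l = n then 1 else 0 : ℂ)) • Y 0) * Y 0 := by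
  have h1 : Y 0 * (c m * c n) * (p k * p l * Y 0) =
      c m * c n * (p k * p l) * (Y 0 * Y 0) := by
    rw [h.Y_mul_cc, mul_assoc _ (Y 2), ← mul_assoc (Y 2), h.Y_two_mul_pp]
    simp only [mul_assoc]
  have h3 : p k * (c m * p l) * c n =
      c m * c n * (p k * p l) +
        ((if k = n then 1 else 0 : ℂ) • (c m * p l) +
        (if k = m then 1 else 0 : ℂ) • (c n * p l) +
        (if l = n then 1 else 0 : ℂ) • (c m * p k) +
        ((if k = m then 1 else 0 : ℂ) * (if l = n then 1 else 0 : ℂ)) • 1) := by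
    have h4 : c m * p k * (c n * p l) = c m * c n * (p k * p l) +
          (if k = n then 1 else 0 : ℂ) • (c m * p l) := by
      rw [mul_assoc, ← mul_assoc (p k), h.pc k n]
      simp only [add_mul, mul_add, smul_mul_assoc, mul_smul_comm, one_mul, mul_assoc]
    rw [← mul_assoc (p k), h.pc, mul_assoc _ (p l), h.pc l n, mul_add, add_mul, add_mul, h4]
    simp only [smul_mul_assoc, mul_smul_comm, one_mul, mul_one, smul_smul]
    rw [mul_comm (if l = n then (1 : ℂ) else 0)]
    abel
  rw [h.W_mul_W, h1, h3]
  simp only [add_mul, smul_mul_assoc, one_mul, mul_assoc]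

/-- `Z W` carries `Y 2` on the left and `W Z` carries `Y 0`; the factor `1 + 2 Y 0` equalizes them,
and the rest is reordering `p p p c`. On `ker y_0` the identity becomes commutation of `Z` and `W`.
-/
theorem Z_mul_W (h : ShiftRelations α p c Y) (k l m n : Fin d) :
    (1 + (2 : ℂ) • Y 0) * (p k * p l * Y 0 * (p m * c n * Y 0)) =
      p m * c n * Y 0 * (p k * p l * Y 0) +
      Y 0 * ((if k = n then 1 else 0 : ℂ) • (p m * p l * Y 0) +
        (if l = n then 1 else 0 : ℂ) • (p m * p k * Y 0)) := by
  have hc : Commute (Y 2) (1 + (2 : ℂ) • Y 0) :=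
    (Commute.one_right _).add_right (Commute.smul_right (h.YY _ _) _)
  have h1 : p k * p l * Y 0 * (p m * c n * Y 0) =
      Y 2 * (p k * p l * (p m * c n) * Y 0) := by
    rw [← h.Y_two_mul_pp]
    simp only [mul_assoc]
  have h2 : p m * c n * Y 0 * (p k * p l * Y 0) =
      Y 0 * (p m * c n * (p k * p l) * Y 0) := by
    rw [← h.Ypc]
    simp only [mul_assoc]
  have h3 : p k * p l * (p m * c n) = p m * c n * (p k * p l) +
        ((if k = n then 1 else 0 : ℂ) • (p m * p l) +
        (if l = n then 1 else 0 : ℂ) • (p m * p k)) := by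
    have hp : Commute (p k * p l) (p m) := .mul_left (h.pp _ _) (h.pp _ _)
    rw [← mul_assoc, hp.eq, mul_assoc (p m), mul_assoc (p k), h.pc l n,
      mul_add, ← mul_assoc (p k), h.pc k n]
    simp only [add_mul, mul_add, smul_mul_assoc, mul_smul_comm, one_mul, mul_one, mul_assoc]
    abel
  rw [h1, h2, ← mul_assoc, ← hc.eq, h.Y_two, h3, add_mul, mul_add]
  simp only [add_mul, smul_mul_assoc]

end ShiftRelations

/-- The relations between the generators of the auxiliary algebra that are used below. -/
structure AuxRelations {A : Type*} [Ring A] [Algebra ℂ A] [StarRing A] {d : ℕ} (α : ℝ)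
    (x : Index d → Index d → A) (y : ℕ → A) : Prop where
  star_y : ∀ n, star (y n) = y n
  y_mul_y : ∀ m n, y m * y n = y n * y m
  y_eq : ∀ m : ℕ, y 0 = y m + (m : ℂ) • (y 0 * y m)
  zero_zero : x .zero .zero = y 0
  zero_pos : ∀ k, x .zero (.pos k) = x (.pos k) .zero
  neg_zero : ∀ k, x (.neg k) .zero = star (x (.pos k) .zero)
  zero_neg : ∀ k, x .zero (.neg k) = star (x (.pos k) .zero)
  pos_pos_comm : ∀ k l, x (.pos k) (.pos l) = x (.pos l) (.pos k)
  neg_neg : ∀ k l, x (.neg k) (.neg l) = star (x (.pos k) (.pos l))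
  star_pos_neg : ∀ k l, star (x (.pos k) (.neg l)) = x (.pos l) (.neg k)
  neg_pos : ∀ k l, x (.neg l) (.pos k) =
    x (.pos k) (.neg l) - (if k = l then 1 else 0 : ℂ) • y 0
  sum_single : ∑ k, star (x (.pos k) .zero) * x (.pos k) .zero = y 0 - (α : ℂ) • (y 0 * y 0)
  sum_pair : ∑ l, ∑ k, star (x (.pos k) (.pos l)) * x (.pos k) (.pos l) =
    (1 - (α : ℂ) • y 0) * (1 - (1 + α : ℂ) • y 0)
  sum_pos_neg : ∑ k, x (.pos k) (.neg k) = 1 + (d - α : ℂ) • y 0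
  X_mul_y : ∀ k, x (.pos k) .zero * y 0 = y 1 * x (.pos k) .zero
  X_comm : ∀ k l, x (.pos k) .zero * x (.pos l) .zero = x (.pos l) .zero * x (.pos k) .zero
  Z_mul_y : ∀ k l, x (.pos k) (.pos l) * y 0 = y 2 * x (.pos k) (.pos l)
  Z_mul_y' : ∀ k l, x (.pos k) (.pos l) * y 0 = x (.pos k) .zero * x (.pos l) .zero * (1 - y 0)
  W_mul_y : ∀ k l m, x (.pos k) (.neg l) * y m = y m * x (.pos k) (.neg l)
  star_X_mul_X : ∀ k l, x (.neg l) (.pos k) * y 0 = star (x (.pos l) .zero) * x (.pos k) .zero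
  star_X_mul_star_X : ∀ k l, x (.neg k) (.neg l) * y 1 =
    star (x (.pos k) .zero) * star (x (.pos l) .zero)
  X_mul_star_X : ∀ k l, x (.pos k) .zero * star (x (.pos l) .zero) =
    x (.pos k) (.neg l) * ((1 - y 1) * y 1)
  Z_comm : ∀ k l m n, x (.pos k) (.pos l) * x (.pos m) (.pos n) =
    x (.pos m) (.pos n) * x (.pos k) (.pos l)
  W_mul_W : ∀ k l m n, x (.pos k) (.neg m) * x (.pos l) (.neg n) =
    x (.pos k) (.pos l) * x (.neg m) (.neg n) * ((1 + (2 : ℂ) • y 0) * (1 + (2 : ℂ) • y 0)) -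
      (if l = m then 1 else 0 : ℂ) • (x (.pos k) (.neg n) * y 0)
  W_mul_W' : ∀ k l m n, x (.pos k) (.neg m) * x (.pos l) (.neg n) =
    x (.neg m) (.neg n) * x (.pos k) (.pos l) +
      ((if k = n then 1 else 0 : ℂ) • x (.neg m) (.pos l) +
        (if k = m then 1 else 0 : ℂ) • x (.neg n) (.pos l) +
        (if l = n then 1 else 0 : ℂ) • x (.neg m) (.pos k) +
        ((if k = m then 1 else 0 : ℂ) * (if l = n then 1 else 0 : ℂ)) • y 0) * y 0
  Z_mul_W : ∀ k l m n,
    (1 + (2 : ℂ) • y 0) * (x (.pos k) (.pos l) * x (.pos m) (.neg n)) =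
      x (.pos m) (.neg n) * x (.pos k) (.pos l) +
      y 0 * ((if k = n then 1 else 0 : ℂ) • x (.pos m) (.pos l) +
        (if l = n then 1 else 0 : ℂ) • x (.pos m) (.pos k))

theorem ShiftRelations.auxRelations {R : Type*} [Ring R] [Algebra ℂ R] [StarRing R] {d : ℕ} {α : ℝ}
    {p c : Fin d → R} {Y : ℕ → R} (h : ShiftRelations α p c Y) (hp : ∀ k, star (p k) = c k)
    (hY : ∀ n, star (Y n) = Y n) (x : Index d → Index d → R) (zero_zero : x .zero .zero = Y 0)
    (pos_zero : ∀ k, x (.pos k) .zero = p k * Y 0) (zero_pos : ∀ k, x .zero (.pos k) = p k * Y 0)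
    (neg_zero : ∀ k, x (.neg k) .zero = Y 0 * c k) (zero_neg : ∀ k, x .zero (.neg k) = Y 0 * c k)
    (pos_pos : ∀ k l, x (.pos k) (.pos l) = p k * p l * Y 0)
    (pos_neg : ∀ k l, x (.pos k) (.neg l) = p k * c l * Y 0)
    (neg_pos : ∀ k l, x (.neg k) (.pos l) = c k * p l * Y 0)
    (neg_neg : ∀ k l, x (.neg k) (.neg l) = Y 0 * (c k * c l)) : AuxRelations α x Y := by
  have hc : ∀ k, star (c k) = p k := fun k => by rw [← hp, star_star]
  have hX : ∀ k, star (p k * Y 0) = Y 0 * c k := fun k => by rw [star_mul, hp, hY]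
  have hZ : ∀ k l, star (p k * p l * Y 0) = Y 0 * (c k * c l) := fun k l => by
    rw [star_mul, star_mul, hp, hp, hY, h.cc]
  constructor <;>
    try simp only [zero_zero, pos_zero, zero_pos, neg_zero, zero_neg, pos_pos, pos_neg, neg_pos,
      neg_neg, hX, hZ]
  · exact hY
  · exact h.YY
  · exact h.Y_eq
  · exact fun _ => trivial
  · exact fun _ => trivial
  · exact fun _ => trivial
  · exact fun k l => by rw [h.pp]
  · exact fun _ _ => trivial
  · exact fun k l => by rw [star_mul, star_mul, hp, hc, hY, h.Ypc]
  · exact fun k l => by rw [h.pc, add_mul, smul_one_mul, add_sub_cancel_right]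
  · exact h.sum_single
  · exact h.sum_pair
  · exact h.sum_pos_neg
  · exact fun k => by rw [h.pY, mul_assoc, h.pY]
  · exact h.X_comm
  · exact h.Z_mul_Y
  · exact h.Z_mul_Y'
  · exact h.W_mul_Y
  · exact h.cp_mul_Y
  · exact h.cc_mul_Y
  · exact h.X_mul_star_X
  · exact h.Z_comm
  · exact h.W_mul_W_eq
  · exact h.W_mul_W_eq'
  · exact h.Z_mul_W

/-- Relations may be checked after applying an injective homomorphism. -/
theorem AuxRelations.of_injective {A R : Type*} [Ring A] [Algebra ℂ A] [StarRing A]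
    [Ring R] [Algebra ℂ R] [StarRing R] {d : ℕ} {α : ℝ} (f : A →⋆ₐ[ℂ] R)
    (hf : Function.Injective f) {x : Index d → Index d → A} {y : ℕ → A}
    (h : AuxRelations α (fun k l => f (x k l)) (fun n => f (y n))) : AuxRelations α x y := by
  constructor <;> intros <;> apply hf <;>
    try simp only [map_add, map_sub, map_mul, map_smul, map_star, map_sum, map_one]
  · exact h.star_y _
  · exact h.y_mul_y _ _
  · exact h.y_eq _
  · exact h.zero_zero
  · exact h.zero_pos _
  · exact h.neg_zero _
  · exact h.zero_neg _
  · exact h.pos_pos_comm _ _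
  · exact h.neg_neg _ _
  · exact h.star_pos_neg _ _
  · exact h.neg_pos _ _
  · exact h.sum_single
  · exact h.sum_pair
  · exact h.sum_pos_neg
  · exact h.X_mul_y _
  · exact h.X_comm _ _
  · exact h.Z_mul_y _ _
  · exact h.Z_mul_y' _ _
  · exact h.W_mul_y _ _ _
  · exact h.star_X_mul_X _ _
  · exact h.star_X_mul_star_X _ _
  · exact h.X_mul_star_X _ _
  · exact h.Z_comm _ _ _ _
  · exact h.W_mul_W _ _ _ _
  · exact h.W_mul_W' _ _ _ _
  · exact h.Z_mul_W _ _ _ _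

theorem shiftRelations {d : ℕ} {α : ℝ} (hα : 0 < α) :
    ShiftRelations (R := adjointable (fockDomain d)) α (fun k => a (.pos k)) (fun k => a (.neg k))
      (yOp α) where
  pp := pos_mul_pos
  cc := neg_mul_neg
  pc := pos_mul_neg
  pY := pos_mul_yOp
  Yc := yOp_mul_neg
  YY := yOp_mul_yOp
  Y_eq := yOp_eq hα
  sum := sum_neg_mul_pos hα
  sum' := by simpa [star_a_pos, star_a_neg, star_yOp] using congrArg star (sum_neg_mul_pos (d := d) hα)

/-! ### The relations in the auxiliary algebra, and generation without the involution -/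

section Generators

variable {d : ℕ} {α : ℝ}

theorem xOp_pos_pos (k l : Fin d) :
    xOp α (.pos k) (.pos l) = a (.pos k) * a (.pos l) * yOp α 0 := rfl

theorem xOp_pos_neg (k l : Fin d) :
    xOp α (.pos k) (.neg l) = a (.pos k) * a (.neg l) * yOp α 0 := rfl

theorem xOp_neg_pos (k l : Fin d) :
    xOp α (.neg k) (.pos l) = a (.neg k) * a (.pos l) * yOp α 0 := rfl

theorem xOp_neg_neg (k l : Fin d) :
    xOp α (.neg k) (.neg l) = yOp α 0 * (a (.neg k) * a (.neg l)) := rfl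

theorem xOp_pos_zero (k : Fin d) : xOp α (.pos k) .zero = a (.pos k) * yOp α 0 :=
  congrArg (· * yOp α 0) (mul_one (a (.pos k)))

theorem xOp_zero_pos (k : Fin d) : xOp α .zero (.pos k) = a (.pos k) * yOp α 0 :=
  congrArg (· * yOp α 0) (one_mul (a (.pos k)))

theorem xOp_neg_zero (k : Fin d) : xOp α (.neg k) .zero = yOp α 0 * a (.neg k) :=
  congrArg (yOp α 0 * ·) (mul_one (a (.neg k)))

theorem xOp_zero_neg (k : Fin d) : xOp α .zero (.neg k) = yOp α 0 * a (.neg k) :=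
  congrArg (yOp α 0 * ·) (one_mul (a (.neg k)))

theorem xOp_zero_zero : (xOp α .zero .zero : adjointable (fockDomain d)) = yOp α 0 :=
  (congrArg (yOp α 0 * ·) (one_mul 1)).trans (mul_one _)

end Generators

theorem auxRelations (d : ℕ) {α : ℝ} (hα : 0 < α) :
    AuxRelations (A := auxAlgebra d α) α (x α) (y α) := by
  have h : AuxRelations (A := adjointable (fockDomain d)) α (xOp α) (yOp α) :=
    (shiftRelations hα).auxRelations star_a_pos star_yOp (xOp α) xOp_zero_zero xOp_pos_zero
      xOp_zero_pos xOp_neg_zero xOp_zero_neg xOp_pos_pos xOp_pos_neg xOp_neg_pos xOp_neg_neg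
  exact AuxRelations.of_injective (auxAlgebra d α).subtype Subtype.val_injective h


/-- The algebra `A` is generated by the `x k l` and the `y n`. -/
def Generates {A : Type*} [Ring A] [Algebra ℂ A] {d : ℕ} (x : Index d → Index d → A) (y : ℕ → A) :
    Prop :=
  ∀ S : Subalgebra ℂ A, (∀ k l, x k l ∈ S) → (∀ n, y n ∈ S) → ∀ t, t ∈ S

theorem AuxRelations.exists_star_eq {A : Type*} [Ring A] [Algebra ℂ A] [StarRing A]
    [StarModule ℂ A] {d : ℕ} {α : ℝ} {x : Index d → Index d → A} {y : ℕ → A}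
    (h : AuxRelations α x y) (k l : Index d) : ∃ k' l', star (x k l) = x k' l' := by
  cases k with
  | zero => cases l with
    | zero => exact ⟨.zero, .zero, by rw [h.zero_zero, h.star_y]⟩
    | pos l => exact ⟨.neg l, .zero, by rw [h.zero_pos, h.neg_zero]⟩
    | neg l => exact ⟨.pos l, .zero, by rw [h.zero_neg, star_star]⟩
  | pos k => cases l with
    | zero => exact ⟨.neg k, .zero, by rw [h.neg_zero]⟩
    | pos l => exact ⟨.neg k, .neg l, by rw [h.neg_neg]⟩
    | neg l => exact ⟨.pos l, .neg k, h.star_pos_neg k l⟩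
  | neg k => cases l with
    | zero => exact ⟨.pos k, .zero, by rw [h.neg_zero, star_star]⟩
    | pos l =>
      refine ⟨.neg l, .pos k, ?_⟩
      rw [h.neg_pos, h.neg_pos, star_sub, star_smul, h.star_pos_neg, h.star_y]
      rcases eq_or_ne k l with rfl | hkl
      · simp
      · simp [hkl, hkl.symm]
    | neg l => exact ⟨.pos k, .pos l, by rw [h.neg_neg, star_star]⟩

/-- The subalgebra is not assumed closed under `star`, so the induction carries membership of `b`
and of `star b` together; the `star` case then only swaps the two. -/
theorem mem_subalgebra_of_star_adjoin {B : Type*} [Ring B] [Algebra ℂ B] [StarRing B]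
    [StarModule ℂ B] {s : Set B} (S : Subalgebra ℂ (StarAlgebra.adjoin ℂ s))
    (h : ∀ b (hb : b ∈ s), (⟨b, StarAlgebra.subset_adjoin ℂ s hb⟩ : StarAlgebra.adjoin ℂ s) ∈ S)
    (h' : ∀ b (hb : b ∈ s),
      star (⟨b, StarAlgebra.subset_adjoin ℂ s hb⟩ : StarAlgebra.adjoin ℂ s) ∈ S)
    (t : StarAlgebra.adjoin ℂ s) : t ∈ S := by
  have key : ∀ b (hb : b ∈ StarAlgebra.adjoin ℂ s), (⟨b, hb⟩ : StarAlgebra.adjoin ℂ s) ∈ S ∧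
      (⟨star b, star_mem hb⟩ : StarAlgebra.adjoin ℂ s) ∈ S := by
    intro b hb
    induction hb using StarAlgebra.adjoin_induction with
    | mem b hb => exact ⟨h b hb, h' b hb⟩
    | algebraMap r =>
      refine ⟨S.algebraMap_mem r, ?_⟩
      convert S.algebraMap_mem (star r) using 1
      exact Subtype.ext (algebraMap_star_comm r).symm
    | add b c hb hc ihb ihc =>
      refine ⟨S.add_mem ihb.1 ihc.1, ?_⟩
      convert S.add_mem ihb.2 ihc.2 using 1
      exact Subtype.ext (star_add b c)
    | mul b c hb hc ihb ihc =>
      refine ⟨S.mul_mem ihb.1 ihc.1, ?_⟩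
      convert S.mul_mem ihc.2 ihb.2 using 1
      exact Subtype.ext (star_mul b c)
    | star b hb ih =>
      refine ⟨ih.2, ?_⟩
      convert ih.1 using 1
      exact Subtype.ext (star_star b)
  exact (key t.1 t.2).1

theorem auxAlgebra_generates (d : ℕ) {α : ℝ} (hα : 0 < α) :
    Generates (A := auxAlgebra d α) (x α) (y α) := by
  intro S hx hy
  have h := auxRelations d hα
  refine mem_subalgebra_of_star_adjoin S (fun b hb => ?_) (fun b hb => ?_)
  · rcases hb with ⟨⟨k, l⟩, rfl⟩ | ⟨n, rfl⟩
    · exact hx k l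
    · exact hy n
  · rcases hb with ⟨⟨k, l⟩, rfl⟩ | ⟨n, rfl⟩
    · obtain ⟨k', l', h'⟩ := h.exists_star_eq k l
      exact (congrArg (· ∈ S) h').mpr (hx k' l')
    · exact (congrArg (· ∈ S) (h.star_y n)).mpr (hy n)

/-! ### Automatic boundedness -/

section Bounded

variable {A : Type*} [Ring A] [Algebra ℂ A] [StarRing A]
variable {D : Type*} [NormedAddCommGroup D] [InnerProductSpace ℂ D] (π : StarRep A D)

/-- The subalgebra of elements that are represented by bounded operators. -/
def StarRep.bdd : Subalgebra ℂ A where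
  carrier := {t | ∃ C : ℝ, ∀ φ : D, ‖π.toAlgHom t φ‖ ≤ C * ‖φ‖}
  add_mem' := by
    rintro s t ⟨B, hB⟩ ⟨C, hC⟩
    refine ⟨B + C, fun φ => ?_⟩
    rw [map_add, LinearMap.add_apply, add_mul]
    exact (norm_add_le _ _).trans (add_le_add (hB φ) (hC φ))
  mul_mem' := by
    rintro s t ⟨B, hB⟩ ⟨C, hC⟩
    refine ⟨|B| * C, fun φ => ?_⟩
    rw [map_mul, Module.End.mul_apply, mul_assoc]
    exact ((hB _).trans (mul_le_mul_of_nonneg_right (le_abs_self B) (norm_nonneg _))).trans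
      (mul_le_mul_of_nonneg_left (hC φ) (abs_nonneg B))
  algebraMap_mem' c := ⟨‖c‖, fun φ => by
    rw [AlgHom.commutes, Module.algebraMap_end_apply, norm_smul]⟩

theorem StarRep.inner_star_mul (s t : A) (φ ψ : D) :
    ⟪φ, π.toAlgHom (star s * t) ψ⟫_ℂ = ⟪π.toAlgHom s φ, π.toAlgHom t ψ⟫_ℂ := by
  rw [map_mul, Module.End.mul_apply, π.inner_map]

theorem StarRep.norm_sq_eq (t : A) (φ : D) :
    ‖π.toAlgHom t φ‖ ^ 2 = (⟪φ, π.toAlgHom (star t * t) φ⟫_ℂ).re := by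
  rw [π.inner_star_mul]
  exact (inner_self_eq_norm_sq (𝕜 := ℂ) _).symm

theorem StarRep.mem_bdd_of_norm_sq_le {t : A} {C : ℝ}
    (h : ∀ φ : D, ‖π.toAlgHom t φ‖ ^ 2 ≤ C * ‖φ‖ ^ 2) : t ∈ π.bdd := by
  refine ⟨√|C|, fun φ => ?_⟩
  refine abs_le_of_sq_le_sq' ?_ (by positivity) |>.2
  rw [mul_pow, Real.sq_sqrt (abs_nonneg C)]
  exact (h φ).trans (mul_le_mul_of_nonneg_right (le_abs_self C) (by positivity))

/-- One square is at most the sum of all, and `∑ ‖t_j φ‖² = ⟪φ, (∑ t_j* t_j) φ⟫` is controlled by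
Cauchy–Schwarz. -/
theorem StarRep.mem_bdd_of_sum {ι : Type*} (s : Finset ι) {t : ι → A}
    (h : ∑ i ∈ s, star (t i) * t i ∈ π.bdd) {i : ι} (hi : i ∈ s) : t i ∈ π.bdd := by
  obtain ⟨C, hC⟩ := h
  refine π.mem_bdd_of_norm_sq_le (C := C) fun φ => ?_
  calc ‖π.toAlgHom (t i) φ‖ ^ 2 ≤ ∑ j ∈ s, ‖π.toAlgHom (t j) φ‖ ^ 2 :=
        Finset.single_le_sum (f := fun j => ‖π.toAlgHom (t j) φ‖ ^ 2)
          (fun j _ => by positivity) hi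
    _ = (⟪φ, π.toAlgHom (∑ j ∈ s, star (t j) * t j) φ⟫_ℂ).re := by
        simp only [π.norm_sq_eq, map_sum, LinearMap.sum_apply, inner_sum, Complex.re_sum]
    _ ≤ ‖φ‖ * ‖π.toAlgHom (∑ j ∈ s, star (t j) * t j) φ‖ :=
        (Complex.re_le_norm _).trans (norm_inner_le_norm _ _)
    _ ≤ ‖φ‖ * (C * ‖φ‖) := mul_le_mul_of_nonneg_left (hC φ) (norm_nonneg φ)
    _ = C * ‖φ‖ ^ 2 := by ring

theorem StarRep.mem_bdd_of_star_mul_self {t : A} (h : star t * t ∈ π.bdd) : t ∈ π.bdd :=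
  π.mem_bdd_of_sum {()} (t := fun _ => t) (by simpa using h) (Finset.mem_singleton_self ())

theorem StarRep.mem_bdd_of_norm_sq_le' {t : A} {C : ℝ}
    (h : ∀ φ : D, ‖π.toAlgHom t φ‖ ^ 2 ≤ C * ‖φ‖ * ‖π.toAlgHom t φ‖) : t ∈ π.bdd := by
  refine ⟨|C|, fun φ => ?_⟩
  rcases eq_or_lt_of_le (norm_nonneg (π.toAlgHom t φ)) with h1 | h1
  · rw [← h1]
    positivity
  · refine le_trans (le_of_mul_le_mul_right ?_ h1)
      (mul_le_mul_of_nonneg_right (le_abs_self C) (norm_nonneg φ))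
    rw [← sq]
    exact h φ

/-- No adjoint on a complete space is needed: `‖t* φ‖² = ⟪φ, t t* φ⟫ ≤ C ‖φ‖ ‖t* φ‖`, and one factor
cancels. -/
theorem StarRep.star_mem_bdd {t : A} (h : t ∈ π.bdd) : star t ∈ π.bdd := by
  obtain ⟨C, hC⟩ := h
  refine π.mem_bdd_of_norm_sq_le' (C := C) fun φ => ?_
  rw [π.norm_sq_eq, star_star, map_mul, Module.End.mul_apply]
  calc _ ≤ ‖φ‖ * ‖π.toAlgHom t (π.toAlgHom (star t) φ)‖ :=
        (Complex.re_le_norm _).trans (norm_inner_le_norm _ _)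
    _ ≤ ‖φ‖ * (C * ‖π.toAlgHom (star t) φ‖) :=
        mul_le_mul_of_nonneg_left (hC _) (norm_nonneg φ)
    _ = _ := by ring

variable {d : ℕ} {α : ℝ} {x : Index d → Index d → A} {y : ℕ → A} (h : AuxRelations α x y)

theorem StarRep.sum_norm_sq_eq (h : AuxRelations α x y) (φ : D) :
    ∑ k, ‖π.toAlgHom (x (.pos k) .zero) φ‖ ^ 2 =
      (⟪φ, π.toAlgHom (y 0) φ⟫_ℂ).re - α * ‖π.toAlgHom (y 0) φ‖ ^ 2 := by
  have h1 : ‖π.toAlgHom (y 0) φ‖ ^ 2 = (⟪φ, π.toAlgHom (y 0 * y 0) φ⟫_ℂ).re := by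
    rw [π.norm_sq_eq, h.star_y]
  have h2 := congrArg (fun t => (⟪φ, π.toAlgHom t φ⟫_ℂ).re) h.sum_single
  simp only [map_sum, LinearMap.sum_apply, inner_sum, Complex.re_sum, ← π.norm_sq_eq, map_sub,
    LinearMap.sub_apply, inner_sub_right, Complex.sub_re, map_smul, LinearMap.smul_apply,
    inner_smul_right, Complex.re_ofReal_mul, ← h1] at h2
  exact h2

theorem StarRep.le_re_inner_y (h : AuxRelations α x y) (φ : D) :
    α * ‖π.toAlgHom (y 0) φ‖ ^ 2 ≤ (⟪φ, π.toAlgHom (y 0) φ⟫_ℂ).re := by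
  have h1 := π.sum_norm_sq_eq h φ
  have h2 : 0 ≤ ∑ k, ‖π.toAlgHom (x (.pos k) .zero) φ‖ ^ 2 :=
    Finset.sum_nonneg fun k _ => by positivity
  linarith

/-- From `α ‖y_0 φ‖² ≤ ⟪φ, y_0 φ⟫ ≤ ‖φ‖ ‖y_0 φ‖` one gets the bound `α⁻¹`. -/
theorem StarRep.y_zero_mem_bdd (hα : 0 < α) (h : AuxRelations α x y) : y 0 ∈ π.bdd := by
  refine π.mem_bdd_of_norm_sq_le' (C := α⁻¹) fun φ => ?_
  have h1 := π.le_re_inner_y h φ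
  have h2 := (Complex.re_le_norm _).trans (norm_inner_le_norm (𝕜 := ℂ) φ (π.toAlgHom (y 0) φ))
  rw [mul_assoc, ← div_eq_inv_mul, le_div_iff₀' hα]
  exact h1.trans h2

/-- For `ψ = y_n φ` one has `y_0 φ = ψ + n y_0 ψ`, and positivity of `y_0` gives `‖ψ‖² ≤ ⟪ψ, y_0
φ⟫`. Thus the bound for `y_0` serves for every `y_n`. -/
theorem StarRep.y_mem_bdd (hα : 0 < α) (h : AuxRelations α x y) (n : ℕ) : y n ∈ π.bdd := by
  obtain ⟨C, hC⟩ := π.y_zero_mem_bdd hα h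
  refine π.mem_bdd_of_norm_sq_le' (C := C) fun φ => ?_
  set ψ := π.toAlgHom (y n) φ with hψ
  have h1 : π.toAlgHom (y 0) φ = ψ + (n : ℂ) • π.toAlgHom (y 0) ψ := by
    rw [hψ, ← Module.End.mul_apply, ← map_mul, ← LinearMap.smul_apply, ← map_smul,
      ← LinearMap.add_apply, ← map_add, ← h.y_eq n]
  have h2 := π.le_re_inner_y h ψ
  have h3 : 0 ≤ α * ‖π.toAlgHom (y 0) ψ‖ ^ 2 := by positivity
  have h4 : ‖ψ‖ ^ 2 ≤ (⟪ψ, π.toAlgHom (y 0) φ⟫_ℂ).re := by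
    rw [h1, inner_add_right, Complex.add_re, inner_smul_right, ← Complex.ofReal_natCast,
      Complex.re_ofReal_mul]
    have h5 : (⟪ψ, ψ⟫_ℂ).re = ‖ψ‖ ^ 2 := inner_self_eq_norm_sq (𝕜 := ℂ) ψ
    have h6 : (0 : ℝ) ≤ n * (⟪ψ, π.toAlgHom (y 0) ψ⟫_ℂ).re :=
      mul_nonneg n.cast_nonneg (h3.trans h2)
    rw [h5]
    exact le_add_of_nonneg_right h6
  calc _ ≤ ‖ψ‖ * ‖π.toAlgHom (y 0) φ‖ :=
        h4.trans ((Complex.re_le_norm _).trans (norm_inner_le_norm _ _))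
    _ ≤ ‖ψ‖ * (C * ‖φ‖) := mul_le_mul_of_nonneg_left (hC φ) (norm_nonneg _)
    _ = _ := by ring

theorem StarRep.mem_bdd (hα : 0 < α) (h : AuxRelations α x y) (hg : Generates x y) (t : A) :
    t ∈ π.bdd := by
  have hy := π.y_mem_bdd hα h
  have hX : ∀ k, x (.pos k) .zero ∈ π.bdd := fun k => by
    refine π.mem_bdd_of_sum (t := fun k => x (.pos k) .zero) Finset.univ ?_ (Finset.mem_univ k)
    rw [h.sum_single]
    exact sub_mem (hy 0) (π.bdd.smul_mem (mul_mem (hy 0) (hy 0)) _)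
  have hXs : ∀ k, star (x (.pos k) .zero) ∈ π.bdd := fun k => π.star_mem_bdd (hX k)
  have hZ : ∀ k l, x (.pos k) (.pos l) ∈ π.bdd := fun k l => by
    refine π.mem_bdd_of_sum (t := fun p : Fin d × Fin d => x (.pos p.1) (.pos p.2))
      Finset.univ ?_ (Finset.mem_univ (k, l))
    rw [Fintype.sum_prod_type_right, h.sum_pair]
    exact mul_mem (sub_mem (one_mem _) (π.bdd.smul_mem (hy 0) _))
      (sub_mem (one_mem _) (π.bdd.smul_mem (hy 0) _))
  have hZs : ∀ k l, x (.neg k) (.neg l) ∈ π.bdd := fun k l => by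
    rw [h.neg_neg]; exact π.star_mem_bdd (hZ k l)
  have hW : ∀ k l, x (.pos k) (.neg l) ∈ π.bdd := fun k l => by
    refine π.mem_bdd_of_star_mul_self ?_
    -- In this ordering `W* W` is `Z* Z` plus terms `x_{-l,k} y_0 = X_l* X_k` and a multiple of
    -- `y_0²`, all already known to be bounded.
    rw [h.star_pos_neg, h.W_mul_W']
    simp only [add_mul, smul_mul_assoc, h.star_X_mul_X]
    refine add_mem (mul_mem (hZs _ _) (hZ _ _)) (add_mem (add_mem (add_mem ?_ ?_) ?_) ?_)
    · exact π.bdd.smul_mem (mul_mem (hXs _) (hX _)) _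
    · exact π.bdd.smul_mem (mul_mem (hXs _) (hX _)) _
    · exact π.bdd.smul_mem (mul_mem (hXs _) (hX _)) _
    · exact π.bdd.smul_mem (mul_mem (hy 0) (hy 0)) _
  refine hg π.bdd (fun k l => ?_) hy t
  cases k with
  | zero => cases l with
    | zero => rw [h.zero_zero]; exact hy 0
    | pos l => rw [h.zero_pos]; exact hX l
    | neg l => rw [h.zero_neg]; exact hXs l
  | pos k => cases l with
    | zero => exact hX k
    | pos l => exact hZ k l
    | neg l => exact hW k l
  | neg k => cases l with
    | zero => rw [h.neg_zero]; exact hXs k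
    | pos l => rw [h.neg_pos]; exact sub_mem (hW _ _) (π.bdd.smul_mem (hy 0) _)
    | neg l => exact hZs k l

end Bounded

/-! ### Extension from the dense subspace to the Hilbert space -/

section Extension

variable {A : Type*} [Ring A] [Algebra ℂ A] [StarRing A]
variable {H : Type*} [NormedAddCommGroup H] [InnerProductSpace ℂ H]

theorem clm_ext_of_dense {G : Type*} [NormedAddCommGroup G] [InnerProductSpace ℂ G]
    {D : Submodule ℂ H} (hD : Dense (D : Set H)) {S T : H →L[ℂ] G}
    (h : ∀ φ : D, S φ = T φ) : S = T := by
  refine ContinuousLinearMap.coeFn_injective (hD.denseRange_val.equalizer S.continuous T.continuous ?_)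
  exact funext h

variable [CompleteSpace H]

/-- A `*`-representation by bounded operators on a dense subspace extends to the Hilbert space. -/
theorem StarRep.exists_extendsTo {D : Submodule ℂ H} (hD : Dense (D : Set H)) (π : StarRep A D)
    (hb : ∀ t, t ∈ π.bdd) : ∃ P : A →⋆ₐ[ℂ] (H →L[ℂ] H), π.ExtendsTo P := by
  have hdr : DenseRange D.subtype := hD.denseRange_val
  have hex : ∀ t, ∃ T : H →L[ℂ] H, ∀ φ : D, T φ = π.toAlgHom t φ := fun t => by
    obtain ⟨C, hC⟩ := hb t
    exact ⟨(D.subtype ∘ₗ π.toAlgHom t).extendOfNorm D.subtype, fun φ =>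
      LinearMap.extendOfNorm_eq (f := D.subtype ∘ₗ π.toAlgHom t) hdr ⟨C, hC⟩ φ⟩
  choose T hT using hex
  refine ⟨{ toFun := T
            map_one' := ?_
            map_mul' := fun s t => ?_
            map_zero' := ?_
            map_add' := fun s t => ?_
            commutes' := fun c => ?_
            map_star' := fun t => ?_ }, hT⟩
  · exact clm_ext_of_dense hD fun φ => by simp [hT]
  · refine clm_ext_of_dense hD fun φ => ?_
    rw [hT, map_mul, Module.End.mul_apply]
    change _ = T s (T t φ)
    rw [hT, hT]
  · exact clm_ext_of_dense hD fun φ => by simp [hT]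
  · exact clm_ext_of_dense hD fun φ => by simp [hT]
  · refine clm_ext_of_dense hD fun φ => ?_
    rw [hT, AlgHom.commutes, Module.algebraMap_end_apply, Algebra.algebraMap_eq_smul_one]
    rfl
  · rw [ContinuousLinearMap.star_eq_adjoint]
    refine clm_ext_of_dense hD fun φ => ?_
    refine hD.eq_of_inner_left (𝕜 := ℂ) fun ψ hψ => ?_
    rw [ContinuousLinearMap.adjoint_inner_left, hT t ⟨ψ, hψ⟩, hT]
    have := π.inner_map (star t) φ ⟨ψ, hψ⟩
    rw [star_star] at this
    exact this

end Extension


/-! ### Lowering a spectral value of `y_0` -/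

section Lowering

variable {A : Type*} [Ring A]

-- Since `p - p(t) = (X - t) q`, the scalar `p(t)` equals `(Q - q(a)) (a - t)`; division by `p(t) ≠
-- 0` gives the left inverse.
open Polynomial in
theorem exists_left_inv_of_aeval_eq [Algebra ℂ A] {a Q : A} {t : ℂ} {p : ℂ[X]} (hp : p.eval t ≠ 0)
    (h : aeval a p = Q * (a - t • 1)) : ∃ L, L * (a - t • 1) = 1 := by
  obtain ⟨q, hq⟩ := X_sub_C_dvd_sub_C_eval (a := t) (p := p)
  have h1 := congrArg (aeval a) hq
  rw [mul_comm, map_sub, map_mul, map_sub, aeval_X, aeval_C, aeval_C, h,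
    Algebra.algebraMap_eq_smul_one, Algebra.algebraMap_eq_smul_one] at h1
  refine ⟨(p.eval t)⁻¹ • (Q - aeval a q), ?_⟩
  rw [smul_mul_assoc, sub_mul, ← h1, sub_sub_cancel, smul_smul, inv_mul_cancel₀ hp, one_smul]

theorem isUnit_of_left_inv_of_isSelfAdjoint [StarRing A] {b L : A} (hb : IsSelfAdjoint b) (h : L * b = 1) :
    IsUnit b := by
  have h1 : b * star L = 1 := by simpa [hb.star_eq] using congrArg star h
  exact isUnit_iff_exists.2 ⟨L, by rwa [left_inv_eq_right_inv h h1], h⟩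

variable [Algebra ℂ A] [StarRing A] {d : ℕ} {α : ℝ} {x : Index d → Index d → A} {y : ℕ → A}

/-- A substitute for `y_0 X_k = X_k (N + α - 1)⁻¹`, whose right side need not make sense in the
algebra: the factor `1 - y_0` clears the denominator. -/
theorem AuxRelations.y_mul_X (h : AuxRelations α x y) (k : Fin d) :
    y 0 * x (.pos k) .zero * (1 - y 0) = x (.pos k) .zero * y 0 := by
  have h1 := h.y_eq 1
  rw [Nat.cast_one, one_smul] at h1
  rw [mul_sub, mul_one, mul_assoc, h.X_mul_y, ← mul_assoc, ← sub_mul]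
  rw [sub_eq_of_eq_add h1]

-- The condition `ht` says `t' = t / (1 - t)`. From `AuxRelations.y_mul_X`, `(y_0 - t') X_k (1 -
-- y_0) = (1 + t') X_k (y_0 - t)`. If `y_0 - t'` is invertible, then `X_k (1 - y_0)` is a left
-- multiple of `y_0 - t`, and summing `X_k* X_k (1 - y_0)` shows the same for `(y_0 - α y_0²)(1 -
-- y_0)`. This polynomial does not vanish at `t`, so `y_0 - t` has a left inverse, and being
-- self-adjoint it is invertible.
open Polynomial in
theorem AuxRelations.isUnit_of_lower [StarModule ℂ A] (h : AuxRelations α x y) {t t' : ℝ}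
    (ht : (1 + t') * t = t') (ht0 : t ≠ 0) (ht1 : t ≠ 1) (htα : α * t ≠ 1)
    (hu : IsUnit (y 0 - (t' : ℂ) • 1)) : IsUnit (y 0 - (t : ℂ) • 1) := by
  have htc : (1 + (t' : ℂ)) * t = t' := by exact_mod_cast ht
  obtain ⟨r, -, hr⟩ := isUnit_iff_exists.1 hu
  have h1 : ∀ k, x (.pos k) .zero * (1 - y 0) =
      (1 + (t' : ℂ)) • (r * x (.pos k) .zero) * (y 0 - (t : ℂ) • 1) := fun k => by
    have h2 : (y 0 - (t' : ℂ) • 1) * (x (.pos k) .zero * (1 - y 0)) =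
        (1 + (t' : ℂ)) • (x (.pos k) .zero * (y 0 - (t : ℂ) • 1)) := by
      rw [sub_mul, ← mul_assoc, h.y_mul_X, smul_one_mul]
      simp only [mul_sub, mul_one, mul_smul_comm, smul_sub, smul_smul, htc, add_smul, one_smul]
      abel
    rw [smul_mul_assoc, mul_assoc, ← mul_smul_comm, ← h2, ← mul_assoc, hr, one_mul]
  have h3 : aeval (y 0) ((X - C (α : ℂ) * (X * X)) * (1 - X) : ℂ[X]) =
      (∑ k, star (x (.pos k) .zero) * ((1 + (t' : ℂ)) • (r * x (.pos k) .zero))) *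
        (y 0 - (t : ℂ) • 1) := by
    have h4 : (y 0 - (α : ℂ) • (y 0 * y 0)) * (1 - y 0) =
        (∑ k, star (x (.pos k) .zero) * ((1 + (t' : ℂ)) • (r * x (.pos k) .zero))) *
        (y 0 - (t : ℂ) • 1) := by
      rw [← h.sum_single, Finset.sum_mul, Finset.sum_mul]
      exact Finset.sum_congr rfl fun k _ => by rw [mul_assoc, h1, mul_assoc]
    rw [← h4]
    simp [Algebra.algebraMap_eq_smul_one]
  have hp : ((X - C (α : ℂ) * (X * X)) * (1 - X) : ℂ[X]).eval (t : ℂ) ≠ 0 := by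
    have h5 : (t - α * (t * t)) * (1 - t) ≠ 0 := by
      have : t - α * (t * t) = t * (1 - α * t) := by ring
      rw [this]
      exact mul_ne_zero (mul_ne_zero ht0 (sub_ne_zero.2 htα.symm)) (sub_ne_zero.2 ht1.symm)
    have h6 : (((t - α * (t * t)) * (1 - t) : ℝ) : ℂ) ≠ 0 := by exact_mod_cast h5
    simpa using h6
  obtain ⟨L, hL⟩ := exists_left_inv_of_aeval_eq hp h3
  refine isUnit_of_left_inv_of_isSelfAdjoint ?_ hL
  simp [IsSelfAdjoint, h.star_y]

-- At `t = 1` lowering would lead to `t' = ∞`. Instead, `X_k y_0 = y_0 X_k (1 - y_0)` directly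
-- exhibits `(y_0 - α y_0²) y_0` as a left multiple of `y_0 - 1`, and the polynomial takes the value
-- `1 - α ≠ 0` at `1`.
open Polynomial in
theorem AuxRelations.isUnit_sub_one [StarModule ℂ A] (h : AuxRelations α x y) (hα : α ≠ 1) :
    IsUnit (y 0 - ((1 : ℝ) : ℂ) • 1) := by
  have h3 : aeval (y 0) ((X - C (α : ℂ) * (X * X)) * X : ℂ[X]) =
      (-∑ k, star (x (.pos k) .zero) * (y 0 * x (.pos k) .zero)) *
        (y 0 - ((1 : ℝ) : ℂ) • 1) := by
    have h4 : (y 0 - (α : ℂ) • (y 0 * y 0)) * y 0 =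
        (-∑ k, star (x (.pos k) .zero) * (y 0 * x (.pos k) .zero)) *
        (y 0 - ((1 : ℝ) : ℂ) • 1) := by
      rw [← h.sum_single, neg_mul, ← mul_neg, neg_sub, Complex.ofReal_one, one_smul,
        Finset.sum_mul, Finset.sum_mul]
      exact Finset.sum_congr rfl fun k _ => by rw [mul_assoc, mul_assoc, h.y_mul_X]
    rw [← h4]
    simp [Algebra.algebraMap_eq_smul_one]
  have hp : ((X - C (α : ℂ) * (X * X)) * X : ℂ[X]).eval ((1 : ℝ) : ℂ) ≠ 0 := by
    have h6 : (1 : ℂ) - α ≠ 0 := sub_ne_zero.2 (by exact_mod_cast hα.symm)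
    simpa using h6
  obtain ⟨L, hL⟩ := exists_left_inv_of_aeval_eq hp h3
  refine isUnit_of_left_inv_of_isSelfAdjoint ?_ hL
  simp [IsSelfAdjoint, h.star_y]

end Lowering

/-! ### Spectrum, kernel and eigenspaces of `y_0` -/

section Operators

variable {H : Type*} [NormedAddCommGroup H] [InnerProductSpace ℂ H]

theorem mem_spectrum_real_iff {T : H →L[ℂ] H} {t : ℝ} :
    t ∈ spectrum ℝ T ↔ ¬IsUnit (T - (t : ℂ) • 1) := by
  rw [spectrum.mem_iff, ← IsUnit.neg_iff, neg_sub, Algebra.algebraMap_eq_smul_one]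
  rfl

variable [CompleteSpace H]
variable {d : ℕ} {α : ℝ} {x : Index d → Index d → H →L[ℂ] H} {y : ℕ → H →L[ℂ] H}

theorem inner_star_left (T : H →L[ℂ] H) (φ ψ : H) : ⟪star T φ, ψ⟫_ℂ = ⟪φ, T ψ⟫_ℂ := by
  rw [ContinuousLinearMap.star_eq_adjoint, ContinuousLinearMap.adjoint_inner_left]

theorem inner_star_right (T : H →L[ℂ] H) (φ ψ : H) : ⟪φ, star T ψ⟫_ℂ = ⟪T φ, ψ⟫_ℂ := by
  rw [ContinuousLinearMap.star_eq_adjoint, ContinuousLinearMap.adjoint_inner_right]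

theorem apply_eq_zero_of_star_mul {T : H →L[ℂ] H} {φ : H} (h : (star T * T) φ = 0) : T φ = 0 := by
  refine inner_self_eq_zero (𝕜 := ℂ).1 ?_
  rw [← inner_star_right]
  change ⟪φ, (star T * T) φ⟫_ℂ = 0
  rw [h, inner_zero_right]

/-- The operator `y_0 - α y_0²` is a sum of squares, so spectral mapping gives `t - α t² ≥ 0`. -/
theorem AuxRelations.mem_spectrum (hα : 0 < α) (h : AuxRelations α x y) {t : ℝ}
    (ht : t ∈ spectrum ℝ (y 0)) : 0 ≤ t ∧ α * t ≤ 1 := by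
  have h1 : (0 : H →L[ℂ] H) ≤ y 0 - (α : ℂ) • (y 0 * y 0) := by
    rw [← h.sum_single]
    exact Finset.sum_nonneg fun k _ => star_mul_self_nonneg _
  have h2 : t - α * (t * t) ∈ spectrum ℝ (y 0 - (α : ℂ) • (y 0 * y 0)) := by
    have h3 := spectrum.subset_polynomial_aeval (y 0)
      (Polynomial.X - Polynomial.C α * (Polynomial.X * Polynomial.X)) ⟨t, ht, rfl⟩
    have h4 : Polynomial.aeval (y 0)
        (Polynomial.X - Polynomial.C α * (Polynomial.X * Polynomial.X)) =
        y 0 - (α : ℂ) • (y 0 * y 0) := by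
      simp [Algebra.algebraMap_eq_smul_one]
    rw [h4] at h3
    simpa using h3
  have h5 := spectrum_nonneg_of_nonneg h1 h2
  have h6 : 0 ≤ t := by nlinarith
  refine ⟨h6, ?_⟩
  by_contra! h7
  have h8 : 0 < t := by
    rcases h6.eq_or_lt with h9 | h9
    · rw [← h9, mul_zero] at h7
      linarith
    · exact h9
  nlinarith

/-- The spectrum of `y 0 = (N + α)⁻¹` consists of `0` and of the numbers `(α + j)⁻¹`. -/
theorem AuxRelations.eq_of_mem_spectrum (hα : 0 < α) (hα1 : α ≠ 1) (h : AuxRelations α x y) {t : ℝ}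
    (ht : t ∈ spectrum ℝ (y 0)) (ht0 : t ≠ 0) : ∃ j : ℕ, t = (α + j)⁻¹ := by
  -- Each lowering step decreases `t⁻¹` by one, so the induction runs on a natural bound for `t⁻¹ -
  -- α`. In the base case `t⁻¹ < α`, which contradicts `α t ≤ 1`.
  obtain ⟨n, hn⟩ := exists_nat_gt (t⁻¹ - α)
  induction n generalizing t with
  | zero =>
    obtain ⟨h1, h2⟩ := h.mem_spectrum hα ht
    have h3 : 0 < t := lt_of_le_of_ne h1 ht0.symm
    rw [Nat.cast_zero, sub_neg, inv_lt_comm₀ h3 hα] at hn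
    have h4 := mul_lt_mul_of_pos_left hn hα
    rw [mul_inv_cancel₀ hα.ne'] at h4
    linarith
  | succ n ih =>
    by_cases htα : α * t = 1
    · exact ⟨0, by rw [Nat.cast_zero, add_zero]; exact eq_inv_of_mul_eq_one_right htα⟩
    have ht1 : t ≠ 1 := by
      rintro rfl
      exact mem_spectrum_real_iff.1 ht (h.isUnit_sub_one hα1)
    have h1t : 1 - t ≠ 0 := sub_ne_zero.2 ht1.symm
    have ht' : t / (1 - t) ∈ spectrum ℝ (y 0) := by
      rw [mem_spectrum_real_iff] at ht ⊢
      refine fun hu => ht (h.isUnit_of_lower ?_ ht0 ht1 htα hu)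
      field_simp
      ring
    have hinv : (t / (1 - t))⁻¹ = t⁻¹ - 1 := by field_simp
    obtain ⟨j, hj⟩ := ih ht' (div_ne_zero ht0 h1t) (by
      rw [hinv]
      push_cast at hn
      linarith)
    refine ⟨j + 1, ?_⟩
    rw [eq_comm, inv_eq_iff_eq_inv] at hj ⊢
    rw [hinv] at hj
    push_cast
    linarith

theorem AuxRelations.y_apply_eq_zero (h : AuxRelations α x y) {φ : H} (hφ : y 0 φ = 0) (n : ℕ) :
    y n φ = 0 := by
  have h1 := congrArg (fun T : H →L[ℂ] H => T φ) (h.y_eq n)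
  rw [h.y_mul_y] at h1
  change y 0 φ = y n φ + (n : ℂ) • y n (y 0 φ) at h1
  rw [hφ, map_zero, smul_zero, add_zero] at h1
  exact h1.symm

theorem AuxRelations.y_zero_apply_eq_zero (h : AuxRelations α x y) {φ : H} {n : ℕ}
    (hφ : y n φ = 0) : y 0 φ = 0 := by
  have h1 := congrArg (fun T : H →L[ℂ] H => T φ) (h.y_eq n)
  change y 0 φ = y n φ + (n : ℂ) • y 0 (y n φ) at h1
  rw [h1, hφ, map_zero, smul_zero, add_zero]

theorem AuxRelations.X_apply_eq_zero (h : AuxRelations α x y) {φ : H} (hφ : y 0 φ = 0)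
    (k : Fin d) : x (.pos k) .zero φ = 0 := by
  refine apply_eq_zero_of_star_mul ?_
  rw [← h.star_X_mul_X]
  change x _ _ (y 0 φ) = 0
  rw [hφ, map_zero]

theorem AuxRelations.star_X_apply_eq_zero (h : AuxRelations α x y) {φ : H} (hφ : y 0 φ = 0)
    (k : Fin d) : star (x (.pos k) .zero) φ = 0 := by
  refine apply_eq_zero_of_star_mul ?_
  rw [star_star, h.X_mul_star_X]
  change x _ _ ((1 - y 1) (y 1 φ)) = 0
  rw [h.y_apply_eq_zero hφ, map_zero, map_zero]

/-- All `y_n` have the same kernel. The `X` and `X*` vanish on it, `W` commutes with `y_0`, and `Z`,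
`Z*` only exchange `y_0` with `y_2`, so each generator preserves it. -/
theorem AuxRelations.y_x_apply_eq_zero (h : AuxRelations α x y) {φ : H} (hφ : y 0 φ = 0)
    (k l : Index d) : y 0 (x k l φ) = 0 := by
  have hW : ∀ k l, y 0 (x (.pos k) (.neg l) φ) = 0 := fun k l => by
    change (y 0 * x (.pos k) (.neg l)) φ = 0
    rw [← h.W_mul_y]
    change x (.pos k) (.neg l) (y 0 φ) = 0
    rw [hφ, map_zero]
  cases k with
  | zero => cases l with
    | zero => rw [h.zero_zero, hφ, map_zero]
    | pos l => rw [h.zero_pos, h.X_apply_eq_zero hφ, map_zero]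
    | neg l => rw [h.zero_neg, h.star_X_apply_eq_zero hφ, map_zero]
  | pos k => cases l with
    | zero => rw [h.X_apply_eq_zero hφ, map_zero]
    | pos l =>
      refine h.y_zero_apply_eq_zero (n := 2) ?_
      change (y 2 * x (.pos k) (.pos l)) φ = 0
      rw [← h.Z_mul_y]
      change x (.pos k) (.pos l) (y 0 φ) = 0
      rw [hφ, map_zero]
    | neg l => exact hW k l
  | neg k => cases l with
    | zero => rw [h.neg_zero, h.star_X_apply_eq_zero hφ, map_zero]
    | pos l =>
      rw [h.neg_pos]
      rw [sub_apply, smul_apply, map_sub, hW, hφ, smul_zero, map_zero, sub_zero]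
    | neg l =>
      have h1 := congrArg star (h.Z_mul_y k l)
      rw [star_mul, star_mul, h.star_y, h.star_y, ← h.neg_neg] at h1
      change (y 0 * x (.neg k) (.neg l)) φ = 0
      rw [h1]
      change x (.neg k) (.neg l) (y 2 φ) = 0
      rw [h.y_apply_eq_zero hφ, map_zero]

/-- `∑ ‖X_k ψ‖² = ⟪ψ, (y_0 - α y_0²) ψ⟫`, and `t - α t²` vanishes at `t = α⁻¹`. -/
theorem AuxRelations.X_apply_eq_zero_of_eigen (hα : 0 < α) (h : AuxRelations α x y) {ψ : H}
    (hψ : y 0 ψ = (α⁻¹ : ℂ) • ψ) (k : Fin d) : x (.pos k) .zero ψ = 0 := by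
  have hα' : (α : ℂ) ≠ 0 := by exact_mod_cast hα.ne'
  have h1 : (y 0 - (α : ℂ) • (y 0 * y 0)) ψ = 0 := by
    change y 0 ψ - (α : ℂ) • y 0 (y 0 ψ) = 0
    rw [hψ, map_smul, hψ, smul_smul, smul_smul, ← sub_smul, mul_inv_cancel₀ hα',
      one_mul, sub_self, zero_smul]
  have h2 : ∑ k, ‖x (.pos k) .zero ψ‖ ^ 2 = 0 := by
    have h3 : (⟪ψ, (∑ k, star (x (.pos k) .zero) * x (.pos k) .zero) ψ⟫_ℂ).re = 0 := by
      rw [h.sum_single, h1, inner_zero_right, Complex.zero_re]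
    rw [← h3, sum_apply, inner_sum, Complex.re_sum]
    refine Finset.sum_congr rfl fun k _ => ?_
    change _ = (⟪ψ, star (x (.pos k) .zero) (x (.pos k) .zero ψ)⟫_ℂ).re
    rw [inner_star_right]
    exact (inner_self_eq_norm_sq (𝕜 := ℂ) _).symm
  have h4 := (Finset.sum_eq_zero_iff_of_nonneg fun k _ => by positivity).1 h2 k (Finset.mem_univ k)
  exact norm_eq_zero.1 (pow_eq_zero_iff two_ne_zero |>.1 h4)

/-- An eigenvector `φ` at `(α + j + 1)⁻¹` is lowered by `X_k` to the eigenvalue `(α + j)⁻¹`, and `∑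
X_k* X_k φ` is `(j + 1) (α + j + 1)⁻²` times `φ`. Since this factor is nonzero, `φ` is recovered
from vectors one step lower. -/
theorem AuxRelations.eigenspace_le (hα : 0 < α) (h : AuxRelations α x y) {G : Submodule ℂ H}
    (h0 : ∀ ψ, y 0 ψ = (α⁻¹ : ℂ) • ψ → ψ ∈ G)
    (hG : ∀ k, ∀ ψ ∈ G, star (x (.pos k) .zero) ψ ∈ G) (j : ℕ) (φ : H)
    (hφ : y 0 φ = ((α + j : ℂ)⁻¹) • φ) : φ ∈ G := by
  induction j generalizing φ with
  | zero => exact h0 φ (by simpa using hφ)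
  | succ j ih =>
    have hj : (α + j : ℂ) ≠ 0 := by
      have : α + j ≠ 0 := by positivity
      exact_mod_cast this
    have hj1 : (α + j + 1 : ℂ) ≠ 0 := by
      have : α + j + 1 ≠ 0 := by positivity
      exact_mod_cast this
    push_cast at hφ
    rw [← add_assoc] at hφ
    have h1 : ∀ k, x (.pos k) .zero φ ∈ G := fun k => by
      refine ih _ ?_
      have h2 := congrArg (fun T : H →L[ℂ] H => T φ) (h.y_mul_X k)
      change y 0 (x (.pos k) .zero (φ - y 0 φ)) = x (.pos k) .zero (y 0 φ) at h2
      rw [hφ, map_sub, map_smul, map_sub, map_smul] at h2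
      have h3 : ((α + j) / (α + j + 1) : ℂ) • y 0 (x (.pos k) .zero φ) =
          (α + j + 1 : ℂ)⁻¹ • x (.pos k) .zero φ := by
        rw [← h2]
        nth_rw 2 [← one_smul ℂ (y 0 (x (.pos k) .zero φ))]
        rw [← sub_smul]
        congr 1
        field_simp
        ring
      rw [← inv_smul_smul₀ (div_ne_zero hj hj1) (y 0 (x (.pos k) .zero φ)), h3, smul_smul]
      congr 1
      field_simp
    have h4 := congrArg (fun T : H →L[ℂ] H => T φ) h.sum_single
    change (∑ k, star (x (.pos k) .zero) * x (.pos k) .zero) φ = y 0 φ - (α : ℂ) • y 0 (y 0 φ) at h4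
    rw [hφ, map_smul, hφ, smul_smul, smul_smul, ← sub_smul, sum_apply] at h4
    have h5 : (α + j + 1 : ℂ)⁻¹ - α * (α + j + 1 : ℂ)⁻¹ * (α + j + 1 : ℂ)⁻¹ ≠ 0 := by
      have : (α + j + 1 : ℂ)⁻¹ - α * (α + j + 1 : ℂ)⁻¹ * (α + j + 1 : ℂ)⁻¹ =
        (j + 1) * ((α + j + 1 : ℂ)⁻¹ * (α + j + 1 : ℂ)⁻¹) := by field_simp; ring
      rw [this]
      exact mul_ne_zero (Nat.cast_add_one_ne_zero j)
        (mul_ne_zero (inv_ne_zero hj1) (inv_ne_zero hj1))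
    refine (G.smul_mem_iff h5).1 ?_
    rw [← h4]
    exact G.sum_mem fun k _ => hG k _ (h1 k)

end Operators


/-! ### Eigenvectors span the complement of the kernel -/

section Spectrum

/-- A continuous function which is `1` at `(α + j)⁻¹` and vanishes at `0` and at all other
`(α + i)⁻¹`. -/
def bump (α : ℝ) (j : ℕ) (t : ℝ) : ℝ :=
  max 0 (1 - |t - (α + j)⁻¹| / ((α + j)⁻¹ - (α + (j + 1 : ℕ))⁻¹))

theorem continuous_bump (α : ℝ) (j : ℕ) : Continuous (bump α j) := by
  unfold bump
  fun_prop

variable {α : ℝ}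

theorem inv_add_lt (hα : 0 < α) {i j : ℕ} (h : i < j) : (α + j)⁻¹ < (α + i)⁻¹ := by
  have : (i : ℝ) < j := by exact_mod_cast h
  exact inv_strictAnti₀ (by positivity) (by linarith)

theorem inv_add_le (hα : 0 < α) {i j : ℕ} (h : i ≤ j) : (α + j)⁻¹ ≤ (α + i)⁻¹ := by
  have : (i : ℝ) ≤ j := by exact_mod_cast h
  exact inv_anti₀ (by positivity) (by linarith)

theorem bump_self (j : ℕ) : bump α j (α + j)⁻¹ = 1 := by
  simp [bump]

theorem bump_eq_zero (hα : 0 < α) {j : ℕ} {t : ℝ}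
    (h : (α + j)⁻¹ - (α + (j + 1 : ℕ))⁻¹ ≤ |t - (α + j)⁻¹|) : bump α j t = 0 := by
  have h1 : 0 < (α + j)⁻¹ - (α + (j + 1 : ℕ))⁻¹ := sub_pos.2 (inv_add_lt hα j.lt_succ_self)
  refine max_eq_left (sub_nonpos.2 ?_)
  rwa [one_le_div h1]

theorem bump_zero (hα : 0 < α) (j : ℕ) : bump α j 0 = 0 := by
  refine bump_eq_zero hα ?_
  have h1 : 0 < (α + (j + 1 : ℕ))⁻¹ := by positivity
  rw [zero_sub, abs_neg, abs_of_pos (by positivity)]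
  linarith

theorem bump_of_ne (hα : 0 < α) {i j : ℕ} (h : i ≠ j) : bump α j (α + i)⁻¹ = 0 := by
  refine bump_eq_zero hα ?_
  rcases lt_or_gt_of_ne h with h | h
  · have h1 := inv_add_le hα (Nat.succ_le_of_lt h)
    have h2 := inv_add_lt hα h
    rw [abs_of_pos (sub_pos.2 h2)]
    have hi : (0 : ℝ) < α + i := by positivity
    have hi1 : (0 : ℝ) < α + j := by positivity
    have h3 : (i : ℝ) + 1 ≤ j := by exact_mod_cast h
    -- The half-width of the tent is the gap to the next smaller point. The distance to a larger
    -- point is at least that: compare `1 / ((α + j)(α + j + 1))` with `(j - i) / ((α + i)(α + j))`.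
    rw [inv_sub_inv hi1.ne' (by positivity), inv_sub_inv hi.ne' hi1.ne']
    refine div_le_div₀ (by linarith) (by push_cast; linarith) (by positivity) ?_
    push_cast
    nlinarith
  · rw [abs_sub_comm, abs_of_pos (sub_pos.2 (inv_add_lt hα h))]
    exact sub_le_sub_left (inv_add_le hα h) _

variable {H : Type*} [NormedAddCommGroup H] [InnerProductSpace ℂ H] [CompleteSpace H]
variable {a : H →L[ℂ] H}

/-- If the spectrum of a self-adjoint operator consists of `0` and of the numbers `(α + j)⁻¹`, then
the range of the operator is contained in every closed subspace that contains the corresponding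
eigenspaces. -/
theorem apply_mem_of_eigenspaces (hα : 0 < α) (ha : IsSelfAdjoint a)
    (hs : ∀ t ∈ spectrum ℝ a, t ≠ 0 → ∃ j : ℕ, t = (α + j)⁻¹) {G : Submodule ℂ H}
    (hc : IsClosed (G : Set H)) (hG : ∀ (j : ℕ) (φ : H), a φ = ((α + j : ℂ)⁻¹) • φ → φ ∈ G)
    (φ : H) : a φ ∈ G := by
  have hb : ∀ j, ContinuousOn (bump α j) (spectrum ℝ a) :=
    fun j => (continuous_bump α j).continuousOn
  have hmem : ∀ j, cfc (bump α j) a φ ∈ G := fun j => by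
    refine hG j _ ?_
    -- On the spectrum `bump α j` is supported at the single point `(α + j)⁻¹`, so its values under
    -- the functional calculus are eigenvectors.
    have h1 : a * cfc (bump α j) a = ((α + j)⁻¹ : ℝ) • cfc (bump α j) a := by
      rw [← cfc_const_mul _ _ _ (hb j)]
      nth_rw 1 [← cfc_id ℝ a]
      rw [← cfc_mul _ _ _ continuousOn_id (hb j)]
      refine cfc_congr fun t ht => ?_
      rcases eq_or_ne t 0 with rfl | ht0
      · simp [bump_zero hα]
      · obtain ⟨i, rfl⟩ := hs t ht ht0
        rcases eq_or_ne i j with rfl | hij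
        · rfl
        · simp [bump_of_ne hα hij]
    have h2 := congrArg (fun T : H →L[ℂ] H => T φ) h1
    change a (cfc (bump α j) a φ) = (((α + j)⁻¹ : ℝ) : ℂ) • cfc (bump α j) a φ at h2
    simpa using h2
  -- On the spectrum the remaining function is `0` at the first `m` points and equals `(α + i)⁻¹`,
  -- `i ≥ m`, at the later ones; so the series converges to `a` in norm.
  have hnorm : ∀ m : ℕ, ‖a - ∑ j ∈ Finset.range m, ((α + j)⁻¹ : ℝ) • cfc (bump α j) a‖ ≤
      (α + m)⁻¹ := fun m => by
    have hcj : ∀ j ∈ Finset.range m,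
        ContinuousOn (fun t => (α + j)⁻¹ * bump α j t) (spectrum ℝ a) :=
      fun j _ => continuousOn_const.mul (hb j)
    have h1 : a - ∑ j ∈ Finset.range m, ((α + j)⁻¹ : ℝ) • cfc (bump α j) a =
        cfc (fun t => t - (∑ j ∈ Finset.range m, fun t => (α + j)⁻¹ * bump α j t) t) a := by
      rw [cfc_sub (fun t => t) _ a continuousOn_id (by
        convert continuousOn_finsetSum _ hcj using 1
        ext t
        exact Finset.sum_apply t _ _), cfc_id' ℝ a, cfc_sum _ _ _ hcj]
      congr 1
      exact Finset.sum_congr rfl fun j _ => (cfc_const_mul _ _ _ (hb j)).symm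
    rw [h1]
    have hpos : ∀ i : ℕ, 0 < (α + i)⁻¹ := fun i => by positivity
    refine norm_cfc_le (hpos m).le fun t ht => ?_
    rw [Finset.sum_apply]
    rcases eq_or_ne t 0 with rfl | ht0
    · simp [bump_zero hα, (hpos m).le]
    · obtain ⟨i, rfl⟩ := hs t ht ht0
      rcases lt_or_ge i m with him | him
      · rw [Finset.sum_eq_single i (fun j _ hj => by simp [bump_of_ne hα hj.symm])
          (fun hi => absurd (Finset.mem_range.2 him) hi), bump_self, mul_one, sub_self, norm_zero]
        exact (hpos m).le
      · rw [Finset.sum_eq_zero fun j hj => by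
          rw [bump_of_ne hα ((Finset.mem_range.1 hj).trans_le him).ne', mul_zero], sub_zero,
          Real.norm_of_nonneg (hpos i).le]
        exact inv_add_le hα him
  have hlim : Filter.Tendsto
      (fun m : ℕ => (∑ j ∈ Finset.range m, ((α + j)⁻¹ : ℝ) • cfc (bump α j) a) φ)
      Filter.atTop (nhds (a φ)) := by
    rw [tendsto_iff_norm_sub_tendsto_zero]
    have h0 : Filter.Tendsto (fun m : ℕ => (α + m)⁻¹ * ‖φ‖) Filter.atTop (nhds 0) := by
      simpa using (tendsto_inv_atTop_zero.comp (Filter.tendsto_atTop_add_const_left _ α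
        tendsto_natCast_atTop_atTop)).mul_const ‖φ‖
    refine squeeze_zero (fun m => norm_nonneg _) (fun m => ?_) h0
    rw [norm_sub_rev, ← sub_apply]
    exact (ContinuousLinearMap.le_opNorm _ _).trans
      (mul_le_mul_of_nonneg_right (hnorm m) (norm_nonneg φ))
  refine hc.mem_of_tendsto hlim (Filter.Eventually.of_forall fun m => ?_)
  rw [sum_apply]
  exact G.sum_mem fun j _ => G.smul_mem ((((α + j)⁻¹ : ℝ)) : ℂ) (hmem j)

variable {d : ℕ} {x : Index d → Index d → H →L[ℂ] H} {y : ℕ → H →L[ℂ] H}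

/-- For the self-adjoint `y_0` the complement of the kernel is the closure of the range. This
criterion yields cyclicity of the Fock vacuum, completeness of the copies, and the identification of
`H_1`. -/
theorem AuxRelations.orthogonal_ker_le (hα : 0 < α) (hα1 : α ≠ 1) (h : AuxRelations α x y)
    {G : Submodule ℂ H} (hc : IsClosed (G : Set H))
    (h0 : ∀ ψ, y 0 ψ = (α⁻¹ : ℂ) • ψ → ψ ∈ G)
    (hG : ∀ k, ∀ ψ ∈ G, star (x (.pos k) .zero) ψ ∈ G) : (y 0).kerᗮ ≤ G := by
  rw [ContinuousLinearMap.orthogonal_ker, ← ContinuousLinearMap.star_eq_adjoint, h.star_y]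
  refine Submodule.topologicalClosure_minimal _ ?_ hc
  rintro _ ⟨φ, rfl⟩
  exact apply_mem_of_eigenspaces hα (h.star_y 0) (fun t ht => h.eq_of_mem_spectrum hα hα1 ht) hc
    (h.eigenspace_le hα h0 hG) φ

end Spectrum


/-! ### The module generated by a vacuum vector -/

section Module

variable {A : Type*} [Ring A] [Algebra ℂ A] [StarRing A] {d : ℕ} {α : ℝ}
variable {M : Type*} [AddCommGroup M] [Module ℂ M] (Φ : A →ₐ[ℂ] Module.End ℂ M)

/-- The level sets of the module generated by a vacuum vector `v`. -/
def level (x : Index d → Index d → A) (v : M) : ℕ → Submodule ℂ M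
  | 0 => Submodule.span ℂ {v}
  | m + 1 => ⨆ k, (level x v m).map (Φ (star (x (.pos k) .zero)))

variable {x : Index d → Index d → A} {y : ℕ → A} {v : M}

theorem level_succ_induction {p : M → Prop} {m : ℕ} (h0 : p 0) (hadd : ∀ u w, p u → p w → p (u + w))
    (h : ∀ k, ∀ u ∈ level Φ x v m, p (Φ (star (x (.pos k) .zero)) u)) :
    ∀ u ∈ level Φ x v (m + 1), p u := by
  intro u hu
  refine Submodule.iSup_induction _ (motive := p) hu ?_ h0 hadd
  rintro k _ ⟨w, hw, rfl⟩
  exact h k w hw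

theorem star_X_mem_level {m : ℕ} {u : M} (hu : u ∈ level Φ x v m) (k : Fin d) :
    Φ (star (x (.pos k) .zero)) u ∈ level Φ x v (m + 1) :=
  Submodule.mem_iSup_of_mem k (Submodule.mem_map_of_mem hu)

theorem add_natCast_ne_zero {α : ℝ} (hα : 0 < α) (m : ℕ) : (α + m : ℂ) ≠ 0 := by
  have : α + m ≠ 0 := by positivity
  exact_mod_cast this

theorem y_apply_of_y_zero_apply (hα : 0 < α) (h : AuxRelations α x y) {m : ℕ} {u : M}
    (hu : Φ (y 0) u = (α + m : ℂ)⁻¹ • u) (n : ℕ) : Φ (y n) u = (α + m + n : ℂ)⁻¹ • u := by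
  have h1 := congrArg (fun T => Φ T u) (h.y_eq n)
  simp only [h.y_mul_y 0 n, map_add, map_smul, map_mul, LinearMap.add_apply, LinearMap.smul_apply,
    Module.End.mul_apply, hu] at h1
  have hm := add_natCast_ne_zero hα m
  have hmn : (α + m + n : ℂ) ≠ 0 := by
    have := add_natCast_ne_zero hα (m + n)
    push_cast at this
    rwa [add_assoc]
  have h3 : 1 + n * (α + m : ℂ)⁻¹ = (α + m + n) * (α + m : ℂ)⁻¹ := by field_simp
  have h2 : ((α + m + n) * (α + m : ℂ)⁻¹) • Φ (y n) u = (α + m : ℂ)⁻¹ • u := by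
    rw [← h3, add_smul, one_smul, ← smul_smul, h1, smul_smul]
  rw [← inv_smul_smul₀ (mul_ne_zero hmn (inv_ne_zero hm)) (Φ (y n) u), h2, smul_smul]
  congr 1
  field_simp

theorem y_zero_apply_of_mem_level (hα : 0 < α) (h : AuxRelations α x y)
    (hv : Φ (y 0) v = (α⁻¹ : ℂ) • v) (m : ℕ) :
    ∀ u ∈ level Φ x v m, Φ (y 0) u = (α + m : ℂ)⁻¹ • u := by
  induction m with
  | zero =>
    intro u hu
    obtain ⟨c, rfl⟩ := Submodule.mem_span_singleton.1 hu
    rw [map_smul, hv, Nat.cast_zero, add_zero, smul_comm]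
  | succ m ih =>
    refine level_succ_induction Φ (by simp) (fun u w hu hw => ?_) (fun k u hu => ?_)
    · rw [map_add, hu, hw, smul_add]
    · have h1 := congrArg star (h.X_mul_y k)
      rw [star_mul, star_mul, h.star_y, h.star_y] at h1
      have h2 := y_apply_of_y_zero_apply Φ hα h (ih u hu) 1
      rw [← Module.End.mul_apply, ← map_mul, h1, map_mul, Module.End.mul_apply, h2, map_smul]
      push_cast
      rw [add_assoc]

/-- On the level `y_0` is the nonzero scalar `(α + m)⁻¹`, so `x_{-l,k} y_0 = X_l* X_k` determines
the action of `x_{-l,k}`, and `W` differs from it by a multiple of `y_0`. -/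
theorem W_mem_level (hα : 0 < α) (h : AuxRelations α x y) {m : ℕ} {u : M}
    (hu : u ∈ level Φ x v m) (hy : Φ (y 0) u = (α + m : ℂ)⁻¹ • u)
    (hX : ∀ k l, Φ (star (x (.pos l) .zero)) (Φ (x (.pos k) .zero) u) ∈ level Φ x v m)
    (k l : Fin d) : Φ (x (.neg l) (.pos k)) u ∈ level Φ x v m ∧
      Φ (x (.pos k) (.neg l)) u ∈ level Φ x v m := by
  have h1 : Φ (x (.neg l) (.pos k)) u ∈ level Φ x v m := by
    have h2 := congrArg (fun T => Φ T u) (h.star_X_mul_X k l)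
    simp only [map_mul, Module.End.mul_apply, hy, map_smul] at h2
    refine ((level Φ x v m).smul_mem_iff (inv_ne_zero (add_natCast_ne_zero hα m))).1 ?_
    rw [h2]
    exact hX k l
  refine ⟨h1, ?_⟩
  rw [eq_add_of_sub_eq (h.neg_pos k l).symm, map_add, map_smul, LinearMap.add_apply,
    LinearMap.smul_apply, hy]
  exact add_mem h1 (Submodule.smul_mem _ _ (Submodule.smul_mem _ _ hu))

/-- On level `m + 1` the operator `X_k` is computed through `X_k X_l* = W (1 - y_1) y_1`, which
needs `W` to preserve level `m`, which in turn needs `X* X` there. Stating the claim for `X* X`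
avoids a level `m - 1` when `m = 0`. -/
theorem X_mem_level (hα : 0 < α) (h : AuxRelations α x y)
    (hv : Φ (y 0) v = (α⁻¹ : ℂ) • v) (hX : ∀ k, Φ (x (.pos k) .zero) v = 0) (m : ℕ) :
    ∀ u ∈ level Φ x v m,
      (∀ k l, Φ (star (x (.pos l) .zero)) (Φ (x (.pos k) .zero) u) ∈ level Φ x v m) ∧
      ∀ k, Φ (x (.pos k) .zero) u ∈ ⨆ m, level Φ x v m := by
  induction m with
  | zero =>
    intro u hu
    obtain ⟨c, rfl⟩ := Submodule.mem_span_singleton.1 hu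
    simp [hX]
  | succ m ih =>
    have h1 : ∀ u ∈ level Φ x v (m + 1), ∀ k, Φ (x (.pos k) .zero) u ∈ level Φ x v m := by
      refine level_succ_induction Φ (by simp) (fun u w hu hw k => ?_) (fun l u hu k => ?_)
      · rw [map_add]
        exact add_mem (hu k) (hw k)
      · have hy := y_zero_apply_of_mem_level Φ hα h hv m u hu
        have hy1 := y_apply_of_y_zero_apply Φ hα h hy 1
        rw [← Module.End.mul_apply, ← map_mul, h.X_mul_star_X]
        simp only [map_mul, map_sub, map_one, Module.End.mul_apply, LinearMap.sub_apply,
          Module.End.one_apply, hy1, map_smul]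
        exact Submodule.smul_mem _ _ (sub_mem (W_mem_level Φ hα h hu hy (ih u hu).1 k l).2
          (Submodule.smul_mem _ _ (W_mem_level Φ hα h hu hy (ih u hu).1 k l).2))
    exact fun u hu => ⟨fun k l => star_X_mem_level Φ (h1 u hu k) l,
      fun k => Submodule.mem_iSup_of_mem m (h1 u hu k)⟩

/-- The module generated by a vacuum vector is the sum of its levels. -/
theorem apply_mem_iSup_level (hα : 0 < α) (h : AuxRelations α x y) (hg : Generates x y)
    (hv : Φ (y 0) v = (α⁻¹ : ℂ) • v) (hX : ∀ k, Φ (x (.pos k) .zero) v = 0) (t : A) :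
    Φ t v ∈ ⨆ m, level Φ x v m := by
  set U := ⨆ m, level Φ x v m with hU
  let S : Subalgebra ℂ A :=
    { carrier := {t | ∀ u ∈ U, Φ t u ∈ U}
      add_mem' := fun {s t} hs ht u hu => by
        rw [map_add, LinearMap.add_apply]
        exact add_mem (hs u hu) (ht u hu)
      mul_mem' := fun {s t} hs ht u hu => by
        rw [map_mul, Module.End.mul_apply]
        exact hs _ (ht u hu)
      algebraMap_mem' := fun c u hu => by
        rw [AlgHom.commutes, Module.algebraMap_end_apply]
        exact U.smul_mem c hu }
  have hS : ∀ {t : A}, (∀ m, ∀ u ∈ level Φ x v m, Φ t u ∈ U) → t ∈ S := fun {t} ht u hu => by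
    refine Submodule.iSup_induction _ (motive := fun u => Φ t u ∈ U) hu ht (by simp)
      (fun u w hu hw => ?_)
    rw [map_add]
    exact add_mem hu hw
  have hle : ∀ m, level Φ x v m ≤ U := fun m => le_iSup (level Φ x v) m
  have hy0 := y_zero_apply_of_mem_level Φ hα h hv
  have hXU := X_mem_level Φ hα h hv hX
  have hyS : ∀ n, y n ∈ S := fun n => hS fun m u hu => by
    rw [y_apply_of_y_zero_apply Φ hα h (hy0 m u hu) n]
    exact U.smul_mem _ (hle m hu)
  have hXS : ∀ k, x (.pos k) .zero ∈ S := fun k => hS fun m u hu => (hXU m u hu).2 k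
  have hXsS : ∀ k, star (x (.pos k) .zero) ∈ S := fun k => hS fun m u hu =>
    hle (m + 1) (star_X_mem_level Φ hu k)
  have hWS : ∀ k l, x (.neg l) (.pos k) ∈ S ∧ x (.pos k) (.neg l) ∈ S := fun k l =>
    ⟨hS fun m u hu => hle m (W_mem_level Φ hα h hu (hy0 m u hu) (hXU m u hu).1 k l).1,
      hS fun m u hu => hle m (W_mem_level Φ hα h hu (hy0 m u hu) (hXU m u hu).1 k l).2⟩
  refine hg S (fun k l => ?_) hyS t v (hle 0 (Submodule.mem_span_singleton_self v))
  cases k with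
  | zero => cases l with
    | zero => rw [h.zero_zero]; exact hyS 0
    | pos l => rw [h.zero_pos]; exact hXS l
    | neg l => rw [h.zero_neg]; exact hXsS l
  | pos k => cases l with
    | zero => exact hXS k
    | pos l =>
      refine hS fun m u hu => ?_
      -- Only `Z y_0` is expressed through the `X_k`; as `y_0` is a nonzero scalar on each level it
      -- can be divided out. The adjoint case below does this with `y_1`.
      have h2 := congrArg (fun T => Φ T u) (h.Z_mul_y' k l)
      simp only [map_mul, Module.End.mul_apply, hy0 m u hu, map_smul] at h2
      refine (U.smul_mem_iff (inv_ne_zero (add_natCast_ne_zero hα m))).1 ?_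
      rw [h2]
      exact hXS k _ (hXS l _ (sub_mem (one_mem S) (hyS 0) u (hle m hu)))
    | neg l => exact (hWS k l).2
  | neg k => cases l with
    | zero => rw [h.neg_zero]; exact hXsS k
    | pos l => exact (hWS l k).1
    | neg l =>
      refine hS fun m u hu => ?_
      have h2 := congrArg (fun T => Φ T u) (h.star_X_mul_star_X k l)
      have h3 := y_apply_of_y_zero_apply Φ hα h (hy0 m u hu) 1
      simp only [map_mul, Module.End.mul_apply, h3, map_smul] at h2
      have h4 : (α + m + (1 : ℕ) : ℂ) ≠ 0 := by
        have := add_natCast_ne_zero hα (m + 1)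
        push_cast at this
        rwa [Nat.cast_one, add_assoc]
      refine (U.smul_mem_iff (inv_ne_zero h4)).1 ?_
      rw [h2]
      exact hXsS k _ (hXsS l _ (hle m hu))

/-- Modulo the ranges of the `X_k*`, every element acts on a vacuum vector by a scalar. -/
theorem exists_sub_smul_mem (hα : 0 < α) (h : AuxRelations α x y) (hg : Generates x y)
    (hv : Φ (y 0) v = (α⁻¹ : ℂ) • v) (hX : ∀ k, Φ (x (.pos k) .zero) v = 0) (t : A) :
    ∃ c : ℂ, Φ t v - c • v ∈ ⨆ k, LinearMap.range (Φ (star (x (.pos k) .zero))) := by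
  have h1 : ⨆ m, level Φ x v m ≤
      Submodule.span ℂ {v} ⊔ ⨆ k, LinearMap.range (Φ (star (x (.pos k) .zero))) := by
    refine iSup_le fun m => ?_
    cases m with
    | zero => exact le_sup_left
    | succ m => exact le_sup_of_le_right (iSup_mono fun k => LinearMap.map_le_range)
  obtain ⟨_, hu, w, hw, huw⟩ :=
    Submodule.mem_sup.1 (h1 (apply_mem_iSup_level Φ hα h hg hv hX t))
  obtain ⟨c, rfl⟩ := Submodule.mem_span_singleton.1 hu
  exact ⟨c, by rwa [← huw, add_sub_cancel_left]⟩

end Module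


/-! ### Comparing vacua in two representations -/

section Copies

variable {A : Type*} [Ring A] [Algebra ℂ A] [StarRing A] {d : ℕ} {α : ℝ}
variable {x : Index d → Index d → A} {y : ℕ → A}

theorem AuxRelations.map {B : Type*} [Ring B] [Algebra ℂ B] [StarRing B] (h : AuxRelations α x y)
    (f : A →⋆ₐ[ℂ] B) : AuxRelations α (fun k l => f (x k l)) (fun n => f (y n)) := by
  constructor <;> intros <;> try simp only [← map_star, ← map_mul, ← map_smul, ← map_sub, ← map_add,
    ← map_one f, ← map_sum]
  · rw [h.star_y]
  · rw [h.y_mul_y]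
  · exact congrArg f (h.y_eq _)
  · rw [h.zero_zero]
  · rw [h.zero_pos]
  · rw [h.neg_zero]
  · rw [h.zero_neg]
  · rw [h.pos_pos_comm]
  · rw [h.neg_neg]
  · rw [h.star_pos_neg]
  · rw [h.neg_pos]
  · rw [h.sum_single]
  · rw [h.sum_pair]
  · rw [h.sum_pos_neg]
  · rw [h.X_mul_y]
  · rw [h.X_comm]
  · rw [h.Z_mul_y]
  · rw [h.Z_mul_y']
  · rw [h.W_mul_y]
  · rw [h.star_X_mul_X]
  · rw [h.star_X_mul_star_X]
  · rw [h.X_mul_star_X]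
  · rw [h.Z_comm]
  · rw [h.W_mul_W]
  · rw [h.W_mul_W']
  · rw [h.Z_mul_W]

variable {F : Type*} [NormedAddCommGroup F] [InnerProductSpace ℂ F] [CompleteSpace F]
variable {H : Type*} [NormedAddCommGroup H] [InnerProductSpace ℂ H] [CompleteSpace H]

/-- The direct sum of two representations, as an algebraic representation. -/
def prodAlgHom (R : A →⋆ₐ[ℂ] (F →L[ℂ] F)) (P : A →⋆ₐ[ℂ] (H →L[ℂ] H)) :
    A →ₐ[ℂ] Module.End ℂ (F × H) where
  toFun t := (R t).toLinearMap.prodMap (P t).toLinearMap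
  map_one' := by ext <;> simp
  map_mul' s t := by ext <;> simp
  map_zero' := by ext <;> simp
  map_add' s t := by ext <;> simp
  commutes' c := by ext <;> simp [Algebra.algebraMap_eq_smul_one]

/-- The matrix elements of a representation between vacuum vectors agree with those of any
other representation. -/
theorem inner_vacuum (hα : 0 < α) (h : AuxRelations α x y) (hg : Generates x y)
    (R : A →⋆ₐ[ℂ] (F →L[ℂ] F)) (P : A →⋆ₐ[ℂ] (H →L[ℂ] H)) {e : F} (he : R (y 0) e = (α⁻¹ : ℂ) • e)
    (he1 : ‖e‖ = 1) {ψ ψ' : H} (hψ : P (y 0) ψ = (α⁻¹ : ℂ) • ψ) (hψ' : P (y 0) ψ' = (α⁻¹ : ℂ) • ψ')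
    (t : A) : ⟪ψ', P t ψ⟫_ℂ = ⟪e, R t e⟫_ℂ * ⟪ψ', ψ⟫_ℂ := by
  have hXR := (h.map R).X_apply_eq_zero_of_eigen hα he
  have hXP := (h.map P).X_apply_eq_zero_of_eigen hα hψ
  have hXP' := (h.map P).X_apply_eq_zero_of_eigen hα hψ'
  -- Working in the direct sum with the vacuum `(e, ψ)` forces one and the same scalar `c` in both
  -- components, without computing it.
  obtain ⟨c, hc⟩ := exists_sub_smul_mem (prodAlgHom R P) (v := (e, ψ)) hα h hg
    (Prod.ext he hψ) (fun k => Prod.ext (hXR k) (hXP k)) t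
  have key : ∀ w ∈ ⨆ k, LinearMap.range (prodAlgHom R P (star (x (.pos k) .zero))),
      ⟪e, w.1⟫_ℂ = 0 ∧ ⟪ψ', w.2⟫_ℂ = 0 := by
    intro w hw
    refine Submodule.iSup_induction _ (motive := fun w : F × H => ⟪e, w.1⟫_ℂ = 0 ∧ ⟪ψ', w.2⟫_ℂ = 0)
      hw ?_ (by simp) (fun u w hu hw => ?_)
    · rintro k _ ⟨w, rfl⟩
      change ⟪e, R (star (x (.pos k) .zero)) w.1⟫_ℂ = 0 ∧
        ⟪ψ', P (star (x (.pos k) .zero)) w.2⟫_ℂ = 0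
      rw [map_star, map_star, inner_star_right, inner_star_right]
      exact ⟨by rw [hXR k, inner_zero_left], by rw [hXP' k, inner_zero_left]⟩
    · simp only [Prod.fst_add, Prod.snd_add, inner_add_right, hu.1, hu.2, hw.1, hw.2, add_zero,
        and_self]
  obtain ⟨h1, h2⟩ := key _ hc
  change ⟪e, R t e - c • e⟫_ℂ = 0 at h1
  change ⟪ψ', P t ψ - c • ψ⟫_ℂ = 0 at h2
  rw [inner_sub_right, inner_smul_right, inner_self_eq_norm_sq_to_K, he1] at h1
  rw [inner_sub_right, inner_smul_right] at h2
  rw [sub_eq_zero.1 h2, sub_eq_zero.1 h1]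
  simp

/-- A cyclic vacuum vector is mapped to a normalized vacuum vector by an intertwining isometry. -/
theorem exists_intertwiner (hα : 0 < α) (h : AuxRelations α x y) (hg : Generates x y)
    (R : A →⋆ₐ[ℂ] (F →L[ℂ] F)) (P : A →⋆ₐ[ℂ] (H →L[ℂ] H)) {e : F} (he : R (y 0) e = (α⁻¹ : ℂ) • e)
    (he1 : ‖e‖ = 1) (hd : DenseRange fun t => R t e) {ψ : H} (hψ : P (y 0) ψ = (α⁻¹ : ℂ) • ψ)
    (hψ1 : ‖ψ‖ = 1) :
    ∃ V : F →ₗᵢ[ℂ] H, ∀ t, V (R t e) = P t ψ := by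
  let E : A →ₗ[ℂ] F :=
    { toFun := fun t => R t e
      map_add' := fun s t => by simp
      map_smul' := fun c t => by simp }
  let G : A →ₗ[ℂ] H :=
    { toFun := fun t => P t ψ
      map_add' := fun s t => by simp
      map_smul' := fun c t => by simp }
  have hn : ∀ t, ‖G t‖ = ‖E t‖ := fun t => by
    -- The matrix element of `t* t` is the squared norm of the orbit vector, so equal matrix
    -- elements make `R t e ↦ P t ψ` well defined and isometric.
    have h1 := inner_vacuum hα h hg R P he he1 hψ hψ (star t * t)
    rw [map_mul, map_mul, map_star, map_star] at h1
    change ⟪ψ, star (P t) (P t ψ)⟫_ℂ = ⟪e, star (R t) (R t e)⟫_ℂ * _ at h1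
    rw [inner_star_right, inner_star_right, inner_self_eq_norm_sq_to_K, inner_self_eq_norm_sq_to_K,
      inner_self_eq_norm_sq_to_K, hψ1] at h1
    have h2 : ‖P t ψ‖ ^ 2 = ‖R t e‖ ^ 2 := by
      simp only [RCLike.ofReal_one, one_pow, mul_one] at h1
      exact_mod_cast h1
    exact (sq_eq_sq₀ (norm_nonneg _) (norm_nonneg _)).1 h2
  have hV : ∀ t, G.extendOfNorm E (E t) = G t := fun t =>
    LinearMap.extendOfNorm_eq hd ⟨1, fun t => by rw [hn, one_mul]⟩ t
  refine ⟨⟨(G.extendOfNorm E).toLinearMap, fun f => ?_⟩, hV⟩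
  refine DenseRange.induction_on (e := E) hd f ?_ fun t => ?_
  · exact isClosed_eq (G.extendOfNorm E).continuous.norm continuous_norm
  · exact (congrArg norm (hV t)).trans (hn t)

theorem mem_ker_sub_smul_one {H : Type*} [NormedAddCommGroup H] [InnerProductSpace ℂ H]
    (K : H →L[ℂ] H) (ψ : H) : ψ ∈ (K - ((α⁻¹ : ℝ) : ℂ) • (1 : H →L[ℂ] H)).ker ↔
      K ψ = (α⁻¹ : ℂ) • ψ := by
  rw [LinearMap.mem_ker]
  change K ψ - ((α⁻¹ : ℝ) : ℂ) • ψ = 0 ↔ _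
  rw [sub_eq_zero, Complex.ofReal_inv]

end Copies

/-! ### Splitting into copies of a cyclic vacuum representation -/

section Sum

variable {A : Type*} [Ring A] [Algebra ℂ A] [StarRing A] {d : ℕ} {α : ℝ}
variable {x : Index d → Index d → A} {y : ℕ → A}
variable {F : Type*} [NormedAddCommGroup F] [InnerProductSpace ℂ F] [CompleteSpace F]
variable {H : Type u} [NormedAddCommGroup H] [InnerProductSpace ℂ H] [CompleteSpace H]

/-- Each vector of an orthonormal basis of the vacuum space gives an intertwining isometry.
Orthogonal vacua have orthogonal orbits by `inner_vacuum`. The closed span of the ranges is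
invariant and contains all vacua, hence contains `(ker y_0)ᗮ`, which is everything. -/
theorem isSumOfCopies_of_ker_eq_bot (hα : 0 < α) (hα1 : α ≠ 1) (h : AuxRelations α x y)
    (hg : Generates x y) (R : A →⋆ₐ[ℂ] (F →L[ℂ] F)) {e : F} (he : R (y 0) e = (α⁻¹ : ℂ) • e)
    (he1 : ‖e‖ = 1) (hd : DenseRange fun t => R t e) (P : A →⋆ₐ[ℂ] (H →L[ℂ] H))
    (hP : (P (y 0)).ker = ⊥) : ∃ ι : Type u, IsSumOfCopies R P ι := by
  set K := (P (y 0) - ((α⁻¹ : ℝ) : ℂ) • (1 : H →L[ℂ] H)).ker with hK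
  have hKmem : ∀ ψ, ψ ∈ K ↔ P (y 0) ψ = (α⁻¹ : ℂ) • ψ := mem_ker_sub_smul_one _
  obtain ⟨w, b, hb⟩ := exists_hilbertBasis ℂ K
  have hbK : ∀ i, P (y 0) (b i) = (α⁻¹ : ℂ) • (b i : H) := fun i => (hKmem _).1 (b i).2
  choose V hV using fun i => exists_intertwiner hα h hg R P he he1 hd (hbK i)
    (b.orthonormal.1 i)
  have hint : ∀ i t f, P t (V i f) = V i (R t f) := fun i t f => by
    refine DenseRange.induction_on (e := fun t => R t e) hd f ?_ fun s => ?_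
    · exact isClosed_eq ((P t).continuous.comp (V i).continuous)
        ((V i).continuous.comp (R t).continuous)
    · have h1 := hV i (t * s)
      rw [map_mul, map_mul] at h1
      rw [hV]
      exact h1.symm
  refine ⟨w, V, IsHilbertSum.mk (fun i j hij f g => ?_) ?_, hint⟩
  · refine DenseRange.induction_on (e := fun t => R t e) hd f ?_ fun s => ?_
    · exact isClosed_eq ((V i).continuous.inner continuous_const) continuous_const
    refine DenseRange.induction_on (e := fun t => R t e) hd g ?_ fun t => ?_
    · exact isClosed_eq (continuous_const.inner (V j).continuous) continuous_const
    rw [hV, hV, ← inner_star_right, ← map_star]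
    change ⟪(b i : H), (P (star s) * P t) (b j)⟫_ℂ = 0
    rw [← map_mul, inner_vacuum hα h hg R P he he1 (hbK j) (hbK i)]
    have h0 : ⟪(b i : H), (b j : H)⟫_ℂ = 0 := by
      rw [← Submodule.coe_inner]
      exact b.orthonormal.2 hij
    rw [h0, mul_zero]
  · have h1 : (⊤ : Submodule ℂ H) = (P (y 0)).kerᗮ := by rw [hP, Submodule.bot_orthogonal_eq_top]
    rw [h1]
    set G := (⨆ i, LinearMap.range (V i).toLinearMap).topologicalClosure with hG
    have hGinv : ∀ t, ∀ ψ ∈ G, P t ψ ∈ G := fun t ψ hψ => by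
      have h2 : ⨆ i, LinearMap.range (V i).toLinearMap ≤ G.comap (P t).toLinearMap := by
        refine iSup_le fun i => ?_
        rintro _ ⟨f, rfl⟩
        change P t (V i f) ∈ G
        rw [hint]
        exact Submodule.le_topologicalClosure _ (Submodule.mem_iSup_of_mem i ⟨_, rfl⟩)
      have h3 : IsClosed ((G.comap (P t).toLinearMap : Submodule ℂ H) : Set H) :=
        (Submodule.isClosed_topologicalClosure _).preimage (P t).continuous
      exact Submodule.topologicalClosure_minimal _ h2 h3 hψ
    refine (h.map P).orthogonal_ker_le hα hα1 (Submodule.isClosed_topologicalClosure _)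
      (fun ψ hψ => ?_) (fun k ψ hψ => ?_)
    · have h2 : Submodule.span ℂ (Set.range b) ≤ G.comap K.subtype := by
        refine Submodule.span_le.2 ?_
        rintro _ ⟨i, rfl⟩
        refine Submodule.le_topologicalClosure _ (Submodule.mem_iSup_of_mem i ⟨e, ?_⟩)
        have h3 := hV i 1
        rw [map_one, map_one] at h3
        exact h3
      have h3 : IsClosed ((G.comap K.subtype : Submodule ℂ K) : Set K) :=
        (Submodule.isClosed_topologicalClosure _).preimage continuous_subtype_val
      have h4 := Submodule.topologicalClosure_minimal _ h2 h3
      rw [b.dense_span] at h4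
      exact h4 (x := ⟨ψ, (hKmem ψ).2 hψ⟩) trivial
    · rw [← map_star]
      exact hGinv _ ψ hψ

end Sum


/-! ### Invariant subspaces and cyclicity -/

section Restriction

variable {A : Type*} [Ring A] [Algebra ℂ A] [StarRing A]
variable {H : Type u} [NormedAddCommGroup H] [InnerProductSpace ℂ H] [CompleteSpace H]

theorem exists_isRestriction (P : A →⋆ₐ[ℂ] (H →L[ℂ] H)) (K : Submodule ℂ H) [CompleteSpace K]
    (hK : ∀ t, ∀ φ ∈ K, P t φ ∈ K) : ∃ Q : A →⋆ₐ[ℂ] (K →L[ℂ] K), IsRestriction P K Q := by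
  have hex : ∀ t, ∃ T : K →L[ℂ] K, ∀ φ : K, (T φ : H) = P t φ := fun t =>
    ⟨((P t).comp K.subtypeL).codRestrict K fun φ => hK t φ φ.2, fun _ => rfl⟩
  choose T hT using hex
  refine ⟨{ toFun := T
            map_one' := ?_
            map_mul' := fun s t => ?_
            map_zero' := ?_
            map_add' := fun s t => ?_
            commutes' := fun c => ?_
            map_star' := fun t => ?_ }, hT⟩
  · ext φ; simp [hT]
  · ext φ; simp [hT]
  · ext φ; simp [hT]
  · ext φ; simp [hT]
  · ext φ; simp [hT, Algebra.algebraMap_eq_smul_one]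
  · rw [ContinuousLinearMap.star_eq_adjoint, ContinuousLinearMap.eq_adjoint_iff]
    intro φ ψ
    rw [Submodule.coe_inner, Submodule.coe_inner, hT, hT, map_star, inner_star_left]

theorem Generates.apply_mem {d : ℕ} {x : Index d → Index d → A} {y : ℕ → A} (hg : Generates x y)
    (P : A →⋆ₐ[ℂ] (H →L[ℂ] H)) {K : Submodule ℂ H} (hx : ∀ k l, ∀ φ ∈ K, P (x k l) φ ∈ K)
    (hy : ∀ n, ∀ φ ∈ K, P (y n) φ ∈ K) (t : A) : ∀ φ ∈ K, P t φ ∈ K := by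
  let S : Subalgebra ℂ A :=
    { carrier := {t | ∀ φ ∈ K, P t φ ∈ K}
      add_mem' := fun {s t} hs ht φ hφ => by
        rw [map_add]
        exact K.add_mem (hs φ hφ) (ht φ hφ)
      mul_mem' := fun {s t} hs ht φ hφ => by
        rw [map_mul]
        exact hs _ (ht φ hφ)
      algebraMap_mem' := fun c φ hφ => by
        rw [AlgHomClass.commutes, Algebra.algebraMap_eq_smul_one]
        exact K.smul_mem c hφ }
  exact hg S hx hy t

theorem apply_mem_orthogonal (P : A →⋆ₐ[ℂ] (H →L[ℂ] H)) {K : Submodule ℂ H}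
    (hK : ∀ t, ∀ φ ∈ K, P t φ ∈ K) (t : A) : ∀ φ ∈ Kᗮ, P t φ ∈ Kᗮ := by
  intro φ hφ ψ hψ
  rw [← star_star t, map_star, inner_star_right]
  exact hφ _ (hK _ ψ hψ)

/-- The closure of the orbit of `e` is stable under the `X_k*` and contains every vacuum, these
being multiples of `e`. -/
theorem AuxRelations.denseRange_apply {d : ℕ} {α : ℝ} {x : Index d → Index d → A} {y : ℕ → A}
    (h : AuxRelations α x y) (hα : 0 < α) (hα1 : α ≠ 1) (R : A →⋆ₐ[ℂ] (H →L[ℂ] H))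
    (hR : (R (y 0)).ker = ⊥) {e : H} (he : ∀ f, R (y 0) f = (α⁻¹ : ℂ) • f → ∃ c : ℂ, f = c • e) :
    DenseRange fun t => R t e := by
  let E : A →ₗ[ℂ] H :=
    { toFun := fun t => R t e
      map_add' := fun s t => by simp
      map_smul' := fun c t => by simp }
  have hE : ∀ t, E t = R t e := fun _ => rfl
  have h1 : (R (y 0)).kerᗮ ≤ (LinearMap.range E).topologicalClosure := by
    refine (h.map R).orthogonal_ker_le hα hα1 (Submodule.isClosed_topologicalClosure _)
      (fun f hf => ?_) (fun k f hf => ?_)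
    · obtain ⟨c, rfl⟩ := he f hf
      refine Submodule.smul_mem _ _ (Submodule.le_topologicalClosure _ ⟨1, ?_⟩)
      rw [hE, map_one]
      rfl
    · rw [← map_star]
      set t := star (x (.pos k) .zero)
      have h2 : LinearMap.range E ≤
          (LinearMap.range E).topologicalClosure.comap (R t).toLinearMap := by
        rintro _ ⟨s, rfl⟩
        refine Submodule.le_topologicalClosure _ ⟨t * s, ?_⟩
        rw [hE, map_mul]
        rfl
      exact Submodule.topologicalClosure_minimal _ h2
        ((Submodule.isClosed_topologicalClosure _).preimage (R t).continuous) hf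
  rw [hR, Submodule.bot_orthogonal_eq_top, top_le_iff,
    ← Submodule.dense_iff_topologicalClosure_eq_top] at h1
  exact h1

end Restriction

/-! ### Monomials in the lowering operators -/

section Powers

/-- Applied to the commuting `X_k`, it gives `X_k* (x^n)* = (x^(n + 1_k))*`, the reason why `H_1` is
stable under `X_k*`. -/
theorem list_prod_ofFn_pow_mul {M : Type*} [Monoid M] {d : ℕ} (f : Fin d → M)
    (hf : ∀ i j, Commute (f i) (f j)) (n : Fin d → ℕ) (k : Fin d) :
    (List.ofFn fun i => f i ^ n i).prod * f k =
      (List.ofFn fun i => f i ^ (n + Pi.single k 1 : Fin d → ℕ) i).prod := by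
  induction d with
  | zero => exact k.elim0
  | succ d ih =>
    rw [List.ofFn_succ, List.ofFn_succ, List.prod_cons, List.prod_cons]
    refine Fin.cases ?_ (fun k => ?_) k
    · have h1 : Commute (f 0) (List.ofFn fun i : Fin d => f i.succ ^ n i.succ).prod := by
        refine Commute.list_prod_right _ _ fun b hb => ?_
        obtain ⟨i, rfl⟩ := (List.mem_ofFn' _ _).1 hb
        exact (hf _ _).pow_right _
      rw [mul_assoc, ← h1.eq, ← mul_assoc, ← pow_succ]
      simp
    · rw [mul_assoc, ih (fun i => f i.succ) (fun i j => hf _ _) (fun i => n i.succ)]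
      have hs : ∀ i : Fin d, (Pi.single k.succ 1 : Fin (d + 1) → ℕ) i.succ =
          (Pi.single k 1 : Fin d → ℕ) i := fun i => by
        rcases eq_or_ne i k with rfl | hi
        · simp
        · rw [Pi.single_eq_of_ne hi, Pi.single_eq_of_ne fun h => hi (Fin.succ_injective _ h)]
      simp [hs]

end Powers

/-! ### The vacuum of the identity representation -/

section Fock

variable {d : ℕ} {α : ℝ}

/-- The basis vector `e_n`. -/
def fockBasis (n : Fin d → ℕ) : fockDomain d :=
  mkDom (Pi.single n 1) fun _ => summable_of_hasFiniteSupport <|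
    (Set.finite_singleton n).subset fun m hm => by
      by_contra h
      exact hm (by simp [Pi.single_eq_of_ne h])

theorem coeff_fockBasis (n m : Fin d → ℕ) :
    coeff (fockBasis n).1 m = (Pi.single n 1 : (Fin d → ℕ) → ℂ) m := rfl

theorem inner_fockBasis (n : Fin d → ℕ) (f : Fock d) : ⟪(fockBasis n).1, f⟫_ℂ = coeff f n := by
  rw [inner_eq_tsum, tsum_eq_single n fun m hm => by simp [coeff_fockBasis, hm]]
  simp [coeff_fockBasis]

theorem norm_fockBasis (n : Fin d → ℕ) : ‖((fockBasis n).1 : Fock d)‖ = 1 := by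
  have h := inner_self_eq_norm_sq_to_K (𝕜 := ℂ) ((fockBasis n).1 : Fock d)
  rw [inner_fockBasis, coeff_fockBasis, Pi.single_eq_same] at h
  have h1 : ‖((fockBasis n).1 : Fock d)‖ ^ 2 = 1 :=
    Complex.ofReal_injective (by rw [Complex.ofReal_pow, Complex.ofReal_one]; exact h.symm)
  exact (pow_eq_one_iff_of_nonneg (norm_nonneg _) two_ne_zero).1 h1

theorem dense_fockDomain (d : ℕ) : Dense (fockDomain d : Set (Fock d)) := by
  rw [Submodule.dense_iff_topologicalClosure_eq_top, Submodule.topologicalClosure_eq_top_iff,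
    Submodule.eq_bot_iff]
  intro f hf
  exact coeff_ext fun n => by rw [← inner_fockBasis, hf _ (fockBasis n).2, coeff_zero]

/-- The vector `f` need not lie in the domain, where `ρ` is given explicitly; so the self-adjoint
`y_0` is moved onto the basis vector, which does. -/
theorem coeff_apply_y (ρ : auxAlgebra d α →⋆ₐ[ℂ] (Fock d →L[ℂ] Fock d))
    (hρ : (tautRep d α).ExtendsTo ρ) (f : Fock d) (n : Fin d → ℕ) :
    coeff (ρ (y α 0) f) n = (deg n + α : ℂ)⁻¹ * coeff f n := by
  have h1 : star (y α 0 : auxAlgebra d α) = y α 0 := Subtype.ext (star_yOp 0)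
  have h2 : ρ (y α 0) (fockBasis n).1 = (deg n + α : ℂ)⁻¹ • (fockBasis n).1 := by
    rw [hρ]
    refine coeff_ext fun m => ?_
    change coeff ((yOp α 0 : adjointable (fockDomain d)).1 (fockBasis n)).1 m = _
    rw [coeff_yOp, coeff_smul, coeff_fockBasis]
    rcases eq_or_ne m n with rfl | hm
    · simp
    · simp [hm]
  rw [← inner_fockBasis, ← inner_star_left, ← map_star, h1, h2, inner_smul_left, inner_fockBasis]
  simp

theorem deg_zero : deg (0 : Fin d → ℕ) = 0 := by simp [deg]

theorem deg_eq_zero {n : Fin d → ℕ} (h : deg n = 0) : n = 0 := by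
  ext k
  exact Nat.le_zero.1 (h ▸ le_deg n k)

theorem ker_y_eq_bot (hα : 0 < α) (ρ : auxAlgebra d α →⋆ₐ[ℂ] (Fock d →L[ℂ] Fock d))
    (hρ : (tautRep d α).ExtendsTo ρ) : (ρ (y α 0)).ker = ⊥ := by
  rw [Submodule.eq_bot_iff]
  intro f hf
  refine coeff_ext fun n => ?_
  have h1 := coeff_apply_y ρ hρ f n
  rw [show ρ (y α 0) f = 0 from hf, coeff_zero] at h1
  have h2 := add_natCast_ne_zero hα (deg n)
  rw [add_comm] at h2
  exact (mul_eq_zero.1 h1.symm).resolve_left (inv_ne_zero h2)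

theorem apply_y_vacuum (ρ : auxAlgebra d α →⋆ₐ[ℂ] (Fock d →L[ℂ] Fock d))
    (hρ : (tautRep d α).ExtendsTo ρ) :
    ρ (y α 0) (fockBasis 0).1 = (α⁻¹ : ℂ) • (fockBasis (0 : Fin d → ℕ)).1 := by
  refine coeff_ext fun n => ?_
  rw [coeff_apply_y ρ hρ, coeff_smul, coeff_fockBasis]
  rcases eq_or_ne n 0 with rfl | hn
  · simp [deg_zero]
  · simp [hn]

theorem eq_smul_vacuum (hα : 0 < α) (ρ : auxAlgebra d α →⋆ₐ[ℂ] (Fock d →L[ℂ] Fock d))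
    (hρ : (tautRep d α).ExtendsTo ρ) {f : Fock d} (hf : ρ (y α 0) f = (α⁻¹ : ℂ) • f) :
    f = coeff f 0 • (fockBasis (0 : Fin d → ℕ)).1 := by
  refine coeff_ext fun n => ?_
  rw [coeff_smul, coeff_fockBasis]
  rcases eq_or_ne n 0 with rfl | hn
  · simp
  · have h1 := coeff_apply_y ρ hρ f n
    rw [hf, coeff_smul] at h1
    have h2 := add_natCast_ne_zero hα (deg n)
    rw [add_comm] at h2
    have h3 : (α⁻¹ : ℂ) ≠ (deg n + α : ℂ)⁻¹ := by
      rw [Ne, inv_inj, eq_comm, add_eq_right]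
      exact_mod_cast fun h => hn (deg_eq_zero h)
    have h4 : ((α⁻¹ : ℂ) - (deg n + α : ℂ)⁻¹) * coeff f n = 0 := by rw [sub_mul, h1, sub_self]
    simp [(mul_eq_zero.1 h4).resolve_left (sub_ne_zero.2 h3), hn]

theorem denseRange_apply_vacuum (hα : 0 < α) (hα1 : α ≠ 1)
    (ρ : auxAlgebra d α →⋆ₐ[ℂ] (Fock d →L[ℂ] Fock d)) (hρ : (tautRep d α).ExtendsTo ρ) :
    DenseRange fun t => ρ t (fockBasis 0).1 :=
  (auxRelations d hα).denseRange_apply hα hα1 ρ (ker_y_eq_bot hα ρ hρ)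
    fun _ hf => ⟨_, eq_smul_vacuum hα ρ hρ hf⟩

end Fock

/-! ### The decomposition into `H_1` and `H_∞` -/

section Decomposition

variable {d : ℕ} {α : ℝ}
variable {H : Type u} [NormedAddCommGroup H] [InnerProductSpace ℂ H] [CompleteSpace H]
variable (P : auxAlgebra d α →⋆ₐ[ℂ] (H →L[ℂ] H))

theorem apply_mem_Hinf (hα : 0 < α) (t : auxAlgebra d α) : ∀ φ ∈ Hinf P, P t φ ∈ Hinf P := by
  have h := (auxRelations d hα).map P
  refine (auxAlgebra_generates d hα).apply_mem P (fun k l φ hφ => ?_) (fun n φ hφ => ?_) t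
  · exact h.y_x_apply_eq_zero hφ k l
  · rw [show P (y α n) φ = 0 from h.y_apply_eq_zero hφ n]
    exact Submodule.zero_mem _

theorem star_x_apply_mem_H1 (hα : 0 < α) (k : Fin d) {φ : H} (hφ : φ ∈ H1 P) :
    P (star (x α (.pos k) .zero)) φ ∈ H1 P := by
  set t := star (x α (.pos k) .zero) with ht
  have h2 : ⨆ n : Fin d → ℕ, (K0 P).map (P (star (xpow α n))).toLinearMap ≤
      (H1 P).comap (P t).toLinearMap := by
    refine iSup_le fun n => ?_
    rintro _ ⟨ψ, hψ, rfl⟩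
    refine Submodule.le_topologicalClosure _
      (Submodule.mem_iSup_of_mem (n + Pi.single k 1) ⟨ψ, hψ, ?_⟩)
    have h3 : xpow α (n + Pi.single k 1) = xpow α n * x α (.pos k) .zero :=
      (list_prod_ofFn_pow_mul (fun k => x α (.pos k) .zero) (auxRelations d hα).X_comm n k).symm
    rw [h3, star_mul, map_mul]
    rfl
  exact Submodule.topologicalClosure_minimal _ h2
    ((Submodule.isClosed_topologicalClosure _).preimage (P t).continuous) hφ

/-- If `φ` lies in `ker y_0`, so does `x^n φ`, and eigenvectors of `y_0` for `0` and `α⁻¹` are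
orthogonal; hence `φ` is orthogonal to `(x^n)* K_0`. The other inclusion is
`AuxRelations.orthogonal_ker_le`. -/
theorem H1_eq_orthogonal (hα : 0 < α) (hα1 : α ≠ 1) : H1 P = (Hinf P)ᗮ := by
  have h := (auxRelations d hα).map P
  refine le_antisymm ?_ ?_
  · refine Submodule.topologicalClosure_minimal _ (iSup_le fun n => ?_)
      (Submodule.isClosed_orthogonal _)
    rintro _ ⟨ψ, hψ, rfl⟩ φ hφ
    change ⟪φ, P (star (xpow α n)) ψ⟫_ℂ = 0
    rw [map_star, inner_star_right]
    have hφ' : P (y α 0) (P (xpow α n) φ) = 0 := apply_mem_Hinf P hα (xpow α n) φ hφ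
    have hψ' := (mem_ker_sub_smul_one _ ψ).1 hψ
    have h1 : ⟪P (xpow α n) φ, P (y α 0) ψ⟫_ℂ = 0 := by
      have h2 : star (P (y α 0)) = P (y α 0) := h.star_y 0
      rw [← h2, inner_star_right, hφ', inner_zero_left]
    rw [hψ', inner_smul_right] at h1
    exact (mul_eq_zero.1 h1).resolve_left (inv_ne_zero (by exact_mod_cast hα.ne'))
  · refine h.orthogonal_ker_le hα hα1 (Submodule.isClosed_topologicalClosure _) (fun ψ hψ => ?_)
      (fun k ψ hψ => ?_)
    · refine Submodule.le_topologicalClosure _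
        (Submodule.mem_iSup_of_mem 0 ⟨ψ, (mem_ker_sub_smul_one _ ψ).2 hψ, ?_⟩)
      have h1 : xpow α (0 : Fin d → ℕ) = 1 := by simp [xpow]
      rw [h1, star_one, map_one]
      rfl
    · have h1 := star_x_apply_mem_H1 P hα k hψ
      rwa [map_star] at h1

end Decomposition


/-! ### The spectral measure of a representation of `C(Y)` -/

section SpectralTheorem

open MeasureTheory Filter Topology

variable {Y : Type*} [MetricSpace Y]
variable {K : Type*} [NormedAddCommGroup K] [InnerProductSpace ℂ K] [CompleteSpace K]

/-- The complex function with the given real values. -/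
def ofRealMap (f : C(Y, ℝ)) : C(Y, ℂ) := ⟨fun z => (f z : ℂ), by fun_prop⟩

theorem star_ofRealMap (f : C(Y, ℝ)) : star (ofRealMap f) = ofRealMap f := by
  ext z
  simp [ofRealMap]

theorem inner_star_mul_self (Φ : C(Y, ℂ) →⋆ₐ[ℂ] (K →L[ℂ] K)) (φ : K) (f : C(Y, ℂ)) :
    ⟪φ, Φ (star f * f) φ⟫_ℂ = ((‖Φ f φ‖ ^ 2 : ℝ) : ℂ) := by
  rw [map_mul, map_star]
  change ⟪φ, star (Φ f) (Φ f φ)⟫_ℂ = _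
  rw [inner_star_right, inner_self_eq_norm_sq_to_K]
  simp

theorem inner_ofRealMap (Φ : C(Y, ℂ) →⋆ₐ[ℂ] (K →L[ℂ] K)) (φ : K) (f : C(Y, ℝ)) :
    ((⟪φ, Φ (ofRealMap f) φ⟫_ℂ).re : ℂ) = ⟪φ, Φ (ofRealMap f) φ⟫_ℂ := by
  rw [← Complex.conj_eq_iff_re, inner_conj_symm, ← inner_star_right, ← map_star, star_ofRealMap]

variable [CompactSpace Y] [MeasurableSpace Y] [BorelSpace Y]

/-- The positive functional `f ↦ ⟪φ, Φ f φ⟫`. -/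
def vectorFunctional (Φ : C(Y, ℂ) →⋆ₐ[ℂ] (K →L[ℂ] K)) (φ : K) :
    CompactlySupportedContinuousMap Y ℝ →ₚ[ℝ] ℝ :=
  PositiveLinearMap.mk₀
    { toFun := fun f => (⟪φ, Φ (ofRealMap f.toContinuousMap) φ⟫_ℂ).re
      map_add' := fun f g => by
        have h : ofRealMap (f + g).toContinuousMap =
            ofRealMap f.toContinuousMap + ofRealMap g.toContinuousMap := by
          ext z
          exact Complex.ofReal_add _ _
        rw [h, map_add, add_apply, inner_add_right, Complex.add_re]
      map_smul' := fun c f => by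
        have h : ofRealMap (c • f).toContinuousMap = (c : ℂ) • ofRealMap f.toContinuousMap := by
          ext z
          exact Complex.ofReal_mul _ _
        rw [h, map_smul, smul_apply, inner_smul_right, Complex.re_ofReal_mul]
        rfl }
    (fun f hf => by
      have h : ofRealMap f.toContinuousMap =
          star (ofRealMap ⟨fun z => Real.sqrt (f z), by fun_prop⟩) *
            ofRealMap ⟨fun z => Real.sqrt (f z), by fun_prop⟩ := by
        rw [star_ofRealMap]
        ext z
        change ((f z : ℝ) : ℂ) = (Real.sqrt (f z) : ℂ) * (Real.sqrt (f z) : ℂ)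
        rw [← Complex.ofReal_mul, Real.mul_self_sqrt (hf z)]
      change 0 ≤ (⟪φ, Φ (ofRealMap f.toContinuousMap) φ⟫_ℂ).re
      rw [h, inner_star_mul_self, Complex.ofReal_re]
      positivity)

/-- The measure of a vector `φ` with respect to a representation of `C(Y)`. -/
def vectorMeasure (Φ : C(Y, ℂ) →⋆ₐ[ℂ] (K →L[ℂ] K)) (φ : K) : Measure Y :=
  RealRMK.rieszMeasure (vectorFunctional Φ φ)

instance (Φ : C(Y, ℂ) →⋆ₐ[ℂ] (K →L[ℂ] K)) (φ : K) : IsFiniteMeasure (vectorMeasure Φ φ) :=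
  inferInstanceAs (IsFiniteMeasure (RealRMK.rieszMeasure _))

theorem integrable_continuousMap (μ : Measure Y) [IsFiniteMeasure μ] (f : C(Y, ℂ)) :
    Integrable f μ :=
  f.continuous.integrable_of_hasCompactSupport (HasCompactSupport.of_compactSpace f)

theorem integral_ofRealMap (Φ : C(Y, ℂ) →⋆ₐ[ℂ] (K →L[ℂ] K)) (φ : K) (f : C(Y, ℝ)) :
    ∫ z, ofRealMap f z ∂(vectorMeasure Φ φ) = ⟪φ, Φ (ofRealMap f) φ⟫_ℂ := by
  have h := RealRMK.integral_rieszMeasure (vectorFunctional Φ φ)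
    ⟨f, HasCompactSupport.of_compactSpace f⟩
  rw [← inner_ofRealMap]
  change ∫ z, ((f z : ℝ) : ℂ) ∂(vectorMeasure Φ φ) = _
  rw [integral_complex_ofReal]
  exact congrArg _ h

theorem integral_vectorMeasure (Φ : C(Y, ℂ) →⋆ₐ[ℂ] (K →L[ℂ] K)) (φ : K) (f : C(Y, ℂ)) :
    ∫ z, f z ∂(vectorMeasure Φ φ) = ⟪φ, Φ f φ⟫_ℂ := by
  let a : C(Y, ℝ) := ⟨fun z => (f z).re, by fun_prop⟩
  let b : C(Y, ℝ) := ⟨fun z => (f z).im, by fun_prop⟩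
  have h : f = ofRealMap a + Complex.I • ofRealMap b := by
    ext z
    change f z = ((f z).re : ℂ) + Complex.I * ((f z).im : ℂ)
    rw [mul_comm, Complex.re_add_im]
  rw [h, map_add, map_smul, add_apply, smul_apply,
    inner_add_right, inner_smul_right, ← integral_ofRealMap, ← integral_ofRealMap,
    ← integral_const_mul, ← integral_add]
  · rfl
  · exact integrable_continuousMap _ _
  · exact (integrable_continuousMap _ _).const_mul _

/-- `∫ |f|² dμ = ⟪φ, Φ(f* f) φ⟫ = ‖Φ(f) φ‖²`, so the orbit map factors isometrically through
`L²(μ)`. -/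
theorem norm_toLp_eq (Φ : C(Y, ℂ) →⋆ₐ[ℂ] (K →L[ℂ] K)) (φ : K) (f : C(Y, ℂ)) :
    ‖ContinuousMap.toLp 2 (vectorMeasure Φ φ) ℂ f‖ = ‖Φ f φ‖ := by
  have h1 : ⟪ContinuousMap.toLp 2 (vectorMeasure Φ φ) ℂ f,
      ContinuousMap.toLp 2 (vectorMeasure Φ φ) ℂ f⟫_ℂ = ((‖Φ f φ‖ ^ 2 : ℝ) : ℂ) := by
    rw [ContinuousMap.inner_toLp, ← inner_star_mul_self, ← integral_vectorMeasure]
    refine integral_congr_ae (Eventually.of_forall fun z => ?_)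
    change f z * starRingEnd ℂ (f z) = starRingEnd ℂ (f z) * f z
    rw [mul_comm]
  rw [inner_self_eq_norm_sq_to_K] at h1
  have h2 : ‖ContinuousMap.toLp 2 (vectorMeasure Φ φ) ℂ f‖ ^ 2 = ‖Φ f φ‖ ^ 2 := by
    refine Complex.ofReal_injective ?_
    rw [Complex.ofReal_pow]
    exact h1
  exact (sq_eq_sq₀ (norm_nonneg _) (norm_nonneg _)).1 h2

/-- The linear map `f ↦ Φ(f) φ`. -/
def orbitMap (Φ : C(Y, ℂ) →⋆ₐ[ℂ] (K →L[ℂ] K)) (φ : K) : C(Y, ℂ) →ₗ[ℂ] K where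
  toFun f := Φ f φ
  map_add' f g := by simp
  map_smul' c f := by simp

/-- The isometry `L²(μ) → K`, `f ↦ Φ(f) φ`, for the measure `μ` of the vector `φ`. -/
def cyclicMap (Φ : C(Y, ℂ) →⋆ₐ[ℂ] (K →L[ℂ] K)) (φ : K) : Lp ℂ 2 (vectorMeasure Φ φ) →L[ℂ] K :=
  (orbitMap Φ φ).extendOfNorm (ContinuousMap.toLp 2 (vectorMeasure Φ φ) ℂ).toLinearMap

theorem cyclicMap_toLp (Φ : C(Y, ℂ) →⋆ₐ[ℂ] (K →L[ℂ] K)) (φ : K) (f : C(Y, ℂ)) :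
    cyclicMap Φ φ (ContinuousMap.toLp 2 (vectorMeasure Φ φ) ℂ f) = Φ f φ := by
  have hd : DenseRange (ContinuousMap.toLp (E := ℂ) 2 (vectorMeasure Φ φ) ℂ).toLinearMap :=
    ContinuousMap.toLp_denseRange ℂ _ ℂ (by simp)
  have hn : ∃ C, ∀ f, ‖orbitMap Φ φ f‖ ≤
      C * ‖(ContinuousMap.toLp (E := ℂ) 2 (vectorMeasure Φ φ) ℂ).toLinearMap f‖ :=
    ⟨1, fun f => by rw [one_mul]; exact (norm_toLp_eq Φ φ f).ge⟩
  exact LinearMap.extendOfNorm_eq hd hn f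

theorem norm_cyclicMap (Φ : C(Y, ℂ) →⋆ₐ[ℂ] (K →L[ℂ] K)) (φ : K)
    (f : Lp ℂ 2 (vectorMeasure Φ φ)) : ‖cyclicMap Φ φ f‖ = ‖f‖ := by
  refine DenseRange.induction_on (ContinuousMap.toLp_denseRange ℂ (vectorMeasure Φ φ) ℂ
    (p := 2) (by simp)) f ?_ fun g => ?_
  · exact isClosed_eq (cyclicMap Φ φ).continuous.norm continuous_norm
  · rw [cyclicMap_toLp, norm_toLp_eq]

/-- The vector `E(B) φ`, where `E` is the spectral measure of `Φ`. -/
def spectralVector (Φ : C(Y, ℂ) →⋆ₐ[ℂ] (K →L[ℂ] K)) {B : Set Y} (hB : MeasurableSet B) (φ : K) :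
    K :=
  cyclicMap Φ φ (indicatorConstLp 2 hB (measure_ne_top _ _) 1)

theorem norm_sq_spectralVector (Φ : C(Y, ℂ) →⋆ₐ[ℂ] (K →L[ℂ] K)) {B : Set Y} (hB : MeasurableSet B)
    (φ : K) : ‖spectralVector Φ hB φ‖ ^ 2 = (vectorMeasure Φ φ).real B := by
  rw [spectralVector, norm_cyclicMap, norm_indicatorConstLp (by simp) (by simp), norm_one, one_mul,
    ← Real.rpow_natCast, ← Real.rpow_mul measureReal_nonneg]
  simp

theorem exists_seq_tendsto_indicator (μ : Measure Y) [IsFiniteMeasure μ] {B : Set Y}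
    (hB : MeasurableSet B) : ∃ f : ℕ → C(Y, ℂ),
      Tendsto (fun n => eLpNorm (⇑(f n) - B.indicator fun _ => (1 : ℂ)) 2 μ) atTop (𝓝 0) := by
  have h : MemLp (B.indicator fun _ => (1 : ℂ)) 2 μ := memLp_indicator_const 2 hB 1 (by simp)
  have h1 : ∀ n : ℕ, ∃ f : C(Y, ℂ),
      eLpNorm (⇑f - B.indicator fun _ => (1 : ℂ)) 2 μ ≤ ((n : ℝ≥0∞) + 1)⁻¹ := fun n => by
    obtain ⟨g, hg, -⟩ := h.exists_boundedContinuous_eLpNorm_sub_le (by simp)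
      (ε := ((n : ℝ≥0∞) + 1)⁻¹) (by simp)
    exact ⟨g.toContinuousMap, by rw [eLpNorm_sub_comm]; exact hg⟩
  choose f hf using h1
  refine ⟨f, tendsto_of_tendsto_of_tendsto_of_le_of_le tendsto_const_nhds ?_
    (fun _ => zero_le) hf⟩
  have h2 := (ENNReal.tendsto_inv_nat_nhds_zero.comp (tendsto_add_atTop_nat 1))
  refine h2.congr fun n => by simp

/-- `E(B) φ` is defined in an `L²` space that depends on `φ`. Allowing any dominating measure `ν`
lets one approximating sequence serve several vectors at once, from which linearity in `φ` follows.
-/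
theorem tendsto_spectralVector (Φ : C(Y, ℂ) →⋆ₐ[ℂ] (K →L[ℂ] K)) {B : Set Y} (hB : MeasurableSet B)
    {ν : Measure Y} {f : ℕ → C(Y, ℂ)}
    (hf : Tendsto (fun n => eLpNorm (⇑(f n) - B.indicator fun _ => (1 : ℂ)) 2 ν) atTop (𝓝 0))
    {φ : K} (hφ : vectorMeasure Φ φ ≤ ν) :
    Tendsto (fun n => Φ (f n) φ) atTop (𝓝 (spectralVector Φ hB φ)) := by
  have h1 : Tendsto (fun n => ContinuousMap.toLp 2 (vectorMeasure Φ φ) ℂ (f n)) atTop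
      (𝓝 (indicatorConstLp 2 hB (measure_ne_top _ _) 1)) := by
    rw [Lp.tendsto_Lp_iff_tendsto_eLpNorm']
    refine tendsto_of_tendsto_of_tendsto_of_le_of_le tendsto_const_nhds hf (fun _ => zero_le)
      fun n => ?_
    refine le_trans (le_of_eq (eLpNorm_congr_ae ?_)) (eLpNorm_mono_measure _ hφ)
    exact (ContinuousMap.coeFn_toLp _ _).sub indicatorConstLp_coeFn
  refine (((cyclicMap Φ φ).continuous.tendsto _).comp h1).congr fun n => cyclicMap_toLp Φ φ _

theorem spectralVector_add (Φ : C(Y, ℂ) →⋆ₐ[ℂ] (K →L[ℂ] K)) {B : Set Y} (hB : MeasurableSet B)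
    (φ ψ : K) : spectralVector Φ hB (φ + ψ) = spectralVector Φ hB φ + spectralVector Φ hB ψ := by
  obtain ⟨f, hf⟩ := exists_seq_tendsto_indicator
    (vectorMeasure Φ φ + vectorMeasure Φ ψ + vectorMeasure Φ (φ + ψ)) hB
  refine tendsto_nhds_unique (tendsto_spectralVector Φ hB hf (Measure.le_add_left le_rfl)) ?_
  simp only [map_add]
  exact (tendsto_spectralVector Φ hB hf (Measure.le_add_right (Measure.le_add_right le_rfl))).add
    (tendsto_spectralVector Φ hB hf (Measure.le_add_right (Measure.le_add_left le_rfl)))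

theorem spectralVector_smul (Φ : C(Y, ℂ) →⋆ₐ[ℂ] (K →L[ℂ] K)) {B : Set Y} (hB : MeasurableSet B)
    (c : ℂ) (φ : K) : spectralVector Φ hB (c • φ) = c • spectralVector Φ hB φ := by
  obtain ⟨f, hf⟩ := exists_seq_tendsto_indicator
    (vectorMeasure Φ φ + vectorMeasure Φ (c • φ)) hB
  refine tendsto_nhds_unique (tendsto_spectralVector Φ hB hf (Measure.le_add_left le_rfl)) ?_
  simp only [map_smul]
  exact (tendsto_spectralVector Φ hB hf (Measure.le_add_right le_rfl)).const_smul c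

/-- On a finite measure space, `L²` convergence to the indicator implies `L¹` convergence, so the
integrals `⟪φ, Φ(f_n) φ⟫` converge to the measure of `B`. -/
theorem inner_spectralVector (Φ : C(Y, ℂ) →⋆ₐ[ℂ] (K →L[ℂ] K)) {B : Set Y} (hB : MeasurableSet B)
    (φ : K) : ⟪φ, spectralVector Φ hB φ⟫_ℂ = ((vectorMeasure Φ φ).real B : ℂ) := by
  obtain ⟨f, hf⟩ := exists_seq_tendsto_indicator (vectorMeasure Φ φ) hB
  have h1 := Tendsto.inner (𝕜 := ℂ) (tendsto_const_nhds (x := φ)) (tendsto_spectralVector Φ hB hf le_rfl)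
  refine tendsto_nhds_unique h1 ?_
  simp only [← integral_vectorMeasure]
  have h2 : Integrable (B.indicator fun _ => (1 : ℂ)) (vectorMeasure Φ φ) :=
    (integrable_const _).indicator hB
  have h3 := tendsto_integral_of_L1' (μ := vectorMeasure Φ φ) _ h2.1 (F := fun n => f n)
    (l := atTop) (Eventually.of_forall fun n => integrable_continuousMap _ _) ?_
  · simpa [integral_indicator hB, Measure.real] using h3
  · have h4 : ∀ n, eLpNorm (⇑(f n) - B.indicator fun _ => (1 : ℂ)) 1 (vectorMeasure Φ φ) ≤
        eLpNorm (⇑(f n) - B.indicator fun _ => (1 : ℂ)) 2 (vectorMeasure Φ φ) *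
          (vectorMeasure Φ φ Set.univ) ^ (1 / (1 : ℝ≥0∞).toReal - 1 / (2 : ℝ≥0∞).toReal) :=
      fun n => eLpNorm_le_eLpNorm_mul_rpow_measure_univ (by norm_num)
        ((f n).continuous.aestronglyMeasurable.sub h2.1)
    refine tendsto_of_tendsto_of_tendsto_of_le_of_le tendsto_const_nhds ?_ (fun _ => zero_le) h4
    have h5 := ENNReal.Tendsto.mul_const (b := (vectorMeasure Φ φ Set.univ) ^
      (1 / (1 : ℝ≥0∞).toReal - 1 / (2 : ℝ≥0∞).toReal)) hf
      (Or.inr (ENNReal.rpow_ne_top_of_nonneg (by norm_num) (measure_ne_top _ _)))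
    rwa [zero_mul] at h5

theorem norm_spectralVector_le (Φ : C(Y, ℂ) →⋆ₐ[ℂ] (K →L[ℂ] K)) {B : Set Y}
    (hB : MeasurableSet B) (φ : K) : ‖spectralVector Φ hB φ‖ ≤ ‖φ‖ := by
  have h1 : (vectorMeasure Φ φ).real Set.univ = ‖φ‖ ^ 2 := by
    have h2 := integral_vectorMeasure Φ φ 1
    rw [map_one] at h2
    change ∫ _, (1 : ℂ) ∂(vectorMeasure Φ φ) = ⟪φ, φ⟫_ℂ at h2
    rw [integral_const, inner_self_eq_norm_sq_to_K, Complex.real_smul, mul_one] at h2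
    refine Complex.ofReal_injective ?_
    rw [h2, Complex.ofReal_pow]
    rfl
  refine (sq_le_sq₀ (norm_nonneg _) (norm_nonneg _)).1 ?_
  rw [norm_sq_spectralVector, ← h1]
  exact measureReal_mono (Set.subset_univ _)

theorem spectralVector_union (Φ : C(Y, ℂ) →⋆ₐ[ℂ] (K →L[ℂ] K)) {B C : Set Y} (hB : MeasurableSet B)
    (hC : MeasurableSet C) (hBC : Disjoint B C) (φ : K) :
    spectralVector Φ (hB.union hC) φ = spectralVector Φ hB φ + spectralVector Φ hC φ := by
  rw [spectralVector, indicatorConstLp_disjoint_union hB hC (measure_ne_top _ _)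
    (measure_ne_top _ _) hBC, map_add]
  rfl

/-- The operator `E(B)`, where `E` is the spectral measure of `Φ`. -/
def spectralProj (Φ : C(Y, ℂ) →⋆ₐ[ℂ] (K →L[ℂ] K)) {B : Set Y} (hB : MeasurableSet B) : K →L[ℂ] K :=
  LinearMap.mkContinuous
    { toFun := spectralVector Φ hB
      map_add' := spectralVector_add Φ hB
      map_smul' := spectralVector_smul Φ hB } 1
    fun φ => by rw [one_mul]; exact norm_spectralVector_le Φ hB φ

theorem spectralProj_apply (Φ : C(Y, ℂ) →⋆ₐ[ℂ] (K →L[ℂ] K)) {B : Set Y} (hB : MeasurableSet B)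
    (φ : K) : spectralProj Φ hB φ = spectralVector Φ hB φ := rfl

/-- The quadratic form is real, so `E(B)` is self-adjoint. Then `⟪E(B)² φ, φ⟫ = ‖E(B) φ‖² = μ(B) =
⟪E(B) φ, φ⟫`, and polarization gives idempotence. -/
theorem isStarProjection_spectralProj (Φ : C(Y, ℂ) →⋆ₐ[ℂ] (K →L[ℂ] K)) {B : Set Y}
    (hB : MeasurableSet B) : IsStarProjection (spectralProj Φ hB) := by
  have h1 : IsSelfAdjoint (spectralProj Φ hB) := by
    rw [ContinuousLinearMap.isSelfAdjoint_iff_isSymmetric,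
      LinearMap.isSymmetric_iff_inner_map_self_real]
    intro φ
    rw [inner_conj_symm]
    change ⟪φ, spectralVector Φ hB φ⟫_ℂ = ⟪spectralVector Φ hB φ, φ⟫_ℂ
    rw [← inner_conj_symm, ← inner_conj_symm (spectralVector Φ hB φ) φ, inner_spectralVector]
    simp
  refine ⟨?_, h1⟩
  refine ContinuousLinearMap.coe_injective ((ext_inner_map _ _).1 fun φ => ?_)
  change ⟪spectralProj Φ hB (spectralProj Φ hB φ), φ⟫_ℂ = ⟪spectralProj Φ hB φ, φ⟫_ℂ
  conv_lhs => rw [← h1.star_eq]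
  rw [inner_star_left, h1.star_eq, inner_self_eq_norm_sq_to_K, spectralProj_apply]
  rw [← inner_conj_symm (spectralVector Φ hB φ) φ, inner_spectralVector,
    ← norm_sq_spectralVector Φ hB]
  simp

/-- The squared norm of the remainder after finitely many sets is the scalar measure of what is
left, so strong convergence reduces to countable additivity of `μ`. -/
theorem hasSum_spectralVector (Φ : C(Y, ℂ) →⋆ₐ[ℂ] (K →L[ℂ] K)) {B : ℕ → Set Y}
    (hB : ∀ i, MeasurableSet (B i)) (hd : Pairwise (Function.onFun Disjoint B)) (φ : K) :
    HasSum (fun i => spectralVector Φ (hB i) φ) (spectralVector Φ (MeasurableSet.iUnion hB) φ) := by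
  have hS : ∀ s : Finset ℕ, MeasurableSet (⋃ i ∈ s, B i) := fun s =>
    s.measurableSet_biUnion fun i _ => hB i
  have h1 : ∀ s : Finset ℕ, spectralVector Φ (hS s) φ = ∑ i ∈ s, spectralVector Φ (hB i) φ := by
    intro s
    induction s using Finset.induction_on with
    | empty =>
      rw [Finset.sum_empty, ← norm_eq_zero, ← sq_eq_zero_iff, norm_sq_spectralVector]
      simp
    | insert i s hi ih =>
      rw [Finset.sum_insert hi, ← ih, ← spectralVector_union Φ (hB i) (hS s)]
      · congr 1
        simp
      · rw [Set.disjoint_iUnion₂_right]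
        exact fun j hj => hd fun h => hi (h ▸ hj)
  have h2 : ∀ s : Finset ℕ, ‖∑ i ∈ s, spectralVector Φ (hB i) φ -
      spectralVector Φ (MeasurableSet.iUnion hB) φ‖ ^ 2 =
      (vectorMeasure Φ φ).real (⋃ i, B i) - ∑ i ∈ s, (vectorMeasure Φ φ).real (B i) := fun s => by
    have hsub : ⋃ i ∈ s, B i ⊆ ⋃ i, B i := Set.iUnion₂_subset fun i _ => Set.subset_iUnion B i
    have hD := (MeasurableSet.iUnion hB).diff (hS s)
    have h3 := spectralVector_union Φ (hS s) hD Set.disjoint_sdiff_right φ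
    have h4 : spectralVector Φ ((hS s).union hD) φ =
        spectralVector Φ (MeasurableSet.iUnion hB) φ := by
      congr 1
      exact Set.union_sdiff_cancel hsub
    rw [← h1, ← h4, h3, sub_add_cancel_left, norm_neg, norm_sq_spectralVector,
      measureReal_sdiff hsub (hS s), measureReal_biUnion_finset (fun i _ j _ hij => hd hij)
        fun i _ => hB i]
  have h5 : HasSum (fun i => (vectorMeasure Φ φ).real (B i))
      ((vectorMeasure Φ φ).real (⋃ i, B i)) := by
    rw [Measure.real, measure_iUnion hd hB, ENNReal.tsum_toReal_eq fun i => measure_ne_top _ _]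
    refine Summable.hasSum (ENNReal.summable_toReal ?_)
    rw [← measure_iUnion hd hB]
    exact measure_ne_top _ _
  rw [HasSum, tendsto_iff_norm_sub_tendsto_zero]
  have h6 : Tendsto (fun s : Finset ℕ => ‖∑ i ∈ s, spectralVector Φ (hB i) φ -
      spectralVector Φ (MeasurableSet.iUnion hB) φ‖ ^ 2) atTop (𝓝 0) := by
    simp only [h2]
    have h7 := h5.const_sub ((vectorMeasure Φ φ).real (⋃ i, B i))
    rwa [sub_self] at h7
  have h8 := h6.sqrt
  simpa using h8

open Classical in
/-- The spectral measure of a representation of `C(Y)`, transported along a measurable map. -/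
def spectralMeasureMap (Φ : C(Y, ℂ) →⋆ₐ[ℂ] (K →L[ℂ] K)) {Ω : Type*} [MeasurableSpace Ω] {s : Y → Ω}
    (hs : Measurable s) : SpectralMeasure Ω K where
  proj B := if hB : MeasurableSet B then spectralProj Φ (hs hB) else 0
  isStarProjection B hB := by
    rw [dif_pos hB]
    exact isStarProjection_spectralProj Φ _
  proj_univ := by
    rw [dif_pos MeasurableSet.univ]
    ext φ
    change cyclicMap Φ φ (indicatorConstLp 2 MeasurableSet.univ (measure_ne_top _ _) 1) = φ
    have h1 : indicatorConstLp 2 MeasurableSet.univ (measure_ne_top _ _) (1 : ℂ) =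
        ContinuousMap.toLp 2 (vectorMeasure Φ φ) ℂ 1 := by
      refine Lp.ext (indicatorConstLp_coeFn.trans ?_)
      refine EventuallyEq.trans ?_ (ContinuousMap.coeFn_toLp _ _).symm
      rw [Set.indicator_univ]
      rfl
    rw [h1, cyclicMap_toLp, map_one]
    rfl
  hasSum_iUnion B hB hd φ := by
    rw [dif_pos (MeasurableSet.iUnion hB)]
    have h1 := hasSum_spectralVector Φ (fun i => hs (hB i))
      (fun i j hij => (hd hij).preimage s) φ
    simp only [dif_pos (hB _), spectralProj_apply]
    convert h1 using 2
    exact Set.preimage_iUnion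

open Classical in
theorem scalarMeasure_spectralMeasureMap (Φ : C(Y, ℂ) →⋆ₐ[ℂ] (K →L[ℂ] K)) {Ω : Type*}
    [MeasurableSpace Ω] {s : Y → Ω} (hs : Measurable s) (φ : K) :
    (spectralMeasureMap Φ hs).scalarMeasure φ = (vectorMeasure Φ φ).map s := by
  refine Measure.ext fun B hB => ?_
  rw [SpectralMeasure.scalarMeasure, Measure.ofMeasurable_apply B hB, Measure.map_apply hs hB]
  change ENNReal.ofReal (⟪φ, (if hB : MeasurableSet B then spectralProj Φ (hs hB) else 0) φ⟫_ℂ).re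
    = _
  rw [dif_pos hB, spectralProj_apply, inner_spectralVector, Complex.ofReal_re, Measure.real,
    ENNReal.ofReal_toReal (measure_ne_top _ _)]

/-- The map `s` need only be measurable: what has to be continuous is the composite of `g` with `s`,
given here as `f`. -/
theorem isIntegral_spectralMeasureMap (Φ : C(Y, ℂ) →⋆ₐ[ℂ] (K →L[ℂ] K)) {Ω : Type*}
    [MeasurableSpace Ω] {s : Y → Ω} (hs : Measurable s) {g : Ω → ℂ} (hg : Measurable g)
    (f : C(Y, ℂ)) (hf : ∀ z, g (s z) = f z) : (spectralMeasureMap Φ hs).IsIntegral g (Φ f) := by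
  intro φ
  rw [scalarMeasure_spectralMeasureMap,
    integrable_map_measure hg.aestronglyMeasurable hs.aemeasurable,
    integral_map hs.aemeasurable hg.aestronglyMeasurable, show g ∘ s = f from funext hf,
    ← integral_vectorMeasure]
  exact ⟨integrable_continuousMap _ _, by simp only [hf]⟩

end SpectralTheorem


/-! ### Passage to a commutative C⋆-algebra -/

section Gelfand

/-- A commuting and star-commuting set in a C⋆-algebra lies in a commutative C⋆-subalgebra. -/
theorem exists_commCStarAlgebra {B : Type u} [CStarAlgebra B] (s : Set B)
    (h : ∀ a ∈ s, ∀ b ∈ s, a * b = b * a) (h' : ∀ a ∈ s, ∀ b ∈ s, a * star b = star b * a) :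
    ∃ (A : Type u) (_ : CommCStarAlgebra A) (j : A →⋆ₐ[ℂ] B), Function.Injective j ∧
      ∀ b ∈ s, ∃ a, j a = b := by
  let S := StarAlgebra.adjoin ℂ s
  have hS : ∀ x y : S, x * y = y * x := (StarAlgebra.isMulCommutative_adjoin ℂ h h').is_comm.comm
  let _ := S.commRingTopologicalClosure hS
  have : IsClosed (S.topologicalClosure : Set B) := S.isClosed_topologicalClosure
  let C : CStarAlgebra S.topologicalClosure := inferInstance
  refine ⟨S.topologicalClosure, { C with mul_comm := mul_comm }, S.topologicalClosure.subtype,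
    Subtype.val_injective, fun b hb => ⟨⟨b, S.le_topologicalClosure ?_⟩, rfl⟩⟩
  exact StarAlgebra.subset_adjoin ℂ s hb

end Gelfand

/-! ### Points of the sphere recovered from products of coordinates -/

section RankOne

/-- The relations among the numbers `z_k z_l` and `z_k conj(z_l)`, for `z` in the unit sphere. -/
structure RankOne {d : ℕ} (Z W : Fin d → Fin d → ℂ) : Prop where
  conj_W : ∀ k l, starRingEnd ℂ (W k l) = W l k
  W_mul_W : ∀ k l m n, W k m * W l n = Z k l * starRingEnd ℂ (Z m n)
  Z_symm : ∀ k l, Z k l = Z l k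
  sum_W : ∑ k, W k k = 1

namespace RankOne

variable {d : ℕ} {Z W : Fin d → Fin d → ℂ}

theorem of_sphere (z : Sphere d) :
    RankOne (fun k l => z.1 k * z.1 l) (fun k l => z.1 k * starRingEnd ℂ (z.1 l)) where
  conj_W k l := by simp [mul_comm]
  W_mul_W k l m n := by simp only [map_mul]; ring
  Z_symm k l := mul_comm _ _
  sum_W := by
    have h : ‖z.1‖ ^ 2 = 1 := by rw [mem_sphere_zero_iff_norm.1 z.2, one_pow]
    rw [EuclideanSpace.norm_sq_eq] at h
    simp only [Complex.mul_conj, Complex.normSq_eq_norm_sq]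
    exact_mod_cast h

theorem exists_W_ne_zero (h : RankOne Z W) : ∃ m, W m m ≠ 0 := by
  by_contra! h1
  have h2 := h.sum_W
  simp [h1] at h2

theorem ofReal_re_W (h : RankOne Z W) (m : Fin d) : ((W m m).re : ℂ) = W m m :=
  Complex.conj_eq_iff_re.1 (h.conj_W m m)

/-- Multiplying by `1 = ∑ W k k` turns `W m m` into `∑ |Z k m|²`. -/
theorem re_W_nonneg (h : RankOne Z W) (m : Fin d) : 0 ≤ (W m m).re := by
  have h1 : W m m = ∑ k, ((‖Z k m‖ ^ 2 : ℝ) : ℂ) := by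
    rw [← one_mul (W m m), ← h.sum_W, Finset.sum_mul]
    refine Finset.sum_congr rfl fun k _ => ?_
    rw [h.W_mul_W, Complex.mul_conj, Complex.normSq_eq_norm_sq]
  rw [h1, ← Complex.ofReal_sum, Complex.ofReal_re]
  positivity

/-- The point of the sphere, up to a sign, recovered from its products. -/
def point (Z W : Fin d → Fin d → ℂ) (m : Fin d) : EuclideanSpace ℂ (Fin d) :=
  WithLp.toLp 2 fun k => (Z m m / W m m) ^ (2⁻¹ : ℂ) * W k m / (Real.sqrt (W m m).re : ℂ)

/-- If `Z` and `W` come from `z`, then the square root in `point` is `± z_m / |z_m|` and `W k m /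
√(W m m)` is `z_k conj(z_m) / |z_m|`, so the product is `± z_k`. In general the relation `W_mul_W`
replaces this computation. -/
theorem point_mul_point (h : RankOne Z W) {m : Fin d} (hm : W m m ≠ 0) (k l : Fin d) :
    point Z W m k * point Z W m l = Z k l := by
  have hr : (Real.sqrt (W m m).re : ℂ) * (Real.sqrt (W m m).re : ℂ) = W m m := by
    rw [← Complex.ofReal_mul, Real.mul_self_sqrt (h.re_W_nonneg m), h.ofReal_re_W]
  have hu : (Z m m / W m m) ^ (2⁻¹ : ℂ) * (Z m m / W m m) ^ (2⁻¹ : ℂ) = Z m m / W m m := by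
    rw [← sq]
    exact Complex.cpow_nat_inv_pow _ two_ne_zero
  calc point Z W m k * point Z W m l = ((Z m m / W m m) ^ (2⁻¹ : ℂ) * (Z m m / W m m) ^ (2⁻¹ : ℂ)) *
        (W k m * W l m) / ((Real.sqrt (W m m).re : ℂ) * (Real.sqrt (W m m).re : ℂ)) := by
        simp only [point]; ring
    _ = Z k l * (Z m m * starRingEnd ℂ (Z m m)) / (W m m * W m m) := by
        rw [hu, hr, h.W_mul_W]; ring
    _ = Z k l := by
        rw [← h.W_mul_W, mul_div_assoc, div_self (mul_ne_zero hm hm), mul_one]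

theorem point_mul_conj_point (h : RankOne Z W) {m : Fin d} (hm : W m m ≠ 0) (k l : Fin d) :
    point Z W m k * starRingEnd ℂ (point Z W m l) = W k l := by
  have hr : (Real.sqrt (W m m).re : ℂ) * (Real.sqrt (W m m).re : ℂ) = W m m := by
    rw [← Complex.ofReal_mul, Real.mul_self_sqrt (h.re_W_nonneg m), h.ofReal_re_W]
  have hu : (Z m m / W m m) ^ (2⁻¹ : ℂ) * (Z m m / W m m) ^ (2⁻¹ : ℂ) = Z m m / W m m := by
    rw [← sq]
    exact Complex.cpow_nat_inv_pow _ two_ne_zero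
  set u := (Z m m / W m m) ^ (2⁻¹ : ℂ)
  have hu1 : u * starRingEnd ℂ u = 1 := by
    have h1 : (u * starRingEnd ℂ u) * (u * starRingEnd ℂ u) = 1 := by
      calc _ = (u * u) * starRingEnd ℂ (u * u) := by rw [map_mul]; ring
        _ = (Z m m * starRingEnd ℂ (Z m m)) / (W m m * W m m) := by
          rw [hu, map_div₀, h.conj_W, div_mul_div_comm]
        _ = 1 := by rw [← h.W_mul_W, div_self (mul_ne_zero hm hm)]
    rw [Complex.mul_conj] at h1 ⊢
    have h2 : Complex.normSq u * Complex.normSq u = 1 := by exact_mod_cast h1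
    have h3 := (mul_self_eq_one_iff.1 h2).resolve_right
      (by linarith [Complex.normSq_nonneg u])
    rw [h3, Complex.ofReal_one]
  calc point Z W m k * starRingEnd ℂ (point Z W m l) = (u * starRingEnd ℂ u) *
        (W k m * W m l) / ((Real.sqrt (W m m).re : ℂ) * (Real.sqrt (W m m).re : ℂ)) := by
        simp only [point, map_mul, map_div₀, h.conj_W, Complex.conj_ofReal]; ring
    _ = W k l * W m m / W m m := by
        rw [hu1, hr, one_mul, h.W_mul_W, h.W_mul_W, h.Z_symm l m]
    _ = W k l := by rw [mul_div_assoc, div_self hm, mul_one]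

theorem norm_point (h : RankOne Z W) {m : Fin d} (hm : W m m ≠ 0) : ‖point Z W m‖ = 1 := by
  have h1 : ‖point Z W m‖ ^ 2 = 1 := by
    have h2 := h.sum_W
    simp only [← h.point_mul_conj_point hm, Complex.mul_conj, Complex.normSq_eq_norm_sq] at h2
    rw [EuclideanSpace.norm_sq_eq]
    exact_mod_cast h2
  exact (pow_eq_one_iff_of_nonneg (norm_nonneg _) two_ne_zero).1 h1

end RankOne

/-- The set of all values of the products `z_k z_l`, `z_k conj(z_l)` on the unit sphere. -/
abbrev ProductSpectrum (d : ℕ) : Type :=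
  {p : (Fin d → Fin d → ℂ) × (Fin d → Fin d → ℂ) // RankOne p.1 p.2}

namespace ProductSpectrum

variable {d : ℕ}

/-- The products of the coordinates of a point. -/
def ofSphere (z : Sphere d) : ProductSpectrum d :=
  ⟨(fun k l => z.1 k * z.1 l, fun k l => z.1 k * starRingEnd ℂ (z.1 l)), RankOne.of_sphere z⟩

theorem continuous_ofSphere : Continuous (ofSphere (d := d)) := by
  refine Continuous.subtype_mk (Continuous.prodMk ?_ ?_) _ <;>
  · refine continuous_pi fun k => continuous_pi fun l => ?_
    fun_prop

theorem surjective_ofSphere : Function.Surjective (ofSphere (d := d)) := by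
  intro p
  obtain ⟨m, hm⟩ := p.2.exists_W_ne_zero
  refine ⟨⟨RankOne.point p.1.1 p.1.2 m, mem_sphere_zero_iff_norm.2 (p.2.norm_point hm)⟩, ?_⟩
  refine Subtype.ext (Prod.ext ?_ ?_)
  · exact funext fun k => funext fun l => p.2.point_mul_point hm k l
  · exact funext fun k => funext fun l => p.2.point_mul_conj_point hm k l

instance : CompactSpace (ProductSpectrum d) :=
  isCompact_univ_iff.1 (surjective_ofSphere.range_eq ▸ isCompact_range continuous_ofSphere)

/-- The points `z` and `-z` have the same products. Taking the smallest `m` with `W m m ≠ 0` and the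
principal square root in `point` selects one of them measurably. -/
theorem exists_measurable_section :
    ∃ s : ProductSpectrum d → Sphere d, Measurable s ∧ ∀ p, ofSphere (s p) = p := by
  classical
  let q : ℕ → ProductSpectrum d → Prop := fun n p => ∃ h : n < d, p.1.2 ⟨n, h⟩ ⟨n, h⟩ ≠ 0
  have hq : ∀ p, ∃ n, q n p := fun p => by
    obtain ⟨m, hm⟩ := p.2.exists_W_ne_zero
    exact ⟨m, m.2, hm⟩
  let f : ℕ → ProductSpectrum d → EuclideanSpace ℂ (Fin d) := fun n p =>
    if h : n < d then RankOne.point p.1.1 p.1.2 ⟨n, h⟩ else 0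
  have hW : ∀ k l : Fin d, Measurable fun p : ProductSpectrum d => p.1.2 k l := fun k l =>
    (by fun_prop : Continuous fun p : ProductSpectrum d => p.1.2 k l).measurable
  have hZ : ∀ k l : Fin d, Measurable fun p : ProductSpectrum d => p.1.1 k l := fun k l =>
    (by fun_prop : Continuous fun p : ProductSpectrum d => p.1.1 k l).measurable
  have hf : ∀ n, Measurable (f n) := fun n => by
    by_cases h : n < d
    · simp only [f, dif_pos h]
      refine (WithLp.measurable_toLp 2 _).comp (measurable_pi_lambda _ fun k => ?_)
      refine Measurable.div (Measurable.mul (Measurable.pow_const ?_ _) (hW _ _)) ?_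
      · exact (hZ _ _).div (hW _ _)
      · exact Complex.measurable_ofReal.comp (Complex.measurable_re.comp (hW _ _)).sqrt
    · simp only [f, dif_neg h]
      exact measurable_const
  have hqm : ∀ n, MeasurableSet {p | q n p} := fun n => by
    by_cases h : n < d
    · simp only [q, h, exists_true_left]
      exact (hW _ _) (measurableSet_singleton (0 : ℂ)).compl
    · simp [q, h]
  have hs : ∀ p, ∃ m, p.1.2 m m ≠ 0 ∧ f (Nat.find (hq p)) p = RankOne.point p.1.1 p.1.2 m :=
    fun p => by
      obtain ⟨h, hm⟩ := Nat.find_spec (hq p)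
      exact ⟨_, hm, dif_pos h⟩
  have hs1 : ∀ p, f (Nat.find (hq p)) p ∈ Metric.sphere (0 : EuclideanSpace ℂ (Fin d)) 1 :=
    fun p => by
      obtain ⟨m, hm, h⟩ := hs p
      rw [h]
      exact mem_sphere_zero_iff_norm.2 (p.2.norm_point hm)
  refine ⟨fun p => ⟨f (Nat.find (hq p)) p, hs1 p⟩, (Measurable.find hf hqm hq).subtype_mk,
    fun p => ?_⟩
  · obtain ⟨m, hm, h⟩ := hs p
    refine Subtype.ext (Prod.ext ?_ ?_) <;> funext k l
    · change f _ p k * f _ p l = _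
      rw [h]
      exact p.2.point_mul_point hm k l
    · change f _ p k * starRingEnd ℂ (f _ p l) = _
      rw [h]
      exact p.2.point_mul_conj_point hm k l

end ProductSpectrum

end RankOne

/-! ### Commuting operators with the relations of the sphere -/

section Classical

variable {d : ℕ} {K : Type*} [NormedAddCommGroup K] [InnerProductSpace ℂ K] [CompleteSpace K]

-- The relations make the `Z` and `W` commute with each other and with their adjoints; normality of
-- `Z` comes from the two orders of `W_mul_W` and `W_mul_W'`. Characters of the generated algebra
-- evaluate to points of `ProductSpectrum d`, and pulling functions back along this map, followed by
-- the inverse Gelfand transform, is `Φ`.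
open WeakDual in
theorem exists_productSpectrum_rep {Z W : Fin d → Fin d → K →L[ℂ] K}
    (star_W : ∀ k l, star (W k l) = W l k)
    (Z_symm : ∀ k l, Z k l = Z l k)
    (W_mul_W : ∀ k l m n, W k m * W l n = Z k l * star (Z m n))
    (W_mul_W' : ∀ k l m n, W k m * W l n = star (Z m n) * Z k l)
    (Z_mul_W : ∀ k l m n, Z k l * W m n = W m n * Z k l)
    (Z_mul_Z : ∀ k l m n, Z k l * Z m n = Z m n * Z k l)
    (sum_W : ∑ k, W k k = 1) :
    ∃ Φ : C(ProductSpectrum d, ℂ) →⋆ₐ[ℂ] (K →L[ℂ] K),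
      (∀ k l, Φ ⟨fun p => p.1.1 k l, by fun_prop⟩ = Z k l) ∧
      ∀ k l, Φ ⟨fun p => p.1.2 k l, by fun_prop⟩ = W k l := by
  let _ : CStarAlgebra (K →L[ℂ] K) := {}
  have WW : ∀ k l m n, W k m * W l n = W l n * W k m := fun k l m n => by
    rw [W_mul_W, W_mul_W, Z_symm k l, Z_symm m n]
  have ZZ : ∀ k l m n, Z k l * star (Z m n) = star (Z m n) * Z k l := fun k l m n => by
    rw [← W_mul_W, W_mul_W']
  have WZ : ∀ k l m n, W m n * star (Z k l) = star (Z k l) * W m n := fun k l m n => by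
    have h := congrArg star (Z_mul_W k l n m)
    rwa [star_mul, star_mul, star_W] at h
  obtain ⟨A, _, j, hj, hs⟩ := exists_commCStarAlgebra
    (Set.range (fun p : Fin d × Fin d => Z p.1 p.2) ∪ Set.range (fun p : Fin d × Fin d => W p.1 p.2))
    (by
      rintro _ (⟨p, rfl⟩ | ⟨p, rfl⟩) _ (⟨q, rfl⟩ | ⟨q, rfl⟩)
      · exact Z_mul_Z _ _ _ _
      · exact Z_mul_W _ _ _ _
      · exact (Z_mul_W _ _ _ _).symm
      · exact WW _ _ _ _)
    (by
      rintro _ (⟨p, rfl⟩ | ⟨p, rfl⟩) _ (⟨q, rfl⟩ | ⟨q, rfl⟩)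
      · exact ZZ _ _ _ _
      · simp only [star_W]
        exact Z_mul_W _ _ _ _
      · exact WZ _ _ _ _
      · simp only [star_W]
        exact WW _ _ _ _)
  choose z hz using fun k l => hs (Z k l) (Or.inl ⟨(k, l), rfl⟩)
  choose w hw using fun k l => hs (W k l) (Or.inr ⟨(k, l), rfl⟩)
  have hR : ∀ χ : characterSpace ℂ A, RankOne (fun k l => χ (z k l)) (fun k l => χ (w k l)) :=
    fun χ =>
    { conj_W := fun k l => by
        have h1 : star (w k l) = w l k := hj (by rw [map_star, hw, hw, star_W])
        rw [← h1, map_star]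
        rfl
      W_mul_W := fun k l m n => by
        have h1 : w k m * w l n = z k l * star (z m n) := hj (by
          rw [map_mul, map_mul, map_star, hw, hw, hz, hz, W_mul_W])
        rw [← map_mul, h1, map_mul, map_star]
        rfl
      Z_symm := fun k l => congrArg χ (hj (by rw [hz, hz, Z_symm]))
      sum_W := by
        have h1 : ∑ k, w k k = 1 := hj (by
          rw [map_sum, map_one, ← sum_W]
          exact Finset.sum_congr rfl fun k _ => hw k k)
        rw [← map_sum, h1, map_one] }
  let p : C(characterSpace ℂ A, ProductSpectrum d) :=
    ⟨fun χ => ⟨(fun k l => χ (z k l), fun k l => χ (w k l)), hR χ⟩, by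
      refine Continuous.subtype_mk (Continuous.prodMk ?_ ?_) _ <;>
      · refine continuous_pi fun k => continuous_pi fun l => ?_
        exact (gelfandTransform ℂ A _).continuous⟩
  have hg : ∀ (a : A) (f : C(characterSpace ℂ A, ℂ)), (∀ χ, f χ = χ a) →
      (gelfandStarTransform A).symm f = a := fun a f hf => by
    rw [show f = gelfandStarTransform A a from ContinuousMap.ext hf]
    exact (gelfandStarTransform A).symm_apply_apply a
  refine ⟨(j.comp (gelfandStarTransform A).symm.toStarAlgHom).comp
    (ContinuousMap.compStarAlgHom' ℂ ℂ p), fun k l => ?_, fun k l => ?_⟩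
  · rw [← hz]
    exact congrArg j (hg _ _ fun χ => rfl)
  · rw [← hw]
    exact congrArg j (hg _ _ fun χ => rfl)

end Classical


/-! ### The part where `y_0` vanishes -/

section Infinity

variable {K : Type*} [NormedAddCommGroup K] [InnerProductSpace ℂ K] [CompleteSpace K]
variable {d : ℕ} {α : ℝ}

/-- A representation of the relations with `y_0 = 0` is given by a spectral measure on the
sphere. -/
theorem AuxRelations.exists_spectralMeasure {x : Index d → Index d → K →L[ℂ] K}
    {y : ℕ → K →L[ℂ] K} (h : AuxRelations α x y) (hy : y 0 = 0) :
    ∃ E : SpectralMeasure (Sphere d) K, ∀ k l : Fin d,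
      E.IsIntegral (fun z => z.1 k * z.1 l) (x (.pos k) (.pos l)) ∧
      E.IsIntegral (fun z => z.1 k * starRingEnd ℂ (z.1 l)) (x (.pos k) (.neg l)) ∧
      E.IsIntegral (fun z => z.1 k * starRingEnd ℂ (z.1 l)) (x (.neg l) (.pos k)) ∧
      E.IsIntegral (fun z => starRingEnd ℂ (z.1 k) * starRingEnd ℂ (z.1 l))
        (x (.neg k) (.neg l)) := by
  -- Setting `y_0 = 0` removes the contraction terms and turns `1 + 2 y_0` into `1`, leaving the
  -- relations of commuting coordinates.
  have hWW : ∀ k l m n, x (.pos k) (.neg m) * x (.pos l) (.neg n) =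
      x (.pos k) (.pos l) * star (x (.pos m) (.pos n)) := fun k l m n => by
    rw [h.W_mul_W, h.neg_neg, hy]
    simp
  have hWW' : ∀ k l m n, x (.pos k) (.neg m) * x (.pos l) (.neg n) =
      star (x (.pos m) (.pos n)) * x (.pos k) (.pos l) := fun k l m n => by
    rw [h.W_mul_W', h.neg_neg, hy, mul_zero, add_zero]
  have hZW : ∀ k l m n, x (.pos k) (.pos l) * x (.pos m) (.neg n) =
      x (.pos m) (.neg n) * x (.pos k) (.pos l) := fun k l m n => by
    have h1 := h.Z_mul_W k l m n
    rwa [hy, smul_zero, add_zero, one_mul, zero_mul, add_zero] at h1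
  have hsum : ∑ k, x (.pos k) (.neg k) = 1 := by
    rw [h.sum_pos_neg, hy, smul_zero, add_zero]
  obtain ⟨Φ, hZ, hW⟩ := exists_productSpectrum_rep (Z := fun k l => x (.pos k) (.pos l))
    (W := fun k l => x (.pos k) (.neg l)) h.star_pos_neg h.pos_pos_comm hWW hWW' hZW h.Z_comm hsum
  -- The section lifts the measure to the sphere; the integrands are even in `z`, so the choice of
  -- sign does not affect the integrals.
  obtain ⟨s, hs, hsp⟩ := ProductSpectrum.exists_measurable_section (d := d)
  have hsZ : ∀ p k l, (s p).1 k * (s p).1 l = p.1.1 k l := fun p k l =>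
    congrArg (fun p : ProductSpectrum d => p.1.1 k l) (hsp p)
  have hsW : ∀ p k l, (s p).1 k * starRingEnd ℂ ((s p).1 l) = p.1.2 k l := fun p k l =>
    congrArg (fun p : ProductSpectrum d => p.1.2 k l) (hsp p)
  have hW' : ∀ k l, (spectralMeasureMap Φ hs).IsIntegral
      (fun z => z.1 k * starRingEnd ℂ (z.1 l)) (x (.pos k) (.neg l)) := fun k l => by
    rw [← hW]
    refine isIntegral_spectralMeasureMap Φ hs (Continuous.measurable (by fun_prop)) _ fun p => ?_
    exact hsW p k l
  refine ⟨spectralMeasureMap Φ hs, fun k l => ⟨?_, hW' k l, ?_, ?_⟩⟩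
  · rw [← hZ]
    refine isIntegral_spectralMeasureMap Φ hs (Continuous.measurable (by fun_prop)) _ fun p => ?_
    exact hsZ p k l
  · rw [h.neg_pos, hy, smul_zero, sub_zero]
    exact hW' k l
  · rw [h.neg_neg, ← hZ, ← map_star]
    refine isIntegral_spectralMeasureMap Φ hs (Continuous.measurable (by fun_prop)) _ fun p => ?_
    rw [← map_mul, hsZ]
    rfl

variable {A : Type*} [Ring A] [Algebra ℂ A] [StarRing A]

theorem AuxRelations.apply_eq_zero {x : Index d → Index d → A} {y : ℕ → A}
    (h : AuxRelations α x y) (R : A →⋆ₐ[ℂ] (K →L[ℂ] K)) (hy : R (y 0) = 0) :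
    (∀ n, R (y n) = 0) ∧ ∀ k, R (x k .zero) = 0 ∧ R (x .zero k) = 0 := by
  have hm := h.map R
  have h0 : ∀ φ, R (y 0) φ = 0 := fun φ => by rw [hy]; rfl
  have hX : ∀ k, R (x (.pos k) .zero) = 0 := fun k =>
    ContinuousLinearMap.ext fun φ => hm.X_apply_eq_zero (h0 φ) k
  have hX' : ∀ k, R (star (x (.pos k) .zero)) = 0 := fun k => by rw [map_star, hX, star_zero]
  refine ⟨fun n => ContinuousLinearMap.ext fun φ => hm.y_apply_eq_zero (h0 φ) n, fun k => ?_⟩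
  cases k with
  | zero => rw [h.zero_zero]; exact ⟨hy, hy⟩
  | pos k => rw [h.zero_pos]; exact ⟨hX k, hX k⟩
  | neg k => rw [h.neg_zero, h.zero_neg]; exact ⟨hX' k, hX' k⟩

theorem apply_eq_zero_of_isRestriction {H : Type*} [NormedAddCommGroup H] [InnerProductSpace ℂ H]
    [CompleteSpace H] {P : A →⋆ₐ[ℂ] (H →L[ℂ] H)} {G : Submodule ℂ H} [CompleteSpace G]
    {Q : A →⋆ₐ[ℂ] (G →L[ℂ] G)} (hQ : IsRestriction P G Q) {t : A} (hG : G ≤ (P t).ker) :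
    Q t = 0 :=
  ContinuousLinearMap.ext fun φ => Subtype.ext ((hQ t φ).trans (hG φ.2))

theorem ker_eq_bot_of_isRestriction {H : Type*} [NormedAddCommGroup H] [InnerProductSpace ℂ H]
    [CompleteSpace H] {P : A →⋆ₐ[ℂ] (H →L[ℂ] H)} {G : Submodule ℂ H} [CompleteSpace G]
    {Q : A →⋆ₐ[ℂ] (G →L[ℂ] G)} (hQ : IsRestriction P G Q) {t : A} (hG : G ⟂ (P t).ker) :
    (Q t).ker = ⊥ := by
  rw [Submodule.eq_bot_iff]
  intro φ hφ
  have h1 : P t φ = 0 := by rw [← hQ, show Q t φ = 0 from hφ, Submodule.coe_zero]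
  have h2 : (φ : H) ∈ G ⊓ (P t).ker := ⟨φ.2, h1⟩
  rw [hG.disjoint.eq_bot] at h2
  exact Subtype.ext h2

end Infinity

/-! ### Assembly -/

section Assembly

theorem exists_extendsTo_of_relations {A : Type*} [Ring A] [Algebra ℂ A] [StarRing A]
    {H : Type*} [NormedAddCommGroup H] [InnerProductSpace ℂ H] [CompleteSpace H]
    {D : Submodule ℂ H} (hD : Dense (D : Set H)) (π : StarRep A D) {d : ℕ} {α : ℝ}
    {x : Index d → Index d → A} {y : ℕ → A} (hα : 0 < α) (h : AuxRelations α x y)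
    (hg : Generates x y) : ∃ P, π.ExtendsTo P :=
  π.exists_extendsTo hD (π.mem_bdd hα h hg)

theorem exists_identityRep (d : ℕ) {α : ℝ} (hα : 0 < α) : ∃ ρ, (tautRep d α).ExtendsTo ρ :=
  exists_extendsTo_of_relations (dense_fockDomain d) (tautRep d α) hα (auxRelations d hα)
    (auxAlgebra_generates d hα)

variable {d : ℕ} {α : ℝ}
variable {H : Type u} [NormedAddCommGroup H] [InnerProductSpace ℂ H] [CompleteSpace H]
variable (P : auxAlgebra d α →⋆ₐ[ℂ] (H →L[ℂ] H))

theorem H1_isOrtho_Hinf (hα : 0 < α) (hα1 : α ≠ 1) : H1 P ⟂ Hinf P := by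
  rw [H1_eq_orthogonal P hα hα1]
  exact (Submodule.isOrtho_orthogonal_right _).symm

theorem H1_sup_Hinf (hα : 0 < α) (hα1 : α ≠ 1) : H1 P ⊔ Hinf P = ⊤ := by
  rw [H1_eq_orthogonal P hα hα1, sup_comm]
  exact Submodule.sup_orthogonal_of_hasOrthogonalProjection

theorem exists_isRestriction_H1 (hα : 0 < α) (hα1 : α ≠ 1) :
    ∃ Q : auxAlgebra d α →⋆ₐ[ℂ] (H1 P →L[ℂ] H1 P), IsRestriction P (H1 P) Q :=
  exists_isRestriction P (H1 P) fun t φ hφ => by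
    rw [H1_eq_orthogonal P hα hα1] at hφ ⊢
    exact apply_mem_orthogonal P (apply_mem_Hinf P hα) t φ hφ

set_option maxHeartbeats 1000000 in
theorem exists_decomposition (hα : 0 < α) (hα1 : α ≠ 1)
    {ρ : auxAlgebra d α →⋆ₐ[ℂ] (Fock d →L[ℂ] Fock d)} (hρ : (tautRep d α).ExtendsTo ρ) :
      H1 P ⟂ Hinf P ∧ H1 P ⊔ Hinf P = ⊤ ∧
      ∃ (π₁ : auxAlgebra d α →⋆ₐ[ℂ] (H1 P →L[ℂ] H1 P))
        (πinf : auxAlgebra d α →⋆ₐ[ℂ] (Hinf P →L[ℂ] Hinf P)),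
        IsRestriction P (H1 P) π₁ ∧ IsRestriction P (Hinf P) πinf ∧
        (∃ ι : Type u, IsSumOfCopies ρ π₁ ι) ∧
        (∀ n : ℕ, πinf (y α n) = 0) ∧
        (∀ k : Index d, πinf (x α k .zero) = 0 ∧ πinf (x α .zero k) = 0) ∧
        ∃ E : SpectralMeasure (Sphere d) (Hinf P), ∀ k l : Fin d,
          E.IsIntegral (fun z => z.1 k * z.1 l) (πinf (x α (.pos k) (.pos l))) ∧
          E.IsIntegral (fun z => z.1 k * starRingEnd ℂ (z.1 l)) (πinf (x α (.pos k) (.neg l))) ∧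
          E.IsIntegral (fun z => z.1 k * starRingEnd ℂ (z.1 l)) (πinf (x α (.neg l) (.pos k))) ∧
          E.IsIntegral (fun z => starRingEnd ℂ (z.1 k) * starRingEnd ℂ (z.1 l))
            (πinf (x α (.neg k) (.neg l))) := by
  have h := auxRelations d hα
  obtain ⟨π₁, hπ₁⟩ := exists_isRestriction_H1 P hα hα1
  obtain ⟨πinf, hπinf⟩ := exists_isRestriction P (Hinf P) (apply_mem_Hinf P hα)
  have horth := H1_isOrtho_Hinf P hα hα1
  have hy : πinf (y α 0) = 0 := apply_eq_zero_of_isRestriction hπinf le_rfl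
  have hz := h.apply_eq_zero πinf hy
  refine ⟨horth, H1_sup_Hinf P hα hα1, π₁, πinf, hπ₁, hπinf, ?_, hz.1, hz.2,
    (h.map πinf).exists_spectralMeasure hy⟩
  -- As `H_1` is orthogonal to `ker y_0`, the restricted `y_0` is injective, which is what the
  -- splitting into copies requires.
  exact isSumOfCopies_of_ker_eq_bot hα hα1 h (auxAlgebra_generates d hα) ρ (apply_y_vacuum ρ hρ)
    (norm_fockBasis 0) (denseRange_apply_vacuum hα hα1 ρ hρ) π₁
    (ker_eq_bot_of_isRestriction hπ₁ horth)

end Assembly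

end WeylAux
end

open WeylAux

set_option maxHeartbeats 1000000 in
theorem mainTheorem2 (d : ℕ) (hd : 1 ≤ d) (α : ℝ) (hα : 0 < α) (hαZ : ∀ m : ℤ, α ≠ m)
    {H : Type u} [NormedAddCommGroup H] [InnerProductSpace ℂ H] [CompleteSpace H]
    (D : Submodule ℂ H) (hD : Dense (D : Set H)) (π : StarRep (auxAlgebra d α) D) :
    (∀ x : auxAlgebra d α, ∃ C : ℝ, ∀ φ : D, ‖π.toAlgHom x φ‖ ≤ C * ‖φ‖) ∧
    ∃ ρ : auxAlgebra d α →⋆ₐ[ℂ] (Fock d →L[ℂ] Fock d), (tautRep d α).ExtendsTo ρ ∧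
    ∃ P : auxAlgebra d α →⋆ₐ[ℂ] (H →L[ℂ] H), π.ExtendsTo P ∧
      H1 P ⟂ Hinf P ∧ H1 P ⊔ Hinf P = ⊤ ∧
      ∃ (π₁ : auxAlgebra d α →⋆ₐ[ℂ] (H1 P →L[ℂ] H1 P))
        (πinf : auxAlgebra d α →⋆ₐ[ℂ] (Hinf P →L[ℂ] Hinf P)),
        IsRestriction P (H1 P) π₁ ∧ IsRestriction P (Hinf P) πinf ∧
        (∃ ι : Type u, IsSumOfCopies ρ π₁ ι) ∧
        (∀ n : ℕ, πinf (y α n) = 0) ∧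
        (∀ k : Index d, πinf (x α k .zero) = 0 ∧ πinf (x α .zero k) = 0) ∧
        ∃ E : SpectralMeasure (Sphere d) (Hinf P), ∀ k l : Fin d,
          E.IsIntegral (fun z => z.1 k * z.1 l) (πinf (x α (.pos k) (.pos l))) ∧
          E.IsIntegral (fun z => z.1 k * starRingEnd ℂ (z.1 l)) (πinf (x α (.pos k) (.neg l))) ∧
          E.IsIntegral (fun z => z.1 k * starRingEnd ℂ (z.1 l)) (πinf (x α (.neg l) (.pos k))) ∧
          E.IsIntegral (fun z => starRingEnd ℂ (z.1 k) * starRingEnd ℂ (z.1 l))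
            (πinf (x α (.neg k) (.neg l))) := by
  have hα1 : α ≠ 1 := fun h => hαZ 1 (by simpa using h)
  obtain ⟨ρ, hρ⟩ := exists_identityRep d hα
  obtain ⟨P, hP⟩ := exists_extendsTo_of_relations hD π hα (auxRelations d hα)
    (auxAlgebra_generates d hα)
  exact ⟨π.mem_bdd hα (auxRelations d hα) (auxAlgebra_generates d hα), ρ, hρ, P, hP,
    exists_decomposition P hα hα1 hρ⟩
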